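/- Let $\mathbb G$ be a Carnot group of step 2 and topological dimension $n$ whose second layer has dimension $1$; that is, its Lie algebra is $\mathfrak g=V_1\oplus V_2$ with $[V_1,V_1]=V_2$, $[V_1,V_2]=0$ and $\dim V_2=1$. By exponential coordinates with respect to any basis $e_1,\dots,e_n$ of $\mathfrak g$ with $e_1,\dots,e_{n-1}\in V_1$ and $e_n\in V_2$, identify $\mathbb G$ with $\mathbb R^n$, with product $p\cdot q=p+q+\tfrac12[p,q]$ and dilations $\delta_\lambda(x_1,\dots,x_n)=(\lambda x_1,\dots,\lambda x_{n-1},\lambda^2x_n)$, $\lambda>0$. A metric $d$ on $\mathbb G$ is homogeneous if $d(p\cdot q,p\cdot q')=d(q,q')$ and $d(\delta_\lambda p,\delta_\lambda q)=\lambda\,d(p,q)$ for all $p,q,q'\in\mathbb G$ and $\lambda>0$. For $u\in\mathbb R^{n-1}$ let $I_u=\{t(u,1):0\le t\le (|u|^2+1)^{-1/2}\}\subset\mathbb R^n$, where $|\cdot|$ is the Euclidean norm. A set $K\subset\mathbb G$ is a bounded LT-Kakeya set if there are $R,r>0$ such that for every $u\in\mathbb R^{n-1}$ with $|u|\le r$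 there is $a\in\mathbb R^n$ with $|a|\le R$ and $a\cdot I_u\subset K$. A set $K\subset\mathbb R^n$ is a (classical) bounded Kakeya set if it is bounded and for every $e\in\mathbb R^n$ with $|e|=1$ there is $a\in\mathbb R^n$ such that $\{a+te:0\le t\le1\}\subset K$. Then, for every homogeneous metric $d$ on $\mathbb G$: (1) every bounded LT-Kakeya set has Hausdorff dimension with respect to $d$ at least $\frac{n+3}{2}$; (2) every bounded Kakeya set has Hausdorff dimension with respect to $d$ at least $\frac{n+4}{2}$. -/

import Mathlib

open scoped ENNReal

namespace Carnot

/-- A stratification of step `s` of a real Lie algebra `𝔤`: a decomposition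
`𝔤 = V 1 ⊕ ⋯ ⊕ V s` with `[V 1, V i] = V (i + 1)`, `V s ≠ 0` and `V j = 0` for `j > s`.
Layers are indexed by `ℕ`, with `V 0 = 0`. -/
structure Stratification (𝔤 : Type*) [LieRing 𝔤] [LieAlgebra ℝ 𝔤] (s : ℕ) where
  V : ℕ → Submodule ℝ 𝔤
  V_zero : V 0 = ⊥
  isInternal : DirectSum.IsInternal V
  bracket_V : ∀ i, 1 ≤ i →
    Submodule.span ℝ {Z : 𝔤 | ∃ X ∈ V 1, ∃ Y ∈ V i, ⁅X, Y⁆ = Z} = V (i + 1)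
  V_ne_bot : V s ≠ ⊥
  V_eq_bot : ∀ j, s < j → V j = ⊥

/-- A linear basis of `𝔤` adapted to a stratification: every basis vector lies in one layer, and
the vectors are listed layer by layer (`deg i` is the layer of the `i`-th one). It gives the
exponential coordinates `(x₁, …, xₙ) ↦ exp (x₁ e₁ + ⋯ + xₙ eₙ)`, which identify the connected and
simply connected Lie group of `𝔤` with `ℝⁿ`. -/
structure ExpCoords {𝔤 : Type*} [LieRing 𝔤] [LieAlgebra ℝ 𝔤] {s : ℕ}
    (S : Stratification 𝔤 s) (n : ℕ) where
  basis : Module.Basis (Fin n) ℝ 𝔤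
  deg : Fin n → ℕ
  deg_mono : Monotone deg
  basis_mem : ∀ i, basis i ∈ S.V (deg i)

namespace ExpCoords

variable {𝔤 : Type*} [LieRing 𝔤] [LieAlgebra ℝ 𝔤]

/-- The element of the Lie algebra with coordinates `p`. -/
noncomputable def toLie {s : ℕ} {S : Stratification 𝔤 s} {n : ℕ} (c : ExpCoords S n)
    (p : EuclideanSpace ℝ (Fin n)) : 𝔤 :=
  ∑ i, p i • c.basis i

/-- The coordinates of an element of the Lie algebra. -/
noncomputable def ofLie {s : ℕ} {S : Stratification 𝔤 s} {n : ℕ} (c : ExpCoords S n)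
    (X : 𝔤) : EuclideanSpace ℝ (Fin n) :=
  WithLp.toLp 2 (fun i => c.basis.repr X i)

/-- The product of a Carnot group of step 2 in exponential coordinates, given by the
Baker-Campbell-Hausdorff formula `exp X * exp Y = exp (X + Y + ½ [X, Y])`. -/
noncomputable def mul {S : Stratification 𝔤 2} {n : ℕ} (c : ExpCoords S n)
    (p q : EuclideanSpace ℝ (Fin n)) : EuclideanSpace ℝ (Fin n) :=
  c.ofLie (c.toLie p + c.toLie q + (1 / 2 : ℝ) • ⁅c.toLie p, c.toLie q⁆)

/-- The dilation `δ_t`, which multiplies the coordinates of layer `j` by `t ^ j`. -/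
noncomputable def dil {s : ℕ} {S : Stratification 𝔤 s} {n : ℕ} (c : ExpCoords S n)
    (t : ℝ) (p : EuclideanSpace ℝ (Fin n)) : EuclideanSpace ℝ (Fin n) :=
  WithLp.toLp 2 (fun i => t ^ c.deg i * p i)

/-- A metric on the group is homogeneous if it is left invariant and one-homogeneous under the
dilations. -/
def IsHomogeneousMetric {S : Stratification 𝔤 2} {n : ℕ} (c : ExpCoords S n)
    (D : MetricSpace (EuclideanSpace ℝ (Fin n))) : Prop :=
  (∀ p q q', D.dist (c.mul p q) (c.mul p q') = D.dist q q') ∧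
  (∀ t : ℝ, 0 < t → ∀ p q, D.dist (c.dil t p) (c.dil t q) = t * D.dist p q)

end ExpCoords

/-- The vector `(u, 1)` of `ℝⁿ`, for `u` in `ℝⁿ⁻¹` (here `n = m + 1`). -/
noncomputable def vec {m : ℕ} (u : EuclideanSpace ℝ (Fin m)) : EuclideanSpace ℝ (Fin (m + 1)) :=
  WithLp.toLp 2 (Fin.snoc (fun i => u i) (1 : ℝ) : Fin (m + 1) → ℝ)

/-- The segment `I_u` of unit Euclidean length from the origin in the direction `(u, 1)`. -/
noncomputable def seg {m : ℕ} (u : EuclideanSpace ℝ (Fin m)) :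
    Set (EuclideanSpace ℝ (Fin (m + 1))) :=
  {p | ∃ t : ℝ, 0 ≤ t ∧ t ≤ 1 / Real.sqrt (‖u‖ ^ 2 + 1) ∧ p = t • vec u}

/-- Bounded LT-Kakeya sets: for some `R, r > 0`, the set contains, for every `u` in the Euclidean
ball of radius `r`, the left translate `a · I_u` of the segment `I_u` by some point `a` of the
Euclidean ball of radius `R`. -/
def IsBoundedLTKakeya {𝔤 : Type*} [LieRing 𝔤] [LieAlgebra ℝ 𝔤] {S : Stratification 𝔤 2} {m : ℕ}
    (c : ExpCoords S (m + 1)) (K : Set (EuclideanSpace ℝ (Fin (m + 1)))) : Prop :=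
  ∃ R : ℝ, 0 < R ∧ ∃ r : ℝ, 0 < r ∧
    ∀ u : EuclideanSpace ℝ (Fin m), ‖u‖ ≤ r →
      ∃ a : EuclideanSpace ℝ (Fin (m + 1)), ‖a‖ ≤ R ∧ c.mul a '' seg u ⊆ K

/-- Classical bounded Kakeya sets: bounded sets that contain a unit Euclidean segment in every
direction. -/
def IsBoundedKakeya {n : ℕ} (K : Set (EuclideanSpace ℝ (Fin n))) : Prop :=
  Bornology.IsBounded K ∧
    ∀ e : EuclideanSpace ℝ (Fin n), ‖e‖ = 1 →
      ∃ a : EuclideanSpace ℝ (Fin n), ∀ t : ℝ, 0 ≤ t → t ≤ 1 → a + t • e ∈ K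

/-- The Hausdorff dimension of `K` with respect to the metric `D`. -/
noncomputable def dimWrt {X : Type*} (D : MetricSpace X) (K : Set X) : ℝ≥0∞ :=
  @dimH X (@MetricSpace.toEMetricSpace X D) K

end Carnot

/-! Write `n = m + 1` and view the group as `ℝᵐ × ℝ` with an alternating form `ω`. By compactness
and dilations, a homogeneous metric is bounded below by the model gauge (`gauge_le`), so a ball of
radius `s` lies in a box of width `s` and thickness `s²`, tilted along the horizontal plane at its
centre. Only segments in directions near the vertical axis are used. They are transversal to the
horizontal distribution, hence meet such a box in length `O(s²)`. A segment therefore needs about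
`δ⁻²` boxes of radius `δ`, although all of these lie near one Euclidean `δ`-tube; this raises the
Euclidean bounds `(n+1)/2` and `(n+2)/2` by one.

Suppose the dimension is below `α`. A fine cover, pigeonholed over dyadic radii once along each
segment and once over the directions, gives a single scale `δ = 2⁻ᵏ`, a set `Q` of `O(δ^(-α))`
boxes, and about `δ⁻ᵐ` tubes with `δ`-separated parameters `u`, each meeting about `δ⁻²` boxes of
`Q` (`exists_discretization`). All losses are powers of `zᵏ` with `z > 1` close to 1, that is, of
`δ^(-ε)`.

For (1), a left translate by `a` has direction `(u, 1 + ½ω(a,u))`, so the tubes need not have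
separated directions. Two tubes through a common point do, because there `ω(a,u)` may be replaced by
`ω(w,u)` with `w` the common point (`norm_sub_le_of_common_point`). That is enough for Bourgain's
bush (`card_le_of_bush`): the tubes through one box are essentially disjoint away from it, so at
most about `|Q|δ²` tubes pass through a box, and double counting gives `δ⁻ᵐ ≲ |Q|²δ⁴`, i.e. `α ≥
(m+4)/2`.

For (2), the directions are globally separated and Wolff's hairbrush applies
(`one_le_of_hairbrush`). Tubes meeting a fixed spine satisfy an `L²` bound with logarithmic loss,
because those which also meet each other have nearly coplanar directions (`near_line`,
`card_hairbrush_le`). A spine met by many tubes exists once most pairs of tubes at each box make a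
large angle. This is arranged by localising the directions to a cell of a `b`-adic grid in which the
tubes through each box are spread out. The outcome is `1 ≲ |Q|²δ^(m+5)`, i.e. `α ≥ (m+5)/2`. -/

/-! ### Separated sets: counting and selection. -/

/-- Points of `ℝᵐ` at mutual sup-distance at least `ε` in a sup-ball of radius `Y` number at most
`(2Y/ε + 2)ᵐ`. -/
theorem card_le_of_separated {ι : Type*} {m : ℕ} (S : Finset ι) (f : ι → Fin m → ℝ) {ε Y : ℝ}
    (hε : 0 < ε) (hY : 0 ≤ Y) (w : Fin m → ℝ)
    (hsep : ∀ i ∈ S, ∀ j ∈ S, i ≠ j → ε ≤ ‖f i - f j‖) (hw : ∀ i ∈ S, ‖f i - w‖ ≤ Y) :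
    (S.card : ℝ) ≤ (2 * Y / ε + 2) ^ m := by
  classical
  let g : ι → Fin m → ℤ := fun i j => ⌊f i j / ε⌋
  let B : Finset (Fin m → ℤ) :=
    Fintype.piFinset fun j => Finset.Icc ⌊(w j - Y) / ε⌋ ⌊(w j + Y) / ε⌋
  have hmaps : ∀ i ∈ S, g i ∈ B := by
    intro i hi
    rw [Fintype.mem_piFinset]
    intro j
    have h1 : |f i j - w j| ≤ Y := by
      have := norm_le_pi_norm (f i - w) j
      rw [Real.norm_eq_abs] at this
      exact this.trans (hw i hi)
    rw [abs_le] at h1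
    rw [Finset.mem_Icc]
    constructor <;> apply Int.floor_le_floor <;> gcongr <;> linarith
  have hinj : Set.InjOn g S := by
    intro i hi j hj hij
    by_contra hne
    have h1 := hsep i hi j hj hne
    have h2 : ‖f i - f j‖ < ε := by
      rw [pi_norm_lt_iff hε]
      intro k
      have h3 : ⌊f i k / ε⌋ = ⌊f j k / ε⌋ := congrFun hij k
      have h4 := Int.abs_sub_lt_one_of_floor_eq_floor h3
      rw [← sub_div, abs_div, abs_of_pos hε, div_lt_one hε] at h4
      exact h4
    linarith
  have hcard : S.card ≤ B.card := Finset.card_le_card_of_injOn g hmaps hinj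
  have hB : (B.card : ℝ) ≤ (2 * Y / ε + 2) ^ m := by
    rw [Fintype.card_piFinset, Nat.cast_prod]
    calc _ ≤ ∏ _j : Fin m, (2 * Y / ε + 2) := by
          apply Finset.prod_le_prod
          · intro j _; positivity
          · intro j _
            rw [Int.card_Icc]
            have h1 : ⌊(w j - Y) / ε⌋ ≤ ⌊(w j + Y) / ε⌋ := by
              apply Int.floor_le_floor; gcongr; linarith
            have h2 : (((⌊(w j + Y) / ε⌋ + 1 - ⌊(w j - Y) / ε⌋).toNat : ℤ) : ℝ)
                = ⌊(w j + Y) / ε⌋ + 1 - ⌊(w j - Y) / ε⌋ := by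
              rw [Int.toNat_of_nonneg (by linarith)]; push_cast; ring
            rw [Int.cast_natCast] at h2
            rw [h2]
            have h3 := Int.floor_le ((w j + Y) / ε)
            have h4 := Int.lt_floor_add_one ((w j - Y) / ε)
            have h5 : (w j + Y) / ε - (w j - Y) / ε = 2 * Y / ε := by ring
            linarith
      _ = _ := by simp
  exact (Nat.cast_le.mpr hcard).trans hB

/-- Greedy choice of separated points in a set that is too large to be covered by `n` balls. -/
theorem exists_separated_finset {X : Type*} [PseudoMetricSpace X] [MeasurableSpace X]
    (μ : MeasureTheory.Measure X) (A : Set X) {η : ℝ} (hη : 0 ≤ η) (w : ℝ≥0∞)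
    (hball : ∀ x, μ (Metric.closedBall x η) ≤ w) (n : ℕ) (h : n * w < μ A) :
    ∃ S : Finset X, S.card = n + 1 ∧ (∀ x ∈ S, x ∈ A) ∧
      ∀ x ∈ S, ∀ y ∈ S, x ≠ y → η < dist x y := by
  classical
  have key : ∀ k : ℕ, k ≤ n + 1 → ∃ S : Finset X, S.card = k ∧ (∀ x ∈ S, x ∈ A) ∧
      ∀ x ∈ S, ∀ y ∈ S, x ≠ y → η < dist x y := by
    intro k
    induction k with
    | zero => intro _; exact ⟨∅, by simp⟩
    | succ k ih =>
      intro hk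
      obtain ⟨S, hS, hSA, hsep⟩ := ih (by omega)
      -- Only subadditivity is used, so `A` may be non-measurable. This matters because the set of
      -- directions to which it is applied depends on an arbitrary choice of segments.
      have hlt : μ (⋃ x ∈ S, Metric.closedBall x η) < μ A := by
        calc _ ≤ ∑ x ∈ S, μ (Metric.closedBall x η) := MeasureTheory.measure_biUnion_finset_le _ _
          _ ≤ ∑ _x ∈ S, w := Finset.sum_le_sum fun x _ => hball x
          _ = k * w := by simp [hS]
          _ ≤ n * w := by gcongr; omega
          _ < _ := h
      obtain ⟨y, hyA, hy⟩ : ∃ y ∈ A, y ∉ ⋃ x ∈ S, Metric.closedBall x η := by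
        by_contra hcon
        push Not at hcon
        exact absurd (MeasureTheory.measure_mono hcon) (not_le.mpr hlt)
      simp only [Set.mem_iUnion, Metric.mem_closedBall, not_exists, not_le] at hy
      have hyS : y ∉ S := fun hmem => by
        have := hy y hmem
        rw [dist_self] at this
        linarith
      refine ⟨insert y S, by rw [Finset.card_insert_of_notMem hyS, hS], ?_, ?_⟩
      · intro x hx
        rcases Finset.mem_insert.1 hx with rfl | hx
        exacts [hyA, hSA x hx]
      · intro x hx z hz hxz
        rcases Finset.mem_insert.1 hx with rfl | hx' <;> rcases Finset.mem_insert.1 hz with rfl | hz'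
        · exact absurd rfl hxz
        · exact hy z hz'
        · rw [dist_comm]; exact hy x hx'
        · exact hsep x hx' z hz' hxz
  exact key (n + 1) le_rfl

/-! ### Tubes and boxes: pairwise intersections. -/

/-- A finite family of `δ`-tubes in `ℝᵐ × ℝ`, the tube `i` having axis `h ↦ a i + h • v i`, and of
`δ × δ²` boxes with centres `(x q, h q)`; `J i` is a set of boxes met by the tube `i`. All the
losses are measured by a single number `B`. -/
structure TubeFamily {ι β : Type*} {m : ℕ} (T : Finset ι) (v a : ι → Fin m → ℝ)
    (x : β → Fin m → ℝ) (h : β → ℝ) (J : ι → Finset β) (δ B : ℝ) : Prop where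
  δ_pos : 0 < δ
  δ_le : δ ≤ 1
  two_le : 2 ≤ B
  near : ∀ i ∈ T, ∀ q ∈ J i, ‖x q - (a i + h q • v i)‖ ≤ B * δ
  -- Non-concentration along the tube. The height of a box is known only up to `O(δ)`, whence the
  -- restriction to `ρ ≥ δ`.
  count : ∀ i ∈ T, ∀ s ρ : ℝ, δ ≤ ρ →
    (((J i).filter fun q => |h q - s| ≤ ρ).card : ℝ) * δ ^ 2 ≤ B * ρ
  height : ∀ i ∈ T, ∀ q ∈ J i, |h q| ≤ B
  slope : ∀ i ∈ T, ‖v i‖ ≤ 1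

namespace TubeFamily

variable {ι β : Type*} {m : ℕ} {T : Finset ι} {v a : ι → Fin m → ℝ}
  {x : β → Fin m → ℝ} {h : β → ℝ} {J : ι → Finset β} {δ B : ℝ}

theorem card_le (F : TubeFamily T v a x h J δ B) {i : ι} (hi : i ∈ T) :
    ((J i).card : ℝ) * δ ^ 2 ≤ B ^ 2 := by
  have h1 := F.count i hi 0 B (by linarith [F.δ_le, F.two_le])
  rw [Finset.filter_true_of_mem] at h1
  · nlinarith
  · intro q hq
    simpa using F.height i hi q hq

/-- At each of the two heights both axes pass within `Bδ` of the same point, so the difference of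
the two affine functions of the height is at most `2Bδ` there; subtracting the two relations leaves
only the slopes. -/
theorem height_sub_mul_le (F : TubeFamily T v a x h J δ B) {i j : ι} (hi : i ∈ T) (hj : j ∈ T)
    {q q' : β} (hq : q ∈ J i) (hq' : q' ∈ J i) (hqj : q ∈ J j) (hqj' : q' ∈ J j) :
    |h q - h q'| * ‖v i - v j‖ ≤ 4 * B * δ := by
  have e : (h q - h q') • (v i - v j) =
      (x q - (a j + h q • v j)) - (x q - (a i + h q • v i))
      + ((x q' - (a i + h q' • v i)) - (x q' - (a j + h q' • v j))) := by
    module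
  rw [← Real.norm_eq_abs, ← norm_smul, e]
  refine (norm_add_le _ _).trans ?_
  have h1 := norm_sub_le (x q - (a j + h q • v j)) (x q - (a i + h q • v i))
  have h2 := norm_sub_le (x q' - (a i + h q' • v i)) (x q' - (a j + h q' • v j))
  linarith [F.near i hi q hq, F.near j hj q hqj, F.near i hi q' hq', F.near j hj q' hqj']

/-- By `height_sub_mul_le` the common boxes lie within height `4Bδ/‖v i - v j‖` of any one of them,
and `count` bounds their number. The summand `1` comes from `card_le` and covers nearly parallel
tubes. -/
theorem card_inter_le [DecidableEq β] (F : TubeFamily T v a x h J δ B) {i j : ι} (hi : i ∈ T)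
    (hj : j ∈ T) : ((J i ∩ J j).card : ℝ) * (1 + ‖v i - v j‖ / δ) * δ ^ 2 ≤ 5 * B ^ 2 := by
  have hδ := F.δ_pos
  have h2 := F.two_le
  have htriv : ((J i ∩ J j).card : ℝ) * δ ^ 2 ≤ B ^ 2 := by
    refine le_trans ?_ (F.card_le hi)
    gcongr
    exact Finset.inter_subset_left
  have hmain : ((J i ∩ J j).card : ℝ) * δ * ‖v i - v j‖ ≤ 4 * B ^ 2 := by
    rcases (J i ∩ J j).eq_empty_or_nonempty with h0 | ⟨q, hq⟩
    · rw [h0]; simp; positivity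
    rcases (norm_nonneg (v i - v j)).eq_or_lt with h0 | h0
    · rw [← h0]; simp; positivity
    have hv : ‖v i - v j‖ ≤ 2 := by
      linarith [norm_sub_le (v i) (v j), F.slope i hi, F.slope j hj]
    rw [Finset.mem_inter] at hq
    have hρ : δ ≤ 4 * B * δ / ‖v i - v j‖ := by
      rw [le_div_iff₀ h0]; nlinarith
    have h3 := F.count i hi (h q) _ hρ
    have h4 : ((J i ∩ J j).card : ℝ) ≤ ((J i).filter fun q' => |h q' - h q| ≤
        4 * B * δ / ‖v i - v j‖).card := by
      gcongr
      intro q' hq'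
      rw [Finset.mem_inter] at hq'
      rw [Finset.mem_filter, le_div_iff₀ h0]
      exact ⟨hq'.1, F.height_sub_mul_le hi hj hq'.1 hq.1 hq'.2 hq.2⟩
    have h5 : ((J i ∩ J j).card : ℝ) * δ ^ 2 ≤ B * (4 * B * δ / ‖v i - v j‖) :=
      le_trans (by gcongr) h3
    rw [← mul_div_assoc, le_div_iff₀ h0] at h5
    nlinarith
  have e : ((J i ∩ J j).card : ℝ) * (1 + ‖v i - v j‖ / δ) * δ ^ 2
      = ((J i ∩ J j).card : ℝ) * δ ^ 2 + ((J i ∩ J j).card : ℝ) * δ * ‖v i - v j‖ := by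
    field_simp
  rw [e]; linarith

end TubeFamily

/-! ### The `L²` estimate for a hairbrush. -/

/-- Points near a line through the origin, weighted by the inverse distance to one of them. -/
theorem sum_inv_le_of_near_line {ι : Type*} {m : ℕ} (hm : 0 < m) (S : Finset ι)
    (f : ι → Fin m → ℝ) {δ r : ℝ} (hδ : 0 < δ) (hr : 0 ≤ r) (e w : Fin m → ℝ)
    (hsep : ∀ i ∈ S, ∀ j ∈ S, i ≠ j → δ ≤ ‖f i - f j‖)
    (hline : ∀ i ∈ S, ∃ s : ℝ, ‖f i - s • e‖ ≤ r)
    (N : ℕ) (hN : ∀ i ∈ S, ‖f i - w‖ / δ + 1 ≤ N) :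
    ∑ i ∈ S, (1 + ‖f i - w‖ / δ)⁻¹ ≤
      (4 + 8 * r / δ) ^ m * (2 * ∑ n ∈ Finset.Icc (-N : ℤ) N, (1 + |(n : ℝ)|)⁻¹) := by
  classical
  have : Nonempty (Fin m) := ⟨⟨0, hm⟩⟩
  -- Project to the largest coordinate of the line. Near the line this coordinate determines the
  -- point up to `O(δ + r)`, so each integer has boundedly many points above it. The distance to `w`
  -- dominates the coordinate difference, so the sum reduces to a harmonic one.
  obtain ⟨j, hj⟩ : ∃ j, ∀ k, |e k| ≤ |e j| := Finite.exists_max fun k => |e k|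
  have hje : ‖e‖ = |e j| := by
    apply le_antisymm
    · rw [pi_norm_le_iff_of_nonneg (abs_nonneg _)]
      exact hj
    · exact norm_le_pi_norm e j
  let g : ι → ℤ := fun i => ⌊(f i j - w j) / δ⌋
  have hcoord : ∀ i, |f i j - w j| ≤ ‖f i - w‖ := fun i => norm_le_pi_norm (f i - w) j
  have hg : ∀ i ∈ S, |(g i : ℝ)| ≤ ‖f i - w‖ / δ + 1 := by
    intro i _
    have h1 := Int.floor_le ((f i j - w j) / δ)
    have h2 := Int.lt_floor_add_one ((f i j - w j) / δ)
    have h3 : |(f i j - w j) / δ| ≤ ‖f i - w‖ / δ := by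
      rw [abs_div, abs_of_pos hδ]; gcongr; exact hcoord i
    rw [abs_le] at h3 ⊢
    constructor <;> simp only [g] <;> linarith
  have hmaps : ∀ i ∈ S, g i ∈ Finset.Icc (-N : ℤ) N := by
    intro i hi
    have := (hg i hi).trans (hN i hi)
    rw [Finset.mem_Icc, ← abs_le]
    exact_mod_cast this
  have hfib : ∀ n : ℤ, ((S.filter fun i => g i = n).card : ℝ) ≤ (4 + 8 * r / δ) ^ m := by
    intro n
    rcases (S.filter fun i => g i = n).eq_empty_or_nonempty with h0 | ⟨i₀, hi₀⟩
    · rw [h0]; simp; positivity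
    rw [Finset.mem_filter] at hi₀
    have := card_le_of_separated (S.filter fun i => g i = n) f hδ
      (by positivity : (0 : ℝ) ≤ δ + 4 * r) (f i₀)
      (fun i hi k hk => hsep i (Finset.mem_filter.1 hi).1 k (Finset.mem_filter.1 hk).1) ?_
    · refine this.trans (le_of_eq ?_)
      congr 1; field_simp; ring
    · intro i hi
      rw [Finset.mem_filter] at hi
      obtain ⟨s, hs⟩ := hline i hi.1
      obtain ⟨s₀, hs₀⟩ := hline i₀ hi₀.1
      have h1 : |f i j - f i₀ j| ≤ δ := by
        have h3 : ⌊(f i j - w j) / δ⌋ = ⌊(f i₀ j - w j) / δ⌋ := hi.2.trans hi₀.2.symm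
        have h4 := Int.abs_sub_lt_one_of_floor_eq_floor h3
        rw [← sub_div, abs_div, abs_of_pos hδ, div_lt_one hδ] at h4
        have : f i j - w j - (f i₀ j - w j) = f i j - f i₀ j := by ring
        rw [this] at h4
        exact h4.le
      have h2 : |f i j - s * e j| ≤ r := (norm_le_pi_norm (f i - s • e) j).trans hs
      have h3 : |f i₀ j - s₀ * e j| ≤ r := (norm_le_pi_norm (f i₀ - s₀ • e) j).trans hs₀
      have h4 : ‖(s - s₀) • e‖ ≤ δ + 2 * r := by
        rw [norm_smul, hje, Real.norm_eq_abs, ← abs_mul]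
        have : (s - s₀) * e j = (f i j - f i₀ j) - (f i j - s * e j) + (f i₀ j - s₀ * e j) := by
          ring
        rw [this]
        refine (abs_add_le _ _).trans ?_
        have := abs_sub (f i j - f i₀ j) (f i j - s * e j)
        linarith
      have h5 : f i - f i₀ = (f i - s • e) - (f i₀ - s₀ • e) + (s - s₀) • e := by module
      rw [h5]
      refine (norm_add_le _ _).trans ?_
      have := norm_sub_le (f i - s • e) (f i₀ - s₀ • e)
      linarith
  calc ∑ i ∈ S, (1 + ‖f i - w‖ / δ)⁻¹ ≤ ∑ i ∈ S, 2 * (1 + |(g i : ℝ)|)⁻¹ := by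
        apply Finset.sum_le_sum
        intro i hi
        have h1 := hg i hi
        have h0 : 0 ≤ ‖f i - w‖ / δ := by positivity
        rw [← div_eq_mul_inv, inv_eq_one_div, div_le_div_iff₀ (by positivity) (by positivity)]
        linarith
    _ = ∑ n ∈ Finset.Icc (-N : ℤ) N, ∑ i ∈ S with g i = n, 2 * (1 + |(g i : ℝ)|)⁻¹ :=
        (Finset.sum_fiberwise_of_maps_to hmaps _).symm
    _ = ∑ n ∈ Finset.Icc (-N : ℤ) N, ((S.filter fun i => g i = n).card : ℝ) *
          (2 * (1 + |(n : ℝ)|)⁻¹) := by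
        apply Finset.sum_congr rfl
        intro n _
        rw [← nsmul_eq_mul, ← Finset.sum_const]
        apply Finset.sum_congr rfl
        intro i hi
        rw [(Finset.mem_filter.1 hi).2]
    _ ≤ ∑ n ∈ Finset.Icc (-N : ℤ) N, (4 + 8 * r / δ) ^ m * (2 * (1 + |(n : ℝ)|)⁻¹) := by
        apply Finset.sum_le_sum
        intro n _
        gcongr
        exact hfib n
    _ = _ := by rw [Finset.mul_sum, Finset.mul_sum]

/-- Córdoba's Cauchy-Schwarz inequality for the incidences of a finite family of sets. -/
theorem sq_sum_card_le {ι β : Type*} [DecidableEq β] (T : Finset ι) (Q : Finset β)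
    (G : ι → Finset β) (hG : ∀ i ∈ T, G i ⊆ Q) :
    (∑ i ∈ T, ((G i).card : ℝ)) ^ 2 ≤ Q.card * ∑ i ∈ T, ∑ j ∈ T, ((G i ∩ G j).card : ℝ) := by
  have h1 : ∀ S : Finset β, S ⊆ Q → (S.card : ℝ) = ∑ q ∈ Q, if q ∈ S then (1 : ℝ) else 0 := by
    intro S hS
    rw [Finset.sum_ite_mem, Finset.inter_eq_right.2 hS]; simp
  have h2 : ∑ i ∈ T, ((G i).card : ℝ) = ∑ q ∈ Q, ∑ i ∈ T, if q ∈ G i then (1 : ℝ) else 0 := by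
    rw [Finset.sum_comm]
    exact Finset.sum_congr rfl fun i hi => h1 _ (hG i hi)
  have h3 : ∑ i ∈ T, ∑ j ∈ T, ((G i ∩ G j).card : ℝ) =
      ∑ q ∈ Q, (∑ i ∈ T, if q ∈ G i then (1 : ℝ) else 0) ^ 2 := by
    calc _ = ∑ i ∈ T, ∑ j ∈ T, ∑ q ∈ Q,
          (if q ∈ G i then (1 : ℝ) else 0) * (if q ∈ G j then (1 : ℝ) else 0) := by
          refine Finset.sum_congr rfl fun i hi => Finset.sum_congr rfl fun j _ => ?_
          rw [h1 _ (Finset.inter_subset_left.trans (hG i hi))]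
          refine Finset.sum_congr rfl fun q _ => ?_
          by_cases hi : q ∈ G i <;> by_cases hj : q ∈ G j <;> simp [hi, hj]
      _ = ∑ i ∈ T, ∑ q ∈ Q, ∑ j ∈ T,
          (if q ∈ G i then (1 : ℝ) else 0) * (if q ∈ G j then (1 : ℝ) else 0) :=
          Finset.sum_congr rfl fun i _ => Finset.sum_comm
      _ = ∑ q ∈ Q, ∑ i ∈ T, ∑ j ∈ T,
          (if q ∈ G i then (1 : ℝ) else 0) * (if q ∈ G j then (1 : ℝ) else 0) := Finset.sum_comm
      _ = _ := Finset.sum_congr rfl fun q _ => by rw [sq, Finset.sum_mul_sum]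
  rw [h2, h3]
  exact sq_sum_le_card_mul_sum_sq

namespace TubeFamily

variable {ι β : Type*} {m : ℕ} {T : Finset ι} {v a : ι → Fin m → ℝ}
  {x : β → Fin m → ℝ} {h : β → ℝ} {J : ι → Finset β} {δ B : ℝ}

/-- The tubes `i`, `j`, `o` form a triangle with corners near `p`, `q`, `r`. Adding the three
near-coincidences cancels the base points `a` and leaves `(h r - h q)(v j - v o) ≈ (h r - h p)(v i -
v o)`: the three directions are nearly coplanar. The division by `h r - h q` is the reason to stay
away from the spine. -/
theorem near_line (F : TubeFamily T v a x h J δ B) {o i j : ι} (ho : o ∈ T) (hi : i ∈ T)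
    (hj : j ∈ T) {p q r : β} (hp : p ∈ J i) (hpo : p ∈ J o) (hq : q ∈ J j) (hqo : q ∈ J o)
    (hri : r ∈ J i) (hrj : r ∈ J j) {ρ : ℝ} (hρ : 0 < ρ) (hr : ρ ≤ |h r - h q|) :
    ∃ s : ℝ, ‖(v j - v o) - s • (v i - v o)‖ ≤ 6 * B * δ / ρ := by
  have hB : 0 < B := by linarith [F.two_le]
  have hpos : 0 < |h r - h q| := hρ.trans_le hr
  have hne : h r - h q ≠ 0 := abs_pos.1 hpos
  refine ⟨(h r - h p) / (h r - h q), ?_⟩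
  have key : ‖(h r - h q) • (v j - v o) - (h r - h p) • (v i - v o)‖ ≤ 6 * B * δ := by
    have e : (h r - h q) • (v j - v o) - (h r - h p) • (v i - v o) =
        ((x r - (a i + h r • v i)) - (x r - (a j + h r • v j)))
        + (((x p - (a o + h p • v o)) - (x p - (a i + h p • v i)))
        + ((x q - (a j + h q • v j)) - (x q - (a o + h q • v o)))) := by module
    rw [e]
    refine (norm_add_le _ _).trans ?_
    have h0 := norm_add_le
      ((x p - (a o + h p • v o)) - (x p - (a i + h p • v i)))
      ((x q - (a j + h q • v j)) - (x q - (a o + h q • v o)))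
    have h1 := norm_sub_le (x r - (a i + h r • v i)) (x r - (a j + h r • v j))
    have h2 := norm_sub_le (x p - (a o + h p • v o)) (x p - (a i + h p • v i))
    have h3 := norm_sub_le (x q - (a j + h q • v j)) (x q - (a o + h q • v o))
    linarith [F.near i hi r hri, F.near j hj r hrj, F.near o ho p hpo, F.near i hi p hp,
      F.near j hj q hq, F.near o ho q hqo]
  have e : (v j - v o) - ((h r - h p) / (h r - h q)) • (v i - v o) =
      (h r - h q)⁻¹ • ((h r - h q) • (v j - v o) - (h r - h p) • (v i - v o)) := by
    rw [smul_sub (h r - h q)⁻¹, smul_smul, smul_smul, inv_mul_cancel₀ hne, one_smul,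
      div_eq_inv_mul]
  rw [e, norm_smul, norm_inv, Real.norm_eq_abs, inv_mul_le_iff₀ hpos]
  refine key.trans ?_
  have hδ := F.δ_pos
  calc 6 * B * δ = ρ * (6 * B * δ / ρ) := by field_simp
    _ ≤ _ := by gcongr

/-- The boxes covering a hairbrush: if all the tubes of `T'` meet the tube `o` and have many boxes
in `Q`, then `Q` is large. -/
theorem card_hairbrush_le [DecidableEq β] (F : TubeFamily T v a x h J δ B) (hm : 0 < m)
    (hsep : ∀ i ∈ T, ∀ j ∈ T, i ≠ j → δ ≤ ‖v i - v j‖) {o : ι} (ho : o ∈ T) {T' : Finset ι}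
    (hT' : T' ⊆ T) (Q : Finset β) {Λ : ℝ} (hΛ : 1 ≤ Λ) (hΛδ : 2 * B * Λ * δ ≤ 1)
    (hmeet : ∀ i ∈ T', (J i ∩ J o).Nonempty)
    (hrich : ∀ i ∈ T', 1 ≤ ((J i ∩ Q).card : ℝ) * δ ^ 2 * Λ) (N : ℕ) (hN : 2 / δ + 1 ≤ N) :
    (T'.card : ℝ) ≤ Q.card * δ ^ 2 * (40 * B ^ 2 * Λ ^ 2 * (4 + 96 * B ^ 2 * Λ) ^ m *
      ∑ n ∈ Finset.Icc (-N : ℤ) N, (1 + |(n : ℝ)|)⁻¹) := by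
  have hδ := F.δ_pos
  have h2 := F.two_le
  have hB : 0 < B := by linarith
  set H := ∑ n ∈ Finset.Icc (-N : ℤ) N, (1 + |(n : ℝ)|)⁻¹ with hH
  rcases T'.eq_empty_or_nonempty with h0 | h0
  · rw [h0]
    have : 0 ≤ H := Finset.sum_nonneg fun _ _ => by positivity
    simp; positivity
  have : Nonempty β := by
    obtain ⟨i, hi⟩ := h0
    exact ⟨(hmeet i hi).choose⟩
  choose! p hp using hmeet
  simp only [Finset.mem_inter] at hp
  -- By `count`, at most `Bρ/δ² = 1/(2Λδ²)` boxes of a bristle lie within height `ρ` of its box on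
  -- the spine. Removing them costs at most half of the boxes granted by `hrich`.
  set ρ : ℝ := 1 / (2 * B * Λ) with hρdef
  have hρ : 0 < ρ := by positivity
  have hδρ : δ ≤ ρ := by
    rw [hρdef, le_div_iff₀ (by positivity)]; linarith
  let G : ι → Finset β := fun i => (J i ∩ Q).filter fun q => ¬ |h q - h (p i)| ≤ ρ
  have hGJ : ∀ i, G i ⊆ J i := fun i q hq =>
    (Finset.mem_inter.1 (Finset.mem_filter.1 hq).1).1
  have hGQ : ∀ i, G i ⊆ Q := fun i q hq =>
    (Finset.mem_inter.1 (Finset.mem_filter.1 hq).1).2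
  have hGcard : ∀ i ∈ T', 1 ≤ ((G i).card : ℝ) * (2 * Λ * δ ^ 2) := by
    intro i hi
    have h1 := hrich i hi
    have h3 : (((J i ∩ Q).filter fun q => |h q - h (p i)| ≤ ρ).card : ℝ) * δ ^ 2 ≤ B * ρ := by
      refine le_trans ?_ (F.count i (hT' hi) (h (p i)) ρ hδρ)
      gcongr
      exact Finset.inter_subset_left
    have h4 := Finset.card_filter_add_card_filter_not (s := J i ∩ Q)
      (fun q => |h q - h (p i)| ≤ ρ)
    have h5 : (((J i ∩ Q).filter fun q => |h q - h (p i)| ≤ ρ).card : ℝ) + (G i).card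
        = (J i ∩ Q).card := by exact_mod_cast h4
    have h6 : B * ρ * Λ = 1 / 2 := by rw [hρdef]; field_simp
    rw [← h5] at h1
    nlinarith
  -- For fixed `i`, every bristle `j` meeting it off the spine has `v j - v o` near the line spanned
  -- by `v i - v o`, so the bounds of `card_inter_le` add up to a harmonic sum.
  have hpair : ∀ i ∈ T', ∑ j ∈ T', ((G i ∩ G j).card : ℝ) ≤
      5 * B ^ 2 / δ ^ 2 * ((4 + 96 * B ^ 2 * Λ) ^ m * (2 * H)) := by
    intro i hi
    classical
    let S := T'.filter fun j => (G i ∩ G j).Nonempty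
    have hS : ∀ j ∈ S, j ∈ T' := fun j hj => (Finset.mem_filter.1 hj).1
    have h1 : ∑ j ∈ T', ((G i ∩ G j).card : ℝ) = ∑ j ∈ S, ((G i ∩ G j).card : ℝ) := by
      symm
      apply Finset.sum_subset (Finset.filter_subset _ _)
      intro j hj hjS
      rw [Finset.mem_filter, not_and, Finset.not_nonempty_iff_eq_empty] at hjS
      simp [hjS hj]
    have h3 : ∀ j ∈ S, ((G i ∩ G j).card : ℝ) ≤
        5 * B ^ 2 / δ ^ 2 * (1 + ‖(v j - v o) - (v i - v o)‖ / δ)⁻¹ := by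
      intro j hj
      have h4 := F.card_inter_le (hT' hi) (hT' (hS j hj))
      have e : (v j - v o) - (v i - v o) = v j - v i := by abel
      rw [e, norm_sub_rev, ← div_eq_mul_inv, le_div_iff₀ (by positivity),
        le_div_iff₀ (by positivity)]
      refine le_trans ?_ h4
      gcongr
      exact hGJ i
      exact hGJ j
    rw [h1]
    refine (Finset.sum_le_sum h3).trans ?_
    rw [← Finset.mul_sum]
    gcongr
    have h5 := sum_inv_le_of_near_line hm S (fun j => v j - v o) hδ
      (by positivity : (0 : ℝ) ≤ 12 * B ^ 2 * Λ * δ) (v i - v o) (v i - v o) ?_ ?_ N ?_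
    · refine h5.trans (le_of_eq ?_)
      congr 2
      field_simp; ring
    · intro j hj k hk hjk
      have := hsep j (hT' (hS j hj)) k (hT' (hS k hk)) hjk
      simpa using this
    · intro j hj
      obtain ⟨r, hr⟩ := (Finset.mem_filter.1 hj).2
      rw [Finset.mem_inter] at hr
      have hrj := (Finset.mem_filter.1 hr.2).2
      have := F.near_line ho (hT' hi) (hT' (hS j hj)) (hp i hi).1 (hp i hi).2 (hp j (hS j hj)).1
        (hp j (hS j hj)).2 (hGJ i hr.1) (hGJ j hr.2) hρ (not_le.1 hrj).le
      have e : 6 * B * δ / ρ = 12 * B ^ 2 * Λ * δ := by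
        rw [hρdef]; field_simp; ring
      rwa [e] at this
    · intro j hj
      refine le_trans ?_ hN
      have e : (v j - v o) - (v i - v o) = v j - v i := by abel
      rw [e]
      gcongr
      linarith [norm_sub_le (v j) (v i), F.slope i (hT' hi), F.slope j (hT' (hS j hj))]
  have hCS := sq_sum_card_le T' Q G fun i _ => hGQ i
  have hlow : (T'.card : ℝ) ≤ (∑ i ∈ T', ((G i).card : ℝ)) * (2 * Λ * δ ^ 2) := by
    rw [Finset.sum_mul]
    calc (T'.card : ℝ) = ∑ _i ∈ T', (1 : ℝ) := by simp
      _ ≤ _ := Finset.sum_le_sum hGcard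
  have hup : ∑ i ∈ T', ∑ j ∈ T', ((G i ∩ G j).card : ℝ) ≤
      T'.card * (5 * B ^ 2 / δ ^ 2 * ((4 + 96 * B ^ 2 * Λ) ^ m * (2 * H))) := by
    rw [← nsmul_eq_mul]
    exact Finset.sum_le_card_nsmul _ _ _ hpair
  have hTpos : (0 : ℝ) < T'.card := by exact_mod_cast Finset.card_pos.2 h0
  have hsq : (T'.card : ℝ) ^ 2 ≤ T'.card * (Q.card * δ ^ 2 * (40 * B ^ 2 * Λ ^ 2 *
      (4 + 96 * B ^ 2 * Λ) ^ m * H)) := by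
    calc (T'.card : ℝ) ^ 2 ≤ ((∑ i ∈ T', ((G i).card : ℝ)) * (2 * Λ * δ ^ 2)) ^ 2 := by gcongr
      _ = (∑ i ∈ T', ((G i).card : ℝ)) ^ 2 * (2 * Λ * δ ^ 2) ^ 2 := by ring
      _ ≤ (Q.card * ∑ i ∈ T', ∑ j ∈ T', ((G i ∩ G j).card : ℝ)) * (2 * Λ * δ ^ 2) ^ 2 := by gcongr
      _ ≤ (Q.card * (T'.card * (5 * B ^ 2 / δ ^ 2 * ((4 + 96 * B ^ 2 * Λ) ^ m * (2 * H)))))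
          * (2 * Λ * δ ^ 2) ^ 2 := by gcongr
      _ = _ := by field_simp; ring
  rw [sq] at hsq
  exact le_of_mul_le_mul_left hsq hTpos

end TubeFamily

/-! ### Double counting and the bush. -/

/-- Double counting of incidences. -/
theorem sum_card_filter_mem_eq {ι β : Type*} [DecidableEq β] (T : Finset ι) (Q : Finset β)
    (J : ι → Finset β) :
    ∑ q ∈ Q, ((T.filter fun i => q ∈ J i).card : ℝ) = ∑ i ∈ T, ((J i ∩ Q).card : ℝ) := by
  have h1 : ∀ q, ((T.filter fun i => q ∈ J i).card : ℝ) = ∑ i ∈ T, if q ∈ J i then 1 else 0 := by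
    intro q; rw [Finset.sum_boole]
  have h2 : ∀ i, ((J i ∩ Q).card : ℝ) = ∑ q ∈ Q, if q ∈ J i then (1 : ℝ) else 0 := by
    intro i; rw [Finset.sum_boole, Finset.filter_mem_eq_inter, Finset.inter_comm]
  simp_rw [h1, h2]
  exact Finset.sum_comm

namespace TubeFamily

variable {ι β : Type*} {m : ℕ} {T : Finset ι} {v a : ι → Fin m → ℝ}
  {x : β → Fin m → ℝ} {h : β → ℝ} {J : ι → Finset β} {δ B : ℝ}

/-- Bourgain's bush argument for tubes whose directions are only separated when they meet. -/
theorem card_le_of_bush [DecidableEq β] (F : TubeFamily T v a x h J δ B) (u : ι → Fin m → ℝ)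
    (hsep : ∀ i ∈ T, ∀ j ∈ T, i ≠ j → δ ≤ ‖u i - u j‖)
    (hdir : ∀ i ∈ T, ∀ j ∈ T, (J i ∩ J j).Nonempty → ‖u i - u j‖ ≤ B * (‖v i - v j‖ + δ))
    (Q : Finset β) (hJQ : ∀ i ∈ T, J i ⊆ Q) (hJ : ∀ i ∈ T, 1 ≤ ((J i).card : ℝ) * δ ^ 2 * B)
    (hBδ : 2 * B ^ 2 * δ ≤ 1) :
    (T.card : ℝ) ≤ (Q.card : ℝ) ^ 2 * δ ^ 4 * (2 * B ^ 2 * (20 * B ^ 4) ^ m) := by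
  have hδ := F.δ_pos
  have h2 := F.two_le
  have hB : 0 < B := by linarith
  set ρ : ℝ := 1 / (2 * B ^ 2) with hρdef
  have hρ : 0 < ρ := by positivity
  have hδρ : δ ≤ ρ := by rw [hρdef, le_div_iff₀ (by positivity)]; linarith
  -- The bush at `q`. If two of its tubes also share a box `q'` at height more than `ρ` from `q`,
  -- their slopes differ by `O(B³δ)`, so by `hdir` their parameters `u` differ by `O(B⁴δ)`. Since
  -- the `u i` are `δ`-separated, each far box lies on boundedly many tubes of the bush. The choice
  -- of `ρ` leaves each tube at least half of its guaranteed boxes.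
  have hbox : ∀ q ∈ Q, ((T.filter fun i => q ∈ J i).card : ℝ) ≤
      Q.card * (δ ^ 2 * (2 * B * (20 * B ^ 4) ^ m)) := by
    intro q _
    set S := T.filter fun i => q ∈ J i with hS
    let G : ι → Finset β := fun i => (J i).filter fun q' => ¬ |h q' - h q| ≤ ρ
    have hG : ∀ i ∈ S, 1 ≤ ((G i).card : ℝ) * (δ ^ 2 * (2 * B)) := by
      intro i hi
      have hiT := (Finset.mem_filter.1 hi).1
      have h3 := F.count i hiT (h q) ρ hδρ
      have h4 : (((J i).filter fun q' => |h q' - h q| ≤ ρ).card : ℝ) + (G i).card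
          = (J i).card := by
        exact_mod_cast Finset.card_filter_add_card_filter_not (s := J i)
          (fun q' => |h q' - h q| ≤ ρ)
      have h5 := hJ i hiT
      have h6 : B * ρ * B = 1 / 2 := by rw [hρdef]; field_simp
      rw [← h4] at h5
      nlinarith
    have hcount : ∀ q' ∈ Q, ((S.filter fun i => q' ∈ G i).card : ℝ) ≤ (20 * B ^ 4) ^ m := by
      intro q' _
      rcases (S.filter fun i => q' ∈ G i).eq_empty_or_nonempty with h0 | ⟨o, ho⟩
      · rw [h0]; simp; positivity
      have hmem : ∀ i ∈ S.filter fun i => q' ∈ G i,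
          i ∈ T ∧ q ∈ J i ∧ q' ∈ J i ∧ ρ < |h q' - h q| := by
        intro i hi
        have h3 := Finset.mem_filter.1 hi
        have h4 := Finset.mem_filter.1 h3.1
        have h5 := Finset.mem_filter.1 h3.2
        exact ⟨h4.1, h4.2, h5.1, not_le.1 h5.2⟩
      obtain ⟨hoT, hoq, hoq', hfar⟩ := hmem o ho
      have := card_le_of_separated (S.filter fun i => q' ∈ G i) u hδ
        (by positivity : (0 : ℝ) ≤ 9 * B ^ 4 * δ) (u o)
        (fun i hi j hj => hsep i (hmem i hi).1 j (hmem j hj).1) ?_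
      · refine this.trans ?_
        have h1B : 1 ≤ B ^ 4 := one_le_pow₀ (by linarith)
        have e : 2 * (9 * B ^ 4 * δ) / δ + 2 = 18 * B ^ 4 + 2 := by field_simp; ring
        rw [e]
        gcongr
        linarith
      · intro i hi
        obtain ⟨hiT, hiq, hiq', -⟩ := hmem i hi
        have h3 := hdir i hiT o hoT ⟨q, Finset.mem_inter.2 ⟨hiq, hoq⟩⟩
        have h4 := F.height_sub_mul_le hiT hoT hiq' hiq hoq' hoq
        have h5 : ‖v i - v o‖ ≤ 8 * B ^ 3 * δ := by
          have h6 : ρ * ‖v i - v o‖ ≤ 4 * B * δ :=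
            le_trans (by gcongr) h4
          have h7 : ρ * (8 * B ^ 3 * δ) = 4 * B * δ := by rw [hρdef]; field_simp; ring
          rw [← h7] at h6
          exact le_of_mul_le_mul_left h6 hρ
        have h8 : B * δ ≤ B ^ 4 * δ := by
          gcongr
          exact le_self_pow₀ (by linarith) (by norm_num)
        calc _ ≤ B * (8 * B ^ 3 * δ + δ) := h3.trans (by gcongr)
          _ = 8 * B ^ 4 * δ + B * δ := by ring
          _ ≤ _ := by linarith
    calc (S.card : ℝ) = ∑ _i ∈ S, (1 : ℝ) := by simp
      _ ≤ ∑ i ∈ S, ((G i).card : ℝ) * (δ ^ 2 * (2 * B)) := Finset.sum_le_sum hG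
      _ = (∑ i ∈ S, ((G i ∩ Q).card : ℝ)) * (δ ^ 2 * (2 * B)) := by
          rw [Finset.sum_mul]
          refine Finset.sum_congr rfl fun i hi => ?_
          rw [Finset.inter_eq_left.2
            ((Finset.filter_subset _ _).trans (hJQ i (Finset.mem_filter.1 hi).1))]
      _ = (∑ q' ∈ Q, ((S.filter fun i => q' ∈ G i).card : ℝ)) * (δ ^ 2 * (2 * B)) := by
          rw [sum_card_filter_mem_eq]
      _ ≤ (Q.card * (20 * B ^ 4) ^ m) * (δ ^ 2 * (2 * B)) := by
          gcongr
          rw [← nsmul_eq_mul]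
          exact Finset.sum_le_card_nsmul _ _ _ hcount
      _ = _ := by ring
  calc (T.card : ℝ) = ∑ _i ∈ T, (1 : ℝ) := by simp
    _ ≤ ∑ i ∈ T, ((J i).card : ℝ) * δ ^ 2 * B := Finset.sum_le_sum hJ
    _ = (∑ i ∈ T, ((J i ∩ Q).card : ℝ)) * (δ ^ 2 * B) := by
        rw [Finset.sum_mul]
        refine Finset.sum_congr rfl fun i hi => ?_
        rw [Finset.inter_eq_left.2 (hJQ i hi), mul_assoc]
    _ = (∑ q ∈ Q, ((T.filter fun i => q ∈ J i).card : ℝ)) * (δ ^ 2 * B) := by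
        rw [sum_card_filter_mem_eq]
    _ ≤ (Q.card * (Q.card * (δ ^ 2 * (2 * B * (20 * B ^ 4) ^ m)))) * (δ ^ 2 * B) := by
        gcongr
        have h9 := Finset.sum_le_card_nsmul Q _ _ hbox
        rwa [nsmul_eq_mul] at h9
    _ = _ := by ring

end TubeFamily

/-! ### Finding the spine of a hairbrush. -/

/-- If at every box most pairs of tubes are far apart, some tube meets many good tubes which are
far from it. -/
theorem exists_tube_with_many_neighbours {ι β : Type*} [DecidableEq β]
    (T T' : Finset ι) (hT' : T' ⊆ T) (Q : Finset β) (J : ι → Finset β)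
    (far : ι → ι → Prop) [DecidableRel far] {I P : ℝ} (hP : 0 ≤ P) (hT : T.Nonempty)
    (hI : ∑ i ∈ T, ((J i ∩ Q).card : ℝ) = I) (hgood : 3 / 4 * I ≤ ∑ i ∈ T', ((J i ∩ Q).card : ℝ))
    (hfar : ∀ q ∈ Q, ∀ i ∈ T, q ∈ J i →
      (((T.filter fun j => q ∈ J j).filter fun j => ¬ far i j).card : ℝ) * 4 ≤
        (T.filter fun j => q ∈ J j).card)
    (hinter : ∀ i ∈ T, ∀ j ∈ T, far i j → ((J j ∩ J i).card : ℝ) ≤ P) :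
    ∃ o ∈ T, I ^ 2 ≤ 32 * Q.card * T.card * P *
      (T'.filter fun j => (J j ∩ J o).Nonempty).card := by
  classical
  set s : β → ℝ := fun q => ((T.filter fun j => q ∈ J j).card : ℝ) with hs
  set g : β → ℝ := fun q => ((T'.filter fun j => q ∈ J j).card : ℝ) with hg
  have hgs : ∀ q, g q ≤ s q := fun q => by
    simp only [hs, hg]
    gcongr
  have hg0 : ∀ q, 0 ≤ g q := fun q => Nat.cast_nonneg _
  have hsum_s : ∑ q ∈ Q, s q = I := by rw [← hI, ← sum_card_filter_mem_eq]
  have hsum_g : 3 / 4 * I ≤ ∑ q ∈ Q, g q := by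
    simp only [hg]
    rwa [sum_card_filter_mem_eq]
  have hI0 : 0 ≤ I := by
    rw [← hI]; exact Finset.sum_nonneg fun _ _ => Nat.cast_nonneg _
  -- Boxes where the tubes of `T'` are at least half of all tubes. The other boxes carry at most
  -- `I/2` incidences with `T'`, so at least `I/4` survive.
  set Q' := Q.filter fun q => s q ≤ 2 * g q with hQ'
  have hQ'g : I / 4 ≤ ∑ q ∈ Q', g q := by
    have h1 := Finset.sum_filter_add_sum_filter_not Q (fun q => s q ≤ 2 * g q) g
    have h2 : ∑ q ∈ Q with ¬ s q ≤ 2 * g q, g q ≤ I / 2 := by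
      calc _ ≤ ∑ q ∈ Q with ¬ s q ≤ 2 * g q, s q / 2 := by
            apply Finset.sum_le_sum
            intro q hq
            linarith [not_le.1 (Finset.mem_filter.1 hq).2]
        _ ≤ ∑ q ∈ Q, s q / 2 := by
            apply Finset.sum_le_sum_of_subset_of_nonneg (Finset.filter_subset _ _)
            intro q _ _
            linarith [hgs q, hg0 q]
        _ = I / 2 := by rw [← Finset.sum_div, hsum_s]
    linarith
  have hpairs : ∀ q ∈ Q', ∀ i ∈ T, q ∈ J i → g q / 2 ≤
      (((T'.filter fun j => q ∈ J j).filter fun j => far i j).card : ℝ) := by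
    intro q hq i hi hqi
    rw [hQ', Finset.mem_filter] at hq
    have h1 := hfar q hq.1 i hi hqi
    have h2 : ((((T'.filter fun j => q ∈ J j).filter fun j => far i j).card : ℝ) +
        ((T'.filter fun j => q ∈ J j).filter fun j => ¬ far i j).card) = g q := by
      simp only [hg]
      exact_mod_cast Finset.card_filter_add_card_filter_not (s := T'.filter fun j => q ∈ J j)
        (fun j => far i j)
    have h3 : (((T'.filter fun j => q ∈ J j).filter fun j => ¬ far i j).card : ℝ) ≤
        ((T.filter fun j => q ∈ J j).filter fun j => ¬ far i j).card := by
      gcongr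
    have h4 : s q = (T.filter fun j => q ∈ J j).card := rfl
    linarith [hq.2]
  set Br : ι → Finset ι := fun o => T'.filter fun j => (J j ∩ J o).Nonempty with hBr
  -- Count triples `(q, i, j)` with `q ∈ Q'` on both `i ∈ T` and `j ∈ T'`, the tubes being far
  -- apart. Each `q` contributes at least `s q * g q / 2`, hence at least `g q ^ 2 / 2`, and each
  -- pair that meets contributes at most `P`.
  have hlow : ∑ q ∈ Q', (g q) ^ 2 / 2 ≤ ∑ i ∈ T, P * (Br i).card := by
    calc ∑ q ∈ Q', (g q) ^ 2 / 2 ≤ ∑ q ∈ Q', ∑ i ∈ T with q ∈ J i, g q / 2 := by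
          apply Finset.sum_le_sum
          intro q _
          rw [Finset.sum_const, nsmul_eq_mul]
          change _ ≤ s q * _
          nlinarith [hgs q, hg0 q]
      _ ≤ ∑ q ∈ Q', ∑ i ∈ T with q ∈ J i, ∑ j ∈ T' with far i j,
            if q ∈ J j then (1 : ℝ) else 0 := by
          apply Finset.sum_le_sum
          intro q hq
          apply Finset.sum_le_sum
          intro i hi
          rw [Finset.mem_filter] at hi
          rw [Finset.sum_boole, Finset.filter_filter]
          refine (hpairs q hq i hi.1 hi.2).trans (le_of_eq ?_)
          rw [Finset.filter_filter]
          simp only [and_comm]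
      _ = ∑ q ∈ Q', ∑ i ∈ T, ∑ j ∈ T' with far i j,
            (if q ∈ J i then (1 : ℝ) else 0) * if q ∈ J j then (1 : ℝ) else 0 := by
          apply Finset.sum_congr rfl
          intro q _
          rw [Finset.sum_filter]
          apply Finset.sum_congr rfl
          intro i _
          split_ifs <;> simp
      _ = ∑ i ∈ T, ∑ j ∈ T' with far i j, ∑ q ∈ Q',
            (if q ∈ J i then (1 : ℝ) else 0) * if q ∈ J j then (1 : ℝ) else 0 := by
          rw [Finset.sum_comm]
          exact Finset.sum_congr rfl fun i _ => Finset.sum_comm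
      _ ≤ ∑ i ∈ T, ∑ j ∈ T' with far i j, if (J j ∩ J i).Nonempty then P else 0 := by
          apply Finset.sum_le_sum
          intro i hi
          apply Finset.sum_le_sum
          intro j hj
          rw [Finset.mem_filter] at hj
          have h1 : ∑ q ∈ Q', ((if q ∈ J i then (1 : ℝ) else 0) * if q ∈ J j then (1 : ℝ) else 0)
              ≤ ((J j ∩ J i).card : ℝ) := by
            have h2 : ∀ q, ((if q ∈ J i then (1 : ℝ) else 0) * if q ∈ J j then (1 : ℝ) else 0)
                = if q ∈ J j ∩ J i then 1 else 0 := by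
              intro q
              by_cases h3 : q ∈ J i <;> by_cases h4 : q ∈ J j <;> simp [h3, h4]
            simp_rw [h2]
            rw [Finset.sum_boole, Finset.filter_mem_eq_inter]
            exact Nat.cast_le.2 (Finset.card_le_card Finset.inter_subset_right)
          split_ifs with h3
          · exact h1.trans (hinter i hi j (hT' hj.1) hj.2)
          · rw [Finset.not_nonempty_iff_eq_empty.1 h3] at h1
            simpa using h1
      _ ≤ ∑ i ∈ T, ∑ j ∈ T', if (J j ∩ J i).Nonempty then P else 0 := by
          apply Finset.sum_le_sum
          intro i _
          apply Finset.sum_le_sum_of_subset_of_nonneg (Finset.filter_subset _ _)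
          intro j _ _
          split_ifs <;> simp [hP]
      _ = ∑ i ∈ T, P * (Br i).card := by
          apply Finset.sum_congr rfl
          intro i _
          rw [← Finset.sum_filter, Finset.sum_const, nsmul_eq_mul, mul_comm]
  have hCS : (∑ q ∈ Q', g q) ^ 2 ≤ Q.card * ∑ q ∈ Q', g q ^ 2 := by
    refine sq_sum_le_card_mul_sum_sq.trans ?_
    exact mul_le_mul_of_nonneg_right
      (Nat.cast_le.2 (Finset.card_le_card (Finset.filter_subset _ _)))
      (Finset.sum_nonneg fun q _ => sq_nonneg _)
  have htot : I ^ 2 ≤ ∑ i ∈ T, 32 * Q.card * P * (Br i).card := by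
    have h1 : (I / 4) ^ 2 ≤ (∑ q ∈ Q', g q) ^ 2 := by gcongr
    rw [← Finset.sum_div] at hlow
    have h3 : ∑ i ∈ T, 32 * Q.card * P * ((Br i).card : ℝ) =
        32 * Q.card * ∑ i ∈ T, P * (Br i).card := by
      rw [Finset.mul_sum]
      exact Finset.sum_congr rfl fun i _ => by ring
    rw [h3]
    have h4 : (Q.card : ℝ) * ((∑ q ∈ Q', g q ^ 2) / 2) ≤ Q.card * ∑ i ∈ T, P * (Br i).card := by
      gcongr
    nlinarith
  have hTc : (0 : ℝ) < T.card := by exact_mod_cast hT.card_pos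
  have h1 : ∑ _i ∈ T, I ^ 2 / T.card ≤ ∑ i ∈ T, 32 * Q.card * P * ((Br i).card : ℝ) := by
    rw [Finset.sum_const, nsmul_eq_mul, mul_div_cancel₀ _ hTc.ne']
    exact htot
  obtain ⟨o, ho, h2⟩ := Finset.exists_le_of_sum_le hT h1
  refine ⟨o, ho, ?_⟩
  rw [div_le_iff₀ hTc] at h2
  linarith

/-! ### Grids of directions and pigeonholing of cells. -/

/-- The cell of `v` at level `l` in the `b`-adic grid of `ℝᵐ`. -/
noncomputable def gridCell {m : ℕ} (b l : ℕ) (v : Fin m → ℝ) : Fin m → ℤ :=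
  fun j => ⌊(b : ℝ) ^ l * v j⌋

theorem card_image_gridCell_le {ι : Type*} {m : ℕ} [DecidableEq (Fin m → ℤ)] (T : Finset ι)
    (v : ι → Fin m → ℝ)
    (hv : ∀ i ∈ T, ‖v i‖ ≤ 1) {b : ℕ} (hb : 1 ≤ b) (l : ℕ) :
    ((T.image fun i => gridCell b l (v i)).card : ℝ) ≤ (4 * (b : ℝ) ^ l) ^ m := by
  have hb1 : (1 : ℝ) ≤ (b : ℝ) ^ l := one_le_pow₀ (by exact_mod_cast hb)
  have hsub : (T.image fun i => gridCell b l (v i)) ⊆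
      Fintype.piFinset fun _ : Fin m => Finset.Icc (-(b ^ l : ℕ) : ℤ) (b ^ l : ℕ) := by
    intro c hc
    obtain ⟨i, hi, rfl⟩ := Finset.mem_image.1 hc
    rw [Fintype.mem_piFinset]
    intro j
    have h1 := (norm_le_pi_norm (v i) j).trans (hv i hi)
    rw [Real.norm_eq_abs, abs_le] at h1
    rw [Finset.mem_Icc]
    simp only [gridCell]
    constructor
    · rw [Int.le_floor]; push_cast; nlinarith
    · rw [← Int.floor_intCast (R := ℝ) ((b ^ l : ℕ) : ℤ)]
      apply Int.floor_le_floor; push_cast; nlinarith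
  refine (Nat.cast_le.2 (Finset.card_le_card hsub)).trans ?_
  rw [Fintype.card_piFinset_const, Int.card_Icc]
  have e : ((b ^ l : ℕ) + 1 - -(b ^ l : ℕ) : ℤ).toNat = 2 * b ^ l + 1 := by omega
  rw [e]
  push_cast
  gcongr
  linarith

theorem card_gridCell_le {ι : Type*} {m : ℕ} [DecidableEq (Fin m → ℤ)] (T : Finset ι)
    (v : ι → Fin m → ℝ) {δ : ℝ} (hδ : 0 < δ)
    (hsep : ∀ i ∈ T, ∀ j ∈ T, i ≠ j → δ ≤ ‖v i - v j‖) {b : ℕ} (hb : 1 ≤ b) {l : ℕ}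
    (hl : (b : ℝ) ^ l * δ ≤ 1) (c : Fin m → ℤ) :
    ((T.filter fun i => gridCell b l (v i) = c).card : ℝ) ≤ (4 / ((b : ℝ) ^ l * δ)) ^ m := by
  have hb0 : (0 : ℝ) < (b : ℝ) ^ l := by have : (0 : ℝ) < b := by exact_mod_cast hb
                                         positivity
  rcases (T.filter fun i => gridCell b l (v i) = c).eq_empty_or_nonempty with h0 | ⟨o, ho⟩
  · rw [h0]; simp only [Finset.card_empty, Nat.cast_zero]; positivity
  have ho' := (Finset.mem_filter.1 ho).2
  refine (card_le_of_separated _ v hδ (by positivity : (0 : ℝ) ≤ 1 / (b : ℝ) ^ l) (v o)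
    (fun i hi j hj => hsep i (Finset.mem_filter.1 hi).1 j (Finset.mem_filter.1 hj).1) ?_).trans ?_
  · intro i hi
    have hi' := (Finset.mem_filter.1 hi).2
    rw [pi_norm_le_iff_of_nonneg (by positivity)]
    intro j
    have h3 : ⌊(b : ℝ) ^ l * v i j⌋ = ⌊(b : ℝ) ^ l * v o j⌋ := congrFun (hi'.trans ho'.symm) j
    have h4 := Int.abs_sub_lt_one_of_floor_eq_floor h3
    rw [← mul_sub, abs_mul, abs_of_pos hb0] at h4
    rw [le_div_iff₀ hb0, mul_comm]
    exact h4.le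
  · gcongr
    have h1 : 1 ≤ 1 / ((b : ℝ) ^ l * δ) := by rw [le_div_iff₀ (by positivity)]; linarith
    have e : 2 * (1 / (b : ℝ) ^ l) / δ = 2 * (1 / ((b : ℝ) ^ l * δ)) := by field_simp
    have e' : 4 / ((b : ℝ) ^ l * δ) = 4 * (1 / ((b : ℝ) ^ l * δ)) := by ring
    rw [e, e']; linarith

/-- The points close to a given one lie in few cells. -/
theorem card_close_le {ι : Type*} {m : ℕ} [DecidableEq (Fin m → ℤ)] (S : Finset ι)
    (v : ι → Fin m → ℝ) {b : ℕ}
    (hb : 1 ≤ b) (l : ℕ) (w : Fin m → ℝ) (hclose : ∀ i ∈ S, ‖w - v i‖ < 1 / (b : ℝ) ^ l) {n : ℝ}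
    (hn : ∀ c, ((S.filter fun i => gridCell b l (v i) = c).card : ℝ) ≤ n) :
    (S.card : ℝ) ≤ 3 ^ m * n := by
  have hb0 : (0 : ℝ) < (b : ℝ) ^ l := by have : (0 : ℝ) < b := by exact_mod_cast hb
                                         positivity
  let C : Finset (Fin m → ℤ) := Fintype.piFinset fun j =>
    Finset.Icc (gridCell b l w j - 1) (gridCell b l w j + 1)
  have hmaps : ∀ i ∈ S, gridCell b l (v i) ∈ C := by
    intro i hi
    rw [Fintype.mem_piFinset]
    intro j
    have h1 := (norm_le_pi_norm (w - v i) j).trans_lt (hclose i hi)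
    rw [Real.norm_eq_abs, Pi.sub_apply, lt_div_iff₀ hb0] at h1
    have h1' : |(b : ℝ) ^ l * w j - (b : ℝ) ^ l * v i j| < 1 := by
      rwa [← mul_sub, abs_mul, abs_of_pos hb0, mul_comm]
    rw [abs_lt] at h1'
    have h2 := Int.floor_le ((b : ℝ) ^ l * w j)
    have h3 := Int.lt_floor_add_one ((b : ℝ) ^ l * w j)
    have h4 := Int.floor_le ((b : ℝ) ^ l * v i j)
    have h5 := Int.lt_floor_add_one ((b : ℝ) ^ l * v i j)
    rw [Finset.mem_Icc]
    simp only [gridCell]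
    constructor
    · rw [Int.le_floor]; push_cast; linarith
    · rw [← Int.lt_add_one_iff, Int.floor_lt]; push_cast; linarith
  have hcard : C.card = 3 ^ m := by
    rw [Fintype.card_piFinset]
    have : ∀ z : ℤ, (Finset.Icc (z - 1) (z + 1)).card = 3 := by
      intro z; rw [Int.card_Icc]; omega
    simp [this]
  rw [Finset.card_eq_sum_card_fiberwise hmaps]
  push_cast
  refine (Finset.sum_le_card_nsmul _ _ n fun c _ => hn c).trans ?_
  rw [hcard, nsmul_eq_mul]; push_cast; rfl

/-- Every finite set has a cell of level at most `L` which holds a large part of it, while the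
cells of the next level hold only small parts of that. -/
theorem exists_concentration_cell {ι κ : Type*} [DecidableEq κ] {S T : Finset ι} (hST : S ⊆ T)
    (hS : S.Nonempty) (f : ℕ → ι → κ) (L : ℕ) {C W : ℝ} (hW : 1 ≤ W)
    (hC : ((T.image (f 0)).card : ℝ) ≤ C) :
    ∃ l c, l ≤ L ∧ (∃ i ∈ S, f l i = c) ∧
      (S.card : ℝ) ≤ C * W ^ L * (S.filter fun i => f l i = c).card ∧
      (l < L → ∀ c', W * ((S.filter fun i => f (l + 1) i = c').card : ℝ) ≤
        (S.filter fun i => f l i = c).card) := by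
  have hW0 : 0 < W := by linarith
  -- Maximise `W ^ l` times the number of points in the cell. Comparison with level `0`, which has
  -- at most `C` cells, shows that the cell is large; comparison with level `l + 1` shows that it is
  -- spread out.
  obtain ⟨⟨l, o⟩, hlo, hmax⟩ := Finset.exists_max_image (Finset.range (L + 1) ×ˢ S)
    (fun p => W ^ p.1 * ((S.filter fun i => f p.1 i = f p.1 p.2).card : ℝ))
    ((Finset.nonempty_range_iff.2 (by omega)).product hS)
  rw [Finset.mem_product, Finset.mem_range] at hlo
  have hC0 : 0 ≤ C := (Nat.cast_nonneg _).trans hC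
  refine ⟨l, f l o, by omega, ⟨o, hlo.2, rfl⟩, ?_, ?_⟩
  · have h1 : ∀ c ∈ T.image (f 0), ((S.filter fun i => f 0 i = c).card : ℝ) ≤
        W ^ L * ((S.filter fun i => f l i = f l o).card : ℝ) := by
      intro c _
      rcases (S.filter fun i => f 0 i = c).eq_empty_or_nonempty with h0 | ⟨i, hi⟩
      · rw [h0]; simp only [Finset.card_empty, Nat.cast_zero]; positivity
      · rw [Finset.mem_filter] at hi
        have h2 := hmax (0, i) (Finset.mem_product.2 ⟨Finset.mem_range.2 (by omega), hi.1⟩)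
        simp only [pow_zero, one_mul, hi.2] at h2
        refine h2.trans ?_
        gcongr
        omega
    rw [Finset.card_eq_sum_card_fiberwise (f := f 0) (t := T.image (f 0))
      fun i hi => Finset.mem_image_of_mem _ (hST hi)]
    push_cast
    refine (Finset.sum_le_card_nsmul _ _ _ h1).trans ?_
    rw [nsmul_eq_mul, mul_assoc]
    gcongr
  · intro hl c'
    rcases (S.filter fun i => f (l + 1) i = c').eq_empty_or_nonempty with h0 | ⟨i, hi⟩
    · rw [h0]; simp
    · rw [Finset.mem_filter] at hi
      have h2 := hmax (l + 1, i) (Finset.mem_product.2 ⟨Finset.mem_range.2 (by omega), hi.1⟩)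
      simp only [hi.2] at h2
      rw [pow_succ, mul_assoc] at h2
      exact le_of_mul_le_mul_left h2 (by positivity)

/-- Among the cells assigned to the boxes, one has at least half the average incidence per box and
not too few incidences. -/
theorem exists_heavy_cell {β κ : Type*} [DecidableEq κ] {Q : Finset β} (hQ : Q.Nonempty)
    (cell : β → ℕ × κ) (r : β → ℝ) (hr : ∀ q ∈ Q, 0 ≤ r q) (L : ℕ) (hL : ∀ q ∈ Q, (cell q).1 ≤ L)
    (A : ℕ → Finset κ) (hA : ∀ q ∈ Q, (cell q).2 ∈ A (cell q).1) (C : ℕ → ℝ) (hC0 : ∀ l, 0 < C l)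
    (hC : ∀ l, ((A l).card : ℝ) ≤ C l) :
    ∃ τ : ℕ × κ, (∃ q ∈ Q, cell q = τ) ∧
      (∑ q ∈ Q, r q) * (Q.filter fun q => cell q = τ).card ≤
        2 * Q.card * ∑ q ∈ Q with cell q = τ, r q ∧
      ∑ q ∈ Q, r q ≤ 2 * (L + 1) * C τ.1 * ∑ q ∈ Q with cell q = τ, r q := by
  set I := ∑ q ∈ Q, r q with hI
  have hI0 : 0 ≤ I := Finset.sum_nonneg hr
  set M : ℕ × κ → ℝ := fun τ => ((Q.filter fun q => cell q = τ).card : ℝ) with hM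
  have hQ0 : (0 : ℝ) < Q.card := by exact_mod_cast hQ.card_pos
  set 𝒞 := Q.image cell with h𝒞
  have hmaps : ∀ q ∈ Q, cell q ∈ 𝒞 := fun q hq => Finset.mem_image_of_mem _ hq
  have h1 : ∑ τ ∈ 𝒞, M τ = Q.card := by
    rw [Finset.card_eq_sum_card_fiberwise hmaps]; push_cast; rfl
  have h2 : ∑ τ ∈ 𝒞, ∑ q ∈ Q with cell q = τ, r q = I := Finset.sum_fiberwise_of_maps_to hmaps r
  have h3 : ∑ τ ∈ 𝒞, (C τ.1)⁻¹ ≤ L + 1 := by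
    have hmaps' : ∀ τ ∈ 𝒞, τ.1 ∈ Finset.range (L + 1) := by
      intro τ hτ
      obtain ⟨q, hq, rfl⟩ := Finset.mem_image.1 hτ
      exact Finset.mem_range.2 (by have := hL q hq; omega)
    rw [← Finset.sum_fiberwise_of_maps_to hmaps']
    have h4 : ∀ l ∈ Finset.range (L + 1), ∑ τ ∈ 𝒞 with τ.1 = l, (C τ.1)⁻¹ ≤ 1 := by
      intro l _
      have h5 : ((𝒞.filter fun τ => τ.1 = l).card : ℝ) ≤ C l := by
        refine le_trans (Nat.cast_le.2 (Finset.card_le_card_of_injOn Prod.snd ?_ ?_)) (hC l)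
        · intro τ hτ
          rw [Finset.mem_coe, Finset.mem_filter] at hτ
          obtain ⟨q, hq, rfl⟩ := Finset.mem_image.1 hτ.1
          rw [← hτ.2]
          exact hA q hq
        · intro τ hτ σ hσ h
          rw [Finset.mem_coe, Finset.mem_filter] at hτ hσ
          exact Prod.ext (hτ.2.trans hσ.2.symm) h
      calc _ = ∑ τ ∈ 𝒞 with τ.1 = l, (C l)⁻¹ :=
            Finset.sum_congr rfl fun τ hτ => by rw [(Finset.mem_filter.1 hτ).2]
        _ = (𝒞.filter fun τ => τ.1 = l).card * (C l)⁻¹ := by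
            rw [Finset.sum_const, nsmul_eq_mul]
        _ ≤ C l * (C l)⁻¹ := by
            have := hC0 l
            gcongr
        _ = 1 := mul_inv_cancel₀ (hC0 l).ne'
    refine (Finset.sum_le_card_nsmul _ _ _ h4).trans ?_
    rw [Finset.card_range]; simp
  -- Each summand adds up both lower bounds wanted for the incidences of `τ`. The first terms total
  -- `I/2`, and the second at most `I/2` because each level contributes at most `1` to `h3`. So some
  -- `τ` meets both demands at once.
  have h4 : ∑ τ ∈ 𝒞, (I / (2 * Q.card) * M τ + I / (2 * (L + 1)) * (C τ.1)⁻¹) ≤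
      ∑ τ ∈ 𝒞, ∑ q ∈ Q with cell q = τ, r q := by
    rw [h2, Finset.sum_add_distrib, ← Finset.mul_sum, ← Finset.mul_sum, h1]
    have e1 : I / (2 * Q.card) * Q.card = I / 2 := by field_simp
    have e2 : I / (2 * (L + 1)) * ((L : ℝ) + 1) = I / 2 := by field_simp
    have h5 : I / (2 * (L + 1)) * ∑ τ ∈ 𝒞, (C τ.1)⁻¹ ≤ I / (2 * (L + 1)) * ((L : ℝ) + 1) := by
      gcongr
    linarith
  obtain ⟨τ, hτ, h5⟩ := Finset.exists_le_of_sum_le (hQ.image cell) h4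
  have hC' := hC0 τ.1
  have p1 : 0 ≤ I / (2 * Q.card) * M τ := by positivity
  have p2 : 0 ≤ I / (2 * (L + 1)) * (C τ.1)⁻¹ := by positivity
  refine ⟨τ, ?_, ?_, ?_⟩
  · obtain ⟨q, hq, h⟩ := Finset.mem_image.1 hτ
    exact ⟨q, hq, h⟩
  · have h6 : I / (2 * Q.card) * M τ ≤ ∑ q ∈ Q with cell q = τ, r q := by linarith
    rw [div_mul_eq_mul_div, div_le_iff₀ (by positivity)] at h6
    linarith
  · have h6 : I / (2 * (L + 1)) * (C τ.1)⁻¹ ≤ ∑ q ∈ Q with cell q = τ, r q := by linarith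
    rw [← div_eq_mul_inv, div_div, div_le_iff₀ (by positivity)] at h6
    linarith

/-! ### Assembling the hairbrush estimate. -/

/-- The arithmetic at the end of the hairbrush argument. -/
theorem hairbrush_arith {m : ℕ} {δ B I Iτ K Kc n b : ℝ} (hm : 0 < m) (hδ : 0 < δ) (h2 : 2 ≤ B)
    (hI : 0 ≤ I) (hQcpos : 0 < Kc) (hn0 : 0 ≤ n) (hbl1 : 1 ≤ b)
    (hIQc : I * Kc ≤ 2 * K * Iτ)
    (hmain : Iτ ^ 2 ≤ Kc ^ 2 * n * δ * b *
      (160 * B ^ 3 * (40 * B ^ 2 * (B ^ 6) ^ 2 * (4 + 96 * B ^ 2 * B ^ 6) ^ m * B)))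
    (hnm : n * (b * δ) ^ m ≤ B) (hdelta : 1 ≤ I * δ ^ (m + 2) * B ^ 4) :
    1 ≤ K ^ 2 * δ ^ (m + 5) * B ^ (42 + 15 * m) := by
  have hB1 : 1 ≤ B := by linarith
  have hB : 0 < B := by linarith
  have hb0 : 0 < b := by linarith
  set X : ℝ := 160 * B ^ 3 * (40 * B ^ 2 * (B ^ 6) ^ 2 * (4 + 96 * B ^ 2 * B ^ 6) ^ m * B) with hX
  have hXpos : 0 ≤ X := by positivity
  have hstep : I ^ 2 ≤ 4 * K ^ 2 * (n * δ * b * X) := by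
    have hsq : 0 < Kc ^ 2 := by positivity
    refine le_of_mul_le_mul_right ?_ hsq
    calc I ^ 2 * Kc ^ 2 = (I * Kc) ^ 2 := by ring
      _ ≤ (2 * K * Iτ) ^ 2 := by gcongr
      _ = 4 * K ^ 2 * Iτ ^ 2 := by ring
      _ ≤ 4 * K ^ 2 * (Kc ^ 2 * n * δ * b * X) := by gcongr
      _ = _ := by ring
  -- Here `m ≥ 1` enters: narrow cells cost a factor `b` in the intersection bound, but they hold
  -- fewer directions by a factor `b ^ m`.
  have hn : n * b * δ ^ m ≤ B := by
    calc n * b * δ ^ m ≤ n * (b) ^ m * δ ^ m := by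
          gcongr
          exact le_self_pow₀ hbl1 hm.ne'
      _ = n * (b * δ) ^ m := by rw [mul_pow]; ring
      _ ≤ B := hnm
  have hXle : 4 * X ≤ B ^ (33 + 15 * m) := by
    have h8 : (96 : ℝ) * B ^ 8 + 4 ≤ B ^ 15 := by
      have h9 : (1 : ℝ) ≤ B ^ 8 := one_le_pow₀ hB1
      have h10 : (2 : ℝ) ^ 7 ≤ B ^ 7 := by gcongr
      have e : B ^ 15 = B ^ 7 * B ^ 8 := by ring
      rw [e]; nlinarith
    have h11 : (2 : ℝ) ^ 15 ≤ B ^ 15 := by gcongr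
    calc 4 * X = 25600 * B ^ 18 * (96 * B ^ 8 + 4) ^ m := by rw [hX]; ring
      _ ≤ B ^ 15 * B ^ 18 * (B ^ 15) ^ m := by
          gcongr
          linarith
      _ = _ := by rw [← pow_mul]; ring
  have hI2 : 1 ≤ I ^ 2 * δ ^ (2 * m + 4) * B ^ 8 := by
    have := one_le_pow₀ hdelta (n := 2)
    calc 1 ≤ _ := this
      _ = _ := by ring
  calc 1 ≤ I ^ 2 * δ ^ (2 * m + 4) * B ^ 8 := hI2
    _ ≤ (4 * K ^ 2 * (n * δ * b * X)) * δ ^ (2 * m + 4) * B ^ 8 := by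
        gcongr
    _ = K ^ 2 * δ ^ (m + 5) * B ^ 8 * (n * b * δ ^ m) * (4 * X) := by
        ring
    _ ≤ K ^ 2 * δ ^ (m + 5) * B ^ 8 * B * B ^ (33 + 15 * m) := by gcongr
    _ = _ := by ring

namespace TubeFamily

variable {ι β : Type*} {m : ℕ} {T : Finset ι} {v a : ι → Fin m → ℝ}
  {x : β → Fin m → ℝ} {h : β → ℝ} {J : ι → Finset β} {δ B : ℝ}

/-- The hairbrush estimate within one cell of directions. -/
theorem sq_le_of_cell [DecidableEq β] (F : TubeFamily T v a x h J δ B) (hm : 0 < m)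
    (hsep : ∀ i ∈ T, ∀ j ∈ T, i ≠ j → δ ≤ ‖v i - v j‖) {Tc : Finset ι} (hTc : Tc ⊆ T)
    (Q : Finset β) {b l L : ℕ} (hbB : (b : ℝ) ≤ B) (hb : 1 ≤ b)
    (hl : l ≤ L) (hL : 1 < (b : ℝ) ^ (L + 1) * δ) {I Λ : ℝ} (hΛ : 1 ≤ Λ)
    (hΛδ : 2 * B * Λ * δ ≤ 1) (hTne : Tc.Nonempty)
    (hI : ∑ i ∈ Tc, ((J i ∩ Q).card : ℝ) = I) (hdense : 4 * Tc.card ≤ I * δ ^ 2 * Λ)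
    (hbroad : l < L → ∀ q ∈ Q, ∀ i ∈ Tc, q ∈ J i →
      (((Tc.filter fun j => q ∈ J j).filter fun j =>
        ‖v i - v j‖ < 1 / (b : ℝ) ^ (l + 1)).card : ℝ) * 4 ≤ (Tc.filter fun j => q ∈ J j).card)
    (N : ℕ) (hN : 2 / δ + 1 ≤ N)
    (hH : ∑ n ∈ Finset.Icc (-N : ℤ) N, (1 + |(n : ℝ)|)⁻¹ ≤ B) :
    I ^ 2 ≤ (Q.card : ℝ) ^ 2 * Tc.card * δ * (b : ℝ) ^ l *
      (160 * B ^ 3 * (40 * B ^ 2 * Λ ^ 2 * (4 + 96 * B ^ 2 * Λ) ^ m * B)) := by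
  classical
  have hδ := F.δ_pos
  have h2 := F.two_le
  have hB : 0 < B := by linarith
  have hb0 : (0 : ℝ) < b := by exact_mod_cast hb
  -- At the last level all pairs count as far: `1 / b ^ (L + 1) < δ`, and the summand `1` in
  -- `card_inter_le` already yields the bound `P`.
  let far : ι → ι → Prop := fun i j => l < L → 1 / (b : ℝ) ^ (l + 1) ≤ ‖v i - v j‖
  -- The tubes left out carry at most `|Tc|/(Λδ²) ≤ I/4` incidences, by `hdense`.
  set T' := Tc.filter fun i => 1 ≤ ((J i ∩ Q).card : ℝ) * δ ^ 2 * Λ with hT'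
  have hgood : 3 / 4 * I ≤ ∑ i ∈ T', ((J i ∩ Q).card : ℝ) := by
    have h3 := Finset.sum_filter_add_sum_filter_not Tc
      (fun i => 1 ≤ ((J i ∩ Q).card : ℝ) * δ ^ 2 * Λ) (fun i => ((J i ∩ Q).card : ℝ))
    have h4 : ∑ i ∈ Tc with ¬ 1 ≤ ((J i ∩ Q).card : ℝ) * δ ^ 2 * Λ, ((J i ∩ Q).card : ℝ) ≤
        Tc.card * (1 / (δ ^ 2 * Λ)) := by
      calc _ ≤ ∑ i ∈ Tc with ¬ 1 ≤ ((J i ∩ Q).card : ℝ) * δ ^ 2 * Λ, 1 / (δ ^ 2 * Λ) := by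
            apply Finset.sum_le_sum
            intro i hi
            have h5 := not_le.1 (Finset.mem_filter.1 hi).2
            rw [le_div_iff₀ (by positivity)]
            linarith
        _ ≤ ∑ i ∈ Tc, 1 / (δ ^ 2 * Λ) := by
            apply Finset.sum_le_sum_of_subset_of_nonneg (Finset.filter_subset _ _)
            intro i _ _
            positivity
        _ = _ := by rw [Finset.sum_const, nsmul_eq_mul]
    have h5 : Tc.card * (1 / (δ ^ 2 * Λ)) ≤ I / 4 := by
      rw [mul_one_div, div_le_iff₀ (by positivity)]
      linarith
    rw [hI] at h3
    linarith
  set P : ℝ := 5 * B ^ 3 * (b : ℝ) ^ l / δ with hP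
  have hinter : ∀ i ∈ Tc, ∀ j ∈ Tc, far i j → ((J j ∩ J i).card : ℝ) ≤ P := by
    intro i hi j hj hf
    have h3 := F.card_inter_le (hTc hj) (hTc hi)
    have h4 : 1 ≤ (b : ℝ) ^ (l + 1) * δ * (1 + ‖v j - v i‖ / δ) := by
      have hbl : (0 : ℝ) < (b : ℝ) ^ (l + 1) := by positivity
      have e : (b : ℝ) ^ (l + 1) * δ * (1 + ‖v j - v i‖ / δ) =
          (b : ℝ) ^ (l + 1) * δ + (b : ℝ) ^ (l + 1) * ‖v j - v i‖ := by field_simp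
      rw [e]
      rcases hl.lt_or_eq with hlt | rfl
      · have h5 := hf hlt
        rw [norm_sub_rev, div_le_iff₀ hbl] at h5
        have : 0 < (b : ℝ) ^ (l + 1) * δ := by positivity
        linarith
      · have : 0 ≤ (b : ℝ) ^ (l + 1) * ‖v j - v i‖ := by positivity
        linarith
    have h5 : ((J j ∩ J i).card : ℝ) * δ ^ 2 ≤ (b : ℝ) ^ (l + 1) * δ * (5 * B ^ 2) := by
      calc ((J j ∩ J i).card : ℝ) * δ ^ 2 = ((J j ∩ J i).card : ℝ) * δ ^ 2 * 1 := by ring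
        _ ≤ ((J j ∩ J i).card : ℝ) * δ ^ 2 *
            ((b : ℝ) ^ (l + 1) * δ * (1 + ‖v j - v i‖ / δ)) := by gcongr
        _ = (b : ℝ) ^ (l + 1) * δ *
            (((J j ∩ J i).card : ℝ) * (1 + ‖v j - v i‖ / δ) * δ ^ 2) := by ring
        _ ≤ _ := by gcongr
    rw [hP, le_div_iff₀ hδ]
    have h6 : ((J j ∩ J i).card : ℝ) * δ ≤ (b : ℝ) ^ l * b * (5 * B ^ 2) := by
      have h7 : ((J j ∩ J i).card : ℝ) * δ * δ ≤ (b : ℝ) ^ l * b * (5 * B ^ 2) * δ := by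
        rw [pow_succ (b : ℝ)] at h5
        linarith
      exact le_of_mul_le_mul_right h7 hδ
    calc _ ≤ (b : ℝ) ^ l * b * (5 * B ^ 2) := h6
      _ ≤ (b : ℝ) ^ l * B * (5 * B ^ 2) := by gcongr
      _ = _ := by ring
  have hfar : ∀ q ∈ Q, ∀ i ∈ Tc, q ∈ J i →
      (((Tc.filter fun j => q ∈ J j).filter fun j => ¬ far i j).card : ℝ) * 4 ≤
        (Tc.filter fun j => q ∈ J j).card := by
    intro q hq i hi hqi
    rcases hl.lt_or_eq with hlt | rfl
    · refine le_trans ?_ (hbroad hlt q hq i hi hqi)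
      gcongr with j
      intro hf
      simp only [far, Classical.not_imp, not_le] at hf
      exact hf.2
    · rw [Finset.filter_false_of_mem]
      · simp
      · intro j _
        simp [far]
  obtain ⟨o, ho, hbig⟩ := exists_tube_with_many_neighbours Tc T' (Finset.filter_subset _ _) Q J far
    (by positivity : 0 ≤ P) hTne hI hgood hfar hinter
  have hbrush := F.card_hairbrush_le hm hsep (hTc ho)
    (T' := T'.filter fun j => (J j ∩ J o).Nonempty)
    ((Finset.filter_subset _ _).trans ((Finset.filter_subset _ _).trans hTc)) Q hΛ hΛδ
    (fun i hi => (Finset.mem_filter.1 hi).2)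
    (fun i hi => (Finset.mem_filter.1 (Finset.mem_filter.1 hi).1).2) N hN
  refine hbig.trans ?_
  calc _ ≤ 32 * Q.card * Tc.card * P * (Q.card * δ ^ 2 *
        (40 * B ^ 2 * Λ ^ 2 * (4 + 96 * B ^ 2 * Λ) ^ m * B)) := by
        refine mul_le_mul_of_nonneg_left (hbrush.trans ?_) (by positivity)
        gcongr
    _ = _ := by
        rw [hP]
        field_simp
        ring

/-- Wolff's hairbrush estimate for the number of `δ × δ²` boxes met by `δ`-tubes with `δ`-separated
directions. -/
theorem one_le_of_hairbrush [DecidableEq β] (F : TubeFamily T v a x h J δ B) (hm : 0 < m)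
    (hsep : ∀ i ∈ T, ∀ j ∈ T, i ≠ j → δ ≤ ‖v i - v j‖) (Q : Finset β)
    (hJQ : ∀ i ∈ T, J i ⊆ Q) (hJ : ∀ i ∈ T, 1 ≤ ((J i).card : ℝ) * δ ^ 2 * B)
    (hT : 1 ≤ (T.card : ℝ) * δ ^ m * B) {b L : ℕ} (hb : 1 ≤ b) (hbB : (b : ℝ) ≤ B)
    (hbL : (b : ℝ) ^ L * δ ≤ 1) (hbL' : 1 < (b : ℝ) ^ (L + 1) * δ)
    (hW : ((4 : ℝ) * 3 ^ m) ^ L ≤ B) (hLB : (L : ℝ) + 1 ≤ B) (hmB : (8 : ℝ) * 16 ^ m ≤ B)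
    (hBδ : 2 * B ^ 7 * δ ≤ 1) (N : ℕ) (hN : 2 / δ + 1 ≤ N)
    (hH : ∑ n ∈ Finset.Icc (-N : ℤ) N, (1 + |(n : ℝ)|)⁻¹ ≤ B) :
    1 ≤ (Q.card : ℝ) ^ 2 * δ ^ (m + 5) * B ^ (42 + 15 * m) := by
  classical
  have hδ := F.δ_pos
  have h2 := F.two_le
  have hB : 0 < B := by linarith
  have hB1 : 1 ≤ B := by linarith
  have hb1 : (1 : ℝ) ≤ b := by exact_mod_cast hb
  have hb0 : (0 : ℝ) < b := by linarith
  have h4B : (4 : ℝ) ^ m ≤ B := by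
    have : (4 : ℝ) ^ m ≤ 16 ^ m := by gcongr; norm_num
    have : (0 : ℝ) ≤ 16 ^ m := by positivity
    linarith
  let f : ℕ → ι → Fin m → ℤ := fun l i => gridCell b l (v i)
  let S : β → Finset ι := fun q => T.filter fun i => q ∈ J i
  set Q₀ := Q.filter fun q => (S q).Nonempty with hQ₀
  have hST : ∀ q, S q ⊆ T := fun q => Finset.filter_subset _ _
  have hf0 : ((T.image (f 0)).card : ℝ) ≤ B := by
    have := card_image_gridCell_le T v F.slope hb 0
    rw [pow_zero, mul_one] at this
    exact this.trans h4B
  have hW1 : (1 : ℝ) ≤ 4 * 3 ^ m := by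
    have : (1 : ℝ) ≤ 3 ^ m := one_le_pow₀ (by norm_num)
    linarith
  have hcell : ∀ q, (S q).Nonempty → ∃ l c, l ≤ L ∧ (∃ i ∈ S q, f l i = c) ∧
      ((S q).card : ℝ) ≤ B * (4 * 3 ^ m) ^ L * ((S q).filter fun i => f l i = c).card ∧
      (l < L → ∀ c', (4 * 3 ^ m) * (((S q).filter fun i => f (l + 1) i = c').card : ℝ) ≤
        ((S q).filter fun i => f l i = c).card) :=
    fun q hq => exists_concentration_cell (hST q) hq f L hW1 hf0
  -- Each box selects the cell of directions in which its tubes concentrate without concentrating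
  -- further one level down. Keeping only those tubes costs a factor `B²`, one `B` for the cells of
  -- level `0` and one for `(4 * 3 ^ m) ^ L`.
  choose! lv c hlv hmem hbig hbroad using hcell
  let cell : β → ℕ × (Fin m → ℤ) := fun q => (lv q, c q)
  let r : β → ℝ := fun q => ((S q).filter fun i => f (lv q) i = c q).card
  have hQ₀S : ∀ q ∈ Q₀, (S q).Nonempty := fun q hq => (Finset.mem_filter.1 hq).2
  have hTpos : 0 < (T.card : ℝ) := by
    by_contra h0
    have : (T.card : ℝ) = 0 := le_antisymm (not_lt.1 h0) (Nat.cast_nonneg _)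
    rw [this] at hT
    norm_num at hT
  have htotal : (T.card : ℝ) ≤ (∑ q ∈ Q₀, r q) * (δ ^ 2 * B ^ 3) := by
    have h3 : ∑ i ∈ T, ((J i).card : ℝ) = ∑ q ∈ Q₀, ((S q).card : ℝ) := by
      have h4 : ∑ q ∈ Q₀, ((S q).card : ℝ) = ∑ q ∈ Q, ((S q).card : ℝ) := by
        apply Finset.sum_subset (Finset.filter_subset _ _)
        intro q hq hq'
        have : ¬ (S q).Nonempty := fun hne => hq' (Finset.mem_filter.2 ⟨hq, hne⟩)
        rw [Finset.not_nonempty_iff_eq_empty.1 this]; simp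
      rw [h4, sum_card_filter_mem_eq]
      exact Finset.sum_congr rfl fun i hi => by rw [Finset.inter_eq_left.2 (hJQ i hi)]
    have h5 : ∑ q ∈ Q₀, ((S q).card : ℝ) ≤ B * B * ∑ q ∈ Q₀, r q := by
      rw [Finset.mul_sum]
      apply Finset.sum_le_sum
      intro q hq
      refine (hbig q (hQ₀S q hq)).trans ?_
      change _ * r q ≤ _ * r q
      have : 0 ≤ r q := Nat.cast_nonneg _
      gcongr
    calc (T.card : ℝ) = ∑ _i ∈ T, (1 : ℝ) := by simp
      _ ≤ ∑ i ∈ T, ((J i).card : ℝ) * δ ^ 2 * B := Finset.sum_le_sum hJ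
      _ = (∑ q ∈ Q₀, ((S q).card : ℝ)) * (δ ^ 2 * B) := by
          rw [← h3, Finset.sum_mul]
          exact Finset.sum_congr rfl fun i _ => by ring
      _ ≤ (B * B * ∑ q ∈ Q₀, r q) * (δ ^ 2 * B) := by gcongr
      _ = _ := by ring
  set I := ∑ q ∈ Q₀, r q with hI
  have hIpos : 0 < I := by
    by_contra h0
    have : I * (δ ^ 2 * B ^ 3) ≤ 0 :=
      mul_nonpos_of_nonpos_of_nonneg (not_lt.1 h0) (by positivity)
    linarith
  have hQ₀ne : Q₀.Nonempty := by
    by_contra h0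
    rw [hI, Finset.not_nonempty_iff_eq_empty.1 h0] at hIpos
    simp at hIpos
  obtain ⟨τ, ⟨q₀, hq₀, hq₀τ⟩, hτ1, hτ2⟩ := exists_heavy_cell hQ₀ne cell r
    (fun q _ => Nat.cast_nonneg _) L (fun q hq => hlv q (hQ₀S q hq)) (fun l => T.image (f l))
    (fun q hq => by
      obtain ⟨i, hi, hic⟩ := hmem q (hQ₀S q hq)
      exact Finset.mem_image.2 ⟨i, hST q hi, hic⟩)
    (fun l => (4 * (b : ℝ) ^ l) ^ m) (fun l => by positivity)
    (fun l => card_image_gridCell_le T v F.slope hb l)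
  have hlL : τ.1 ≤ L := by rw [← hq₀τ]; exact hlv q₀ (hQ₀S q₀ hq₀)
  set l := τ.1 with hldef
  set Tc := T.filter fun i => f l i = τ.2 with hTc
  set Qc := Q₀.filter fun q => cell q = τ with hQc
  have hr : ∀ q ∈ Qc, r q = (Tc.filter fun j => q ∈ J j).card := by
    intro q hq
    have h3 : cell q = τ := (Finset.mem_filter.1 hq).2
    have h4 : lv q = l := congrArg Prod.fst h3
    have h5 : c q = τ.2 := congrArg Prod.snd h3
    simp only [r, S, hTc, h4, h5, Finset.filter_filter, and_comm]
  set Iτ := ∑ q ∈ Qc, r q with hIτ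
  have hbl : (0 : ℝ) < (b : ℝ) ^ l := by positivity
  have hbl1 : (1 : ℝ) ≤ (b : ℝ) ^ l := one_le_pow₀ hb1
  have hblδ : (b : ℝ) ^ l * δ ≤ 1 := by
    refine le_trans ?_ hbL
    gcongr
  have hTc_card : (Tc.card : ℝ) ≤ (4 / ((b : ℝ) ^ l * δ)) ^ m :=
    card_gridCell_le T v hδ hsep hb hblδ τ.2
  have hIτ_pos : 0 < Iτ := by
    by_contra h0
    have : 2 * ((L : ℝ) + 1) * (4 * (b : ℝ) ^ l) ^ m * Iτ ≤ 0 :=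
      mul_nonpos_of_nonneg_of_nonpos (by positivity) (not_lt.1 h0)
    linarith
  have hIτ_sum : ∑ i ∈ Tc, ((J i ∩ Qc).card : ℝ) = Iτ := by
    rw [hIτ, ← sum_card_filter_mem_eq]
    exact (Finset.sum_congr rfl hr).symm
  have hTcne : Tc.Nonempty := by
    by_contra h0
    rw [← hIτ_sum, Finset.not_nonempty_iff_eq_empty.1 h0] at hIτ_pos
    simp at hIτ_pos
  have hIQc : I * Qc.card ≤ 2 * Q₀.card * Iτ := hτ1
  have hIle : I ≤ 2 * ((L : ℝ) + 1) * (4 * (b : ℝ) ^ l) ^ m * Iτ := hτ2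
  clear_value I Iτ
  have hdelta : 1 ≤ I * δ ^ (m + 2) * B ^ 4 := by
    calc 1 ≤ T.card * δ ^ m * B := hT
      _ ≤ (I * (δ ^ 2 * B ^ 3)) * δ ^ m * B := by gcongr
      _ = _ := by ring
  have hnm : (Tc.card : ℝ) * ((b : ℝ) ^ l * δ) ^ m ≤ 4 ^ m := by
    rw [div_pow, le_div_iff₀ (by positivity)] at hTc_card
    exact hTc_card
  -- The cell carries a share of at least about `b ^ (-l * m)` of all incidences and has at most
  -- about `(b ^ l * δ) ^ (-m)` tubes. The powers of `b ^ l` cancel, so an average tube of the cell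
  -- still has about `δ⁻²` boxes, up to powers of `B`.
  have hdense : 4 * (Tc.card : ℝ) ≤ Iτ * δ ^ 2 * B ^ 6 := by
    have hX : (0 : ℝ) < ((b : ℝ) ^ l * δ) ^ m := by positivity
    refine le_of_mul_le_mul_right ?_ hX
    calc 4 * (Tc.card : ℝ) * ((b : ℝ) ^ l * δ) ^ m ≤ 4 * 4 ^ m := by linarith
      _ ≤ 4 * 4 ^ m * (I * δ ^ (m + 2) * B ^ 4) := le_mul_of_one_le_right (by positivity) hdelta
      _ ≤ 4 * 4 ^ m * ((2 * B * (4 * (b : ℝ) ^ l) ^ m * Iτ) * δ ^ (m + 2) * B ^ 4) := by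
          gcongr
          refine hIle.trans ?_
          gcongr
      _ = (8 * 16 ^ m) * (Iτ * δ ^ 2 * B ^ 5 * ((b : ℝ) ^ l * δ) ^ m) := by
          have : (16 : ℝ) ^ m = 4 ^ m * 4 ^ m := by rw [← mul_pow]; norm_num
          rw [this, mul_pow, mul_pow]; ring
      _ ≤ B * (Iτ * δ ^ 2 * B ^ 5 * ((b : ℝ) ^ l * δ) ^ m) := by gcongr
      _ = _ := by ring
  have hmain := F.sq_le_of_cell hm hsep (Finset.filter_subset _ _ : Tc ⊆ T) Qc hbB hb hlL hbL'
    (one_le_pow₀ hB1 : 1 ≤ B ^ 6) (by linarith : 2 * B * B ^ 6 * δ ≤ 1) hTcne hIτ_sum hdense ?_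
    N hN hH
  swap
  · intro hlt q hq i hi hqi
    have hqQ := (Finset.mem_filter.1 hq).1
    have h3 : cell q = τ := (Finset.mem_filter.1 hq).2
    have h4 : lv q = l := congrArg Prod.fst h3
    have h5 := hbroad q (hQ₀S q hqQ) (by rw [h4]; exact hlt)
    have h6 : (((S q).filter fun i => f (lv q) i = c q).card : ℝ) =
      (Tc.filter fun j => q ∈ J j).card := hr q hq
    rw [h6, h4] at h5
    -- Directions close to `v i` lie in `3 ^ m` cells of level `l + 1`, each holding at most the
    -- fraction `1 / (4 * 3 ^ m)`. This explains the weight `W = 4 * 3 ^ m`.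
    have h7 := card_close_le ((Tc.filter fun j => q ∈ J j).filter fun j =>
        ‖v i - v j‖ < 1 / (b : ℝ) ^ (l + 1)) v hb (l + 1) (v i)
        (fun j hj => (Finset.mem_filter.1 hj).2)
        (n := ((Tc.filter fun j => q ∈ J j).card : ℝ) / (4 * 3 ^ m)) ?_
    · refine (mul_le_mul_of_nonneg_right h7 (by norm_num)).trans (le_of_eq ?_)
      field_simp
      rw [hTc]
    · intro c'
      rw [le_div_iff₀ (by positivity), mul_comm]
      refine le_trans ?_ (h5 c')
      refine mul_le_mul_of_nonneg_left (Nat.cast_le.2 (Finset.card_le_card ?_)) (by positivity)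
      intro j hj
      simp only [Finset.mem_filter, hTc, S, f] at hj ⊢
      exact ⟨⟨hj.1.1.1.1, hj.1.1.2⟩, hj.2⟩
  have hQcpos : 0 < (Qc.card : ℝ) := by
    exact_mod_cast Finset.card_pos.2 ⟨q₀, Finset.mem_filter.2 ⟨hq₀, hq₀τ⟩⟩
  have hQQ : (Q₀.card : ℝ) ≤ Q.card :=
    Nat.cast_le.2 (Finset.card_le_card (Finset.filter_subset _ _))
  refine hairbrush_arith hm hδ h2 hIpos.le hQcpos
    (Nat.cast_nonneg _) hbl1 (hIQc.trans (by gcongr)) hmain (hnm.trans h4B) hdelta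

end TubeFamily

/-! ### Homogeneous metrics and the model gauge. -/

theorem exists_bilin_bound {m : ℕ} (ω : (Fin m → ℝ) →ₗ[ℝ] (Fin m → ℝ) →ₗ[ℝ] ℝ) :
    ∃ C, 0 < C ∧ ∀ x y, |ω x y| ≤ C * ‖x‖ * ‖y‖ := by
  obtain ⟨C, hC⟩ : ∃ C, ∀ x y, ‖LinearMap.toContinuousBilinearMap ω x y‖ ≤ C * ‖x‖ * ‖y‖ :=
    ⟨_, fun x y => ContinuousLinearMap.le_opNorm₂ _ x y⟩
  refine ⟨max C 1, by positivity, fun x y => ?_⟩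
  have h1 := hC x y
  simp only [LinearMap.toContinuousBilinearMap_apply, Real.norm_eq_abs] at h1
  refine h1.trans ?_
  gcongr
  exact le_max_left _ _

/-- The product of the step two group `ℝᵐ × ℝ` with bracket `ω`. -/
noncomputable def stepTwoMul {m : ℕ} (ω : (Fin m → ℝ) →ₗ[ℝ] (Fin m → ℝ) →ₗ[ℝ] ℝ)
    (p q : (Fin m → ℝ) × ℝ) : (Fin m → ℝ) × ℝ :=
  (p.1 + q.1, p.2 + q.2 + 1 / 2 * ω p.1 q.1)

/-- A homogeneous metric on the step two group `ℝᵐ × ℝ` with bracket `ω`. -/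
structure HomogeneousDist {m : ℕ} (ω : (Fin m → ℝ) →ₗ[ℝ] (Fin m → ℝ) →ₗ[ℝ] ℝ)
    (d : (Fin m → ℝ) × ℝ → (Fin m → ℝ) × ℝ → ℝ) : Prop where
  alt : ∀ x, ω x x = 0
  self : ∀ p, d p p = 0
  eq_of_zero : ∀ p q, d p q = 0 → p = q
  comm : ∀ p q, d p q = d q p
  triangle : ∀ p q r, d p r ≤ d p q + d q r
  left : ∀ p q r, d (stepTwoMul ω p q) (stepTwoMul ω p r) = d q r
  dil : ∀ t, 0 < t → ∀ p q : (Fin m → ℝ) × ℝ,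
    d (t • p.1, t ^ 2 * p.2) (t • q.1, t ^ 2 * q.2) = t * d p q

namespace HomogeneousDist

variable {m : ℕ} {ω : (Fin m → ℝ) →ₗ[ℝ] (Fin m → ℝ) →ₗ[ℝ] ℝ}
  {d : (Fin m → ℝ) × ℝ → (Fin m → ℝ) × ℝ → ℝ}

theorem nonneg (H : HomogeneousDist ω d) (p q : (Fin m → ℝ) × ℝ) : 0 ≤ d p q := by
  have := H.triangle p q p
  rw [H.self, H.comm q p] at this
  linarith

theorem eq_norm (H : HomogeneousDist ω d) (p q : (Fin m → ℝ) × ℝ) :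
    d p q = d 0 (q.1 - p.1, q.2 - p.2 - 1 / 2 * ω p.1 q.1) := by
  rw [← H.left p 0]
  congr 1
  · simp [stepTwoMul]
  · refine Prod.ext ?_ ?_
    · simp [stepTwoMul]
    · simp only [stepTwoMul, map_sub, H.alt]
      ring

theorem norm_mul_le (H : HomogeneousDist ω d) (p q : (Fin m → ℝ) × ℝ) :
    d 0 (stepTwoMul ω p q) ≤ d 0 p + d 0 q := by
  refine (H.triangle 0 p _).trans ?_
  have := H.left p 0 q
  have e : stepTwoMul ω p 0 = p := by simp [stepTwoMul]
  rw [e] at this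
  rw [this]

theorem norm_dil (H : HomogeneousDist ω d) {t : ℝ} (ht : 0 < t) (x : Fin m → ℝ) (z : ℝ) :
    d 0 (t • x, t ^ 2 * z) = t * d 0 (x, z) := by
  have := H.dil t ht 0 (x, z)
  simp only [Prod.fst_zero, Prod.snd_zero, smul_zero, mul_zero] at this
  exact this

theorem norm_horizontal_le (H : HomogeneousDist ω d) (r : ℝ) (e : Fin m → ℝ) :
    d 0 (r • e, 0) ≤ |r| * (d 0 (e, 0) + d 0 (-e, 0)) := by
  have h1 := H.nonneg 0 (e, 0)
  have h2 := H.nonneg 0 (-e, 0)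
  rcases lt_trichotomy r 0 with hr | rfl | hr
  · have := H.norm_dil (neg_pos.2 hr) (-e) 0
    rw [mul_zero, smul_neg, neg_smul, neg_neg] at this
    rw [this, abs_of_neg hr]
    nlinarith
  · simp only [zero_smul, abs_zero, zero_mul]
    exact (H.self 0).le
  · have := H.norm_dil hr e 0
    rw [mul_zero] at this
    rw [this, abs_of_pos hr]
    nlinarith

theorem norm_vertical_le (H : HomogeneousDist ω d) (z : ℝ) :
    d 0 (0, z) ≤ Real.sqrt |z| * (d 0 (0, 1) + d 0 (0, -1)) := by
  have h1 := H.nonneg 0 (0, 1)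
  have h2 := H.nonneg 0 (0, -1)
  have h3 := Real.sqrt_nonneg |z|
  rcases lt_trichotomy z 0 with hz | rfl | hz
  · have := H.norm_dil (Real.sqrt_pos.2 (abs_pos.2 hz.ne)) 0 (-1)
    rw [Real.sq_sqrt (abs_nonneg z), smul_zero, abs_of_neg hz] at this
    rw [abs_of_neg hz] at h3 ⊢
    have e : -z * -1 = z := by ring
    rw [e] at this
    rw [this]
    nlinarith
  · simp only [abs_zero, Real.sqrt_zero, zero_mul]
    exact (H.self 0).le
  · have := H.norm_dil (Real.sqrt_pos.2 (abs_pos.2 hz.ne')) 0 1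
    rw [Real.sq_sqrt (abs_nonneg z), smul_zero, abs_of_pos hz, mul_one] at this
    rw [abs_of_pos hz] at h3 ⊢
    rw [this]
    nlinarith

/-- Continuity of `d` is not assumed, so the bound comes from the group law. A point is reached by
horizontal moves along one coordinate at a time, whose cost is controlled by dilations. The brackets
create a bounded vertical error, which a single vertical move corrects. -/
theorem norm_bounded (H : HomogeneousDist ω d) :
    ∃ C, 0 < C ∧ ∀ p : (Fin m → ℝ) × ℝ, ‖p.1‖ ≤ 1 → |p.2| ≤ 1 → d 0 p ≤ C := by
  classical
  obtain ⟨Cω, hCω, hω⟩ := exists_bilin_bound ω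
  have key : ∀ s : Finset (Fin m), ∃ C, 0 ≤ C ∧ ∀ x : Fin m → ℝ, ‖x‖ ≤ 1 →
      ∃ z, |z| ≤ C ∧ d 0 (fun i => if i ∈ s then x i else 0, z) ≤ C := by
    intro s
    induction s using Finset.induction_on with
    | empty =>
      refine ⟨0, le_rfl, fun x _ => ⟨0, by simp, ?_⟩⟩
      simp only [Finset.notMem_empty, if_false]
      exact (H.self 0).le
    | insert j s hj ih =>
      obtain ⟨C, hC, ih⟩ := ih
      set e : Fin m → ℝ := Pi.single j 1 with he
      set A := d 0 (e, 0) + d 0 (-e, 0) with hA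
      have hA0 : 0 ≤ A := add_nonneg (H.nonneg _ _) (H.nonneg _ _)
      refine ⟨C + Cω + A, by positivity, fun x hx => ?_⟩
      obtain ⟨z, hz, hzd⟩ := ih x hx
      set y : Fin m → ℝ := fun i => if i ∈ s then x i else 0 with hy
      have hxj : |x j| ≤ 1 := (norm_le_pi_norm x j).trans hx
      have hyn : ‖y‖ ≤ 1 := by
        rw [pi_norm_le_iff_of_nonneg zero_le_one]
        intro i
        simp only [hy]
        split_ifs
        · exact (norm_le_pi_norm x i).trans hx
        · simp
      have hen : ‖x j • e‖ ≤ 1 := by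
        rw [norm_smul, he, Pi.norm_single, norm_one, mul_one]
        exact hxj
      refine ⟨z + 0 + 1 / 2 * ω y (x j • e), ?_, ?_⟩
      · have h1 := hω y (x j • e)
        have h2 : Cω * ‖y‖ * ‖x j • e‖ ≤ Cω * 1 * 1 := by gcongr
        rw [abs_le] at hz h1 ⊢
        constructor <;> linarith
      · have e1 : (fun i => if i ∈ insert j s then x i else 0) = y + x j • e := by
          ext i
          by_cases hij : i = j
          · subst hij; simp [hy, he, hj]
          · simp [hy, he, hij]
        have h1 := H.norm_mul_le (y, z) (x j • e, 0)
        simp only [stepTwoMul] at h1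
        rw [e1]
        have h2 := H.norm_horizontal_le (x j) e
        have h3 : |x j| * A ≤ 1 * A := by gcongr
        linarith
  obtain ⟨C, hC, key⟩ := key Finset.univ
  set A := d 0 ((0 : Fin m → ℝ), (1 : ℝ)) + d 0 (0, -1) with hA
  have hA0 : 0 ≤ A := add_nonneg (H.nonneg _ _) (H.nonneg _ _)
  refine ⟨C + Real.sqrt (1 + C) * A + 1, by positivity, fun p hp1 hp2 => ?_⟩
  obtain ⟨z, hz, hzd⟩ := key p.1 hp1
  simp only [Finset.mem_univ, if_true] at hzd
  have h1 := H.norm_mul_le (p.1, z) (0, p.2 - z)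
  have e : stepTwoMul ω (p.1, z) (0, p.2 - z) = p := by simp [stepTwoMul]
  rw [e] at h1
  have h2 := H.norm_vertical_le (p.2 - z)
  have h3 : Real.sqrt |p.2 - z| * A ≤ Real.sqrt (1 + C) * A := by
    gcongr
    exact (abs_sub _ _).trans (add_le_add hp2 hz)
  have h4 : d 0 (p.1, z) ≤ C := hzd
  linarith

theorem norm_le (H : HomogeneousDist ω d) :
    ∃ C, 0 < C ∧ ∀ p : (Fin m → ℝ) × ℝ, d 0 p ≤ C * (‖p.1‖ + Real.sqrt |p.2|) := by
  obtain ⟨C, hC, hbd⟩ := H.norm_bounded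
  refine ⟨C, hC, fun p => ?_⟩
  set t := ‖p.1‖ + Real.sqrt |p.2| with ht
  have h1 := norm_nonneg p.1
  have h2 := Real.sqrt_nonneg |p.2|
  rcases (by positivity : 0 ≤ t).eq_or_lt with h0 | h0
  · have h3 : p.1 = 0 := norm_eq_zero.1 (by linarith)
    have h4 : p.2 = 0 := by
      have : Real.sqrt |p.2| = 0 := by linarith
      rw [Real.sqrt_eq_zero (abs_nonneg _)] at this
      exact abs_eq_zero.1 this
    have : p = 0 := Prod.ext h3 h4
    rw [← h0, mul_zero, this, H.self]
  · have h3 := H.norm_dil h0 (t⁻¹ • p.1) ((t ^ 2)⁻¹ * p.2)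
    rw [smul_smul, mul_inv_cancel₀ h0.ne', one_smul, ← mul_assoc,
      mul_inv_cancel₀ (by positivity), one_mul] at h3
    have h4 := hbd (t⁻¹ • p.1, (t ^ 2)⁻¹ * p.2) ?_ ?_
    · change d 0 (p.1, p.2) ≤ _
      rw [h3, mul_comm]
      gcongr
    · rw [norm_smul, norm_inv, Real.norm_eq_abs, abs_of_pos h0, inv_mul_le_iff₀ h0]
      linarith
    · rw [abs_mul, abs_inv, abs_of_pos (by positivity : 0 < t ^ 2), inv_mul_le_iff₀ (by positivity),
        mul_one, ← Real.sq_sqrt (abs_nonneg p.2)]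
      gcongr
      linarith

/-- The triangle inequality bounds the increment by `d p q`, and `norm_le` makes that small. The
result feeds the compactness argument of `gauge_le`. -/
theorem continuous_norm (H : HomogeneousDist ω d) : Continuous fun p => d 0 p := by
  obtain ⟨C, hC, hle⟩ := H.norm_le
  rw [continuous_iff_continuousAt]
  intro p
  have hωc : Continuous fun q : (Fin m → ℝ) × ℝ => ω p.1 q.1 :=
    (LinearMap.continuous_of_finiteDimensional (ω p.1)).comp continuous_fst
  have h1 : Filter.Tendsto (fun q : (Fin m → ℝ) × ℝ =>
      C * (‖q.1 - p.1‖ + Real.sqrt |q.2 - p.2 - 1 / 2 * ω p.1 q.1|)) (nhds p) (nhds 0) := by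
    have hc : Continuous fun q : (Fin m → ℝ) × ℝ =>
      C * (‖q.1 - p.1‖ + Real.sqrt |q.2 - p.2 - 1 / 2 * ω p.1 q.1|) := by fun_prop
    have := hc.tendsto p
    simpa [H.alt] using this
  rw [ContinuousAt, tendsto_iff_dist_tendsto_zero]
  refine squeeze_zero (fun _ => dist_nonneg) (fun q => ?_) h1
  refine le_trans ?_ (hle (q.1 - p.1, q.2 - p.2 - 1 / 2 * ω p.1 q.1))
  rw [← H.eq_norm, Real.dist_eq, abs_le]
  have h2 := H.triangle 0 p q
  have h3 := H.triangle 0 q p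
  rw [H.comm q p] at h3
  constructor <;> linarith

/-- A homogeneous metric is bounded below by the model gauge. -/
theorem gauge_le (H : HomogeneousDist ω d) : ∃ C, 1 ≤ C ∧ ∀ p q : (Fin m → ℝ) × ℝ,
    ‖q.1 - p.1‖ ≤ C * d p q ∧ |q.2 - p.2 - 1 / 2 * ω p.1 q.1| ≤ C * d p q ^ 2 := by
  obtain ⟨o, ho, hmin⟩ := (isCompact_sphere (0 : (Fin m → ℝ) × ℝ) 1).exists_isMinOn
    (NormedSpace.sphere_nonempty.2 zero_le_one) H.continuous_norm.continuousOn
  set c := d 0 o with hc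
  have hcpos : 0 < c := by
    refine lt_of_le_of_ne (H.nonneg _ _) fun h0 => ?_
    have h1 := H.eq_of_zero _ _ h0.symm
    rw [← h1] at ho
    simp at ho
  have key : ∀ p : (Fin m → ℝ) × ℝ, c * max ‖p.1‖ (Real.sqrt |p.2|) ≤ d 0 p := by
    intro p
    -- Dilating by `t⁻¹` puts the point on the unit sphere of the product norm, where the minimum
    -- `c` applies.
    set t := max ‖p.1‖ (Real.sqrt |p.2|) with ht
    have h1 := norm_nonneg p.1
    have h2 := Real.sqrt_nonneg |p.2|
    rcases (h1.trans (le_max_left _ _) : 0 ≤ t).eq_or_lt with h0 | h0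
    · rw [← h0, mul_zero]; exact H.nonneg _ _
    · have h3 := H.norm_dil h0 (t⁻¹ • p.1) ((t ^ 2)⁻¹ * p.2)
      rw [smul_smul, mul_inv_cancel₀ h0.ne', one_smul, ← mul_assoc,
        mul_inv_cancel₀ (by positivity), one_mul] at h3
      have h4 : (t⁻¹ • p.1, (t ^ 2)⁻¹ * p.2) ∈ Metric.sphere (0 : (Fin m → ℝ) × ℝ) 1 := by
        rw [mem_sphere_zero_iff_norm, Prod.norm_def]
        simp only
        rw [norm_smul, norm_inv, Real.norm_eq_abs, abs_of_pos h0, Real.norm_eq_abs, abs_mul,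
          abs_inv, abs_of_pos (by positivity : 0 < t ^ 2)]
        have hp2 : |p.2| = Real.sqrt |p.2| ^ 2 := (Real.sq_sqrt (abs_nonneg _)).symm
        rcases le_total ‖p.1‖ (Real.sqrt |p.2|) with hle | hle
        · have : t = Real.sqrt |p.2| := max_eq_right hle
          rw [max_eq_right]
          · rw [hp2, ← this]; field_simp
          · rw [hp2, ← this, inv_mul_cancel₀ (by positivity), inv_mul_le_iff₀ h0]
            linarith
        · have : t = ‖p.1‖ := max_eq_left hle
          rw [max_eq_left]
          · rw [← this]; field_simp
          · rw [← this, inv_mul_cancel₀ h0.ne', inv_mul_le_iff₀ (by positivity), hp2, mul_one, this]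
            gcongr
      have h5 : c ≤ d 0 (t⁻¹ • p.1, (t ^ 2)⁻¹ * p.2) := hmin h4
      change _ ≤ d 0 (p.1, p.2)
      rw [h3, mul_comm]
      gcongr
  refine ⟨max 1 (max c⁻¹ (c⁻¹ ^ 2)), le_max_left _ _, fun p q => ?_⟩
  have h1 := key (q.1 - p.1, q.2 - p.2 - 1 / 2 * ω p.1 q.1)
  rw [← H.eq_norm] at h1
  have h0 := H.nonneg p q
  have h2 : ‖q.1 - p.1‖ ≤ c⁻¹ * d p q := by
    rw [le_inv_mul_iff₀ hcpos]
    refine le_trans ?_ h1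
    gcongr
    exact le_max_left _ _
  have h3 : Real.sqrt |q.2 - p.2 - 1 / 2 * ω p.1 q.1| ≤ c⁻¹ * d p q := by
    rw [le_inv_mul_iff₀ hcpos]
    refine le_trans ?_ h1
    gcongr
    exact le_max_right _ _
  constructor
  · refine h2.trans ?_
    gcongr
    exact (le_max_left _ _).trans (le_max_right _ _)
  · rw [← Real.sq_sqrt (abs_nonneg (q.2 - p.2 - 1 / 2 * ω p.1 q.1))]
    calc _ ≤ (c⁻¹ * d p q) ^ 2 := by gcongr
      _ = c⁻¹ ^ 2 * d p q ^ 2 := by ring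
      _ ≤ _ := by
        gcongr
        exact (le_max_right _ _).trans (le_max_right _ _)

end HomogeneousDist

/-! ### From exponential coordinates to `ℝᵐ × ℝ` with an alternating form. -/

namespace Carnot.ExpCoords

variable {𝔤 : Type*} [LieRing 𝔤] [LieAlgebra ℝ 𝔤] {S : Stratification 𝔤 2} {m : ℕ}

theorem eq_zero_of_mem_of_mem (S : Stratification 𝔤 2) {X : 𝔤} (h1 : X ∈ S.V 1)
    (h2 : X ∈ S.V 2) : X = 0 := by
  have := S.isInternal.submodule_iSupIndep.pairwiseDisjoint (show (1 : ℕ) ≠ 2 by norm_num)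
  exact Submodule.disjoint_def.1 this X h1 h2

theorem deg_eq {n : ℕ} (c : ExpCoords S n) (i : Fin n) : c.deg i = 1 ∨ c.deg i = 2 := by
  have h1 := c.basis_mem i
  have h2 := c.basis.ne_zero i
  rcases Nat.lt_or_ge 2 (c.deg i) with h | h
  · rw [S.V_eq_bot _ h, Submodule.mem_bot] at h1
    exact absurd h1 h2
  · rcases Nat.eq_zero_or_pos (c.deg i) with h0 | h0
    · rw [h0, S.V_zero, Submodule.mem_bot] at h1
      exact absurd h1 h2
    · omega

/-- Otherwise monotonicity of `deg` puts the whole basis in `V 1`, and `V 2`, which is independent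
of `V 1`, would vanish. -/
theorem deg_last (c : ExpCoords S (m + 1)) : c.deg (Fin.last m) = 2 := by
  rcases c.deg_eq (Fin.last m) with h | h
  swap
  · exact h
  exfalso
  have h1 : ∀ i, c.basis i ∈ S.V 1 := by
    intro i
    have h2 := c.deg_mono (Fin.le_last i)
    have h3 : c.deg i = 1 := by
      rcases c.deg_eq i with h' | h' <;> omega
    have := c.basis_mem i
    rwa [h3] at this
  have h2 : ∀ X : 𝔤, X ∈ S.V 1 := by
    intro X
    rw [← c.basis.sum_repr X]
    exact Submodule.sum_mem _ fun i _ => Submodule.smul_mem _ _ (h1 i)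
  exact S.V_ne_bot ((Submodule.eq_bot_iff _).2 fun X hX => eq_zero_of_mem_of_mem S (h2 X) hX)

theorem basis_last_mem (c : ExpCoords S (m + 1)) : c.basis (Fin.last m) ∈ S.V 2 := by
  have := c.basis_mem (Fin.last m)
  rwa [c.deg_last] at this

theorem exists_smul_eq (hV : Module.finrank ℝ (S.V 2) = 1) (c : ExpCoords S (m + 1)) {X : 𝔤}
    (hX : X ∈ S.V 2) : ∃ k : ℝ, k • c.basis (Fin.last m) = X := by
  have h0 : (⟨c.basis (Fin.last m), c.basis_last_mem⟩ : S.V 2) ≠ 0 := by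
    intro h
    exact c.basis.ne_zero _ (congrArg Subtype.val h)
  obtain ⟨k, hk⟩ := (finrank_eq_one_iff_of_nonzero' _ h0).1 hV ⟨X, hX⟩
  exact ⟨k, congrArg Subtype.val hk⟩

/-- The last basis vector already spans the line `V 2`, which leaves no room for a second one. -/
theorem deg_castSucc (hV : Module.finrank ℝ (S.V 2) = 1) (c : ExpCoords S (m + 1)) (i : Fin m) :
    c.deg i.castSucc = 1 := by
  rcases c.deg_eq i.castSucc with h | h
  · exact h
  exfalso
  have h1 := c.basis_mem i.castSucc
  rw [h] at h1
  obtain ⟨k, hk⟩ := c.exists_smul_eq hV h1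
  have h2 := congrArg (fun X => c.basis.repr X i.castSucc) hk
  simp at h2

theorem lie_basis_mem (hV : Module.finrank ℝ (S.V 2) = 1) (c : ExpCoords S (m + 1))
    (i j : Fin m) : ⁅c.basis i.castSucc, c.basis j.castSucc⁆ ∈ S.V 2 := by
  have hi := c.basis_mem i.castSucc
  have hj := c.basis_mem j.castSucc
  rw [c.deg_castSucc hV] at hi hj
  have := S.bracket_V 1 le_rfl
  rw [← this]
  exact Submodule.subset_span ⟨_, hi, _, hj, rfl⟩

theorem lie_last (hV : Module.finrank ℝ (S.V 2) = 1) (c : ExpCoords S (m + 1)) (X : 𝔤) :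
    ⁅X, c.basis (Fin.last m)⁆ = 0 := by
  rw [← c.basis.sum_repr X, sum_lie]
  apply Finset.sum_eq_zero
  intro i _
  rw [smul_lie]
  induction i using Fin.lastCases with
  | last => rw [lie_self, smul_zero]
  | cast i =>
    have hi := c.basis_mem i.castSucc
    rw [c.deg_castSucc hV] at hi
    have h1 : ⁅c.basis i.castSucc, c.basis (Fin.last m)⁆ ∈ S.V (2 + 1) := by
      rw [← S.bracket_V 2 (by norm_num)]
      exact Submodule.subset_span ⟨_, hi, _, c.basis_last_mem, rfl⟩
    rw [S.V_eq_bot 3 (by norm_num), Submodule.mem_bot] at h1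
    rw [h1, smul_zero]

/-- The horizontal part of the Lie algebra in coordinates. -/
noncomputable def horizontal (c : ExpCoords S (m + 1)) : (Fin m → ℝ) →ₗ[ℝ] 𝔤 :=
  Fintype.linearCombination ℝ fun i => c.basis i.castSucc

/-- The Lie bracket of the first layer, in coordinates. -/
noncomputable def form (c : ExpCoords S (m + 1)) : (Fin m → ℝ) →ₗ[ℝ] (Fin m → ℝ) →ₗ[ℝ] ℝ :=
  LinearMap.mk₂ ℝ
    (fun x y => c.basis.repr ⁅c.horizontal x, c.horizontal y⁆ (Fin.last m))
    (by intros; simp) (by intros; simp) (by intros; simp) (by intros; simp)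

theorem form_self (c : ExpCoords S (m + 1)) (x : Fin m → ℝ) : c.form x x = 0 := by
  simp [form]

end Carnot.ExpCoords

/-- The point of `ℝⁿ` with given horizontal and vertical coordinates. -/
noncomputable def snocPoint {m : ℕ} (p : (Fin m → ℝ) × ℝ) : EuclideanSpace ℝ (Fin (m + 1)) :=
  WithLp.toLp 2 (Fin.snoc p.1 p.2 : Fin (m + 1) → ℝ)

/-- The horizontal and vertical coordinates of a point of `ℝⁿ`. -/
noncomputable def splitPoint {m : ℕ} (p : EuclideanSpace ℝ (Fin (m + 1))) : (Fin m → ℝ) × ℝ :=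
  (fun i => p i.castSucc, p (Fin.last m))

@[simp]
theorem snocPoint_castSucc {m : ℕ} (p : (Fin m → ℝ) × ℝ) (i : Fin m) :
    snocPoint p i.castSucc = p.1 i := by
  simp [snocPoint]

@[simp]
theorem snocPoint_last {m : ℕ} (p : (Fin m → ℝ) × ℝ) : snocPoint p (Fin.last m) = p.2 := by
  simp [snocPoint]

@[simp]
theorem splitPoint_snocPoint {m : ℕ} (p : (Fin m → ℝ) × ℝ) : splitPoint (snocPoint p) = p := by
  simp [splitPoint]

@[simp]
theorem snocPoint_splitPoint {m : ℕ} (p : EuclideanSpace ℝ (Fin (m + 1))) :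
    snocPoint (splitPoint p) = p := by
  ext i
  induction i using Fin.lastCases <;> simp [splitPoint]

namespace Carnot.ExpCoords

variable {𝔤 : Type*} [LieRing 𝔤] [LieAlgebra ℝ 𝔤] {S : Stratification 𝔤 2} {m : ℕ}

theorem toLie_snocPoint (c : ExpCoords S (m + 1)) (p : (Fin m → ℝ) × ℝ) :
    c.toLie (snocPoint p) = c.horizontal p.1 + p.2 • c.basis (Fin.last m) := by
  rw [toLie, Fin.sum_univ_castSucc]
  simp [horizontal, Fintype.linearCombination_apply]

theorem lie_toLie (hV : Module.finrank ℝ (S.V 2) = 1) (c : ExpCoords S (m + 1))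
    (p q : (Fin m → ℝ) × ℝ) : ⁅c.toLie (snocPoint p), c.toLie (snocPoint q)⁆ =
      c.form p.1 q.1 • c.basis (Fin.last m) := by
  have h1 : ∀ X : 𝔤, ⁅c.basis (Fin.last m), X⁆ = 0 := fun X => by
    rw [← lie_skew, c.lie_last hV, neg_zero]
  have h2 : ⁅c.horizontal p.1, c.horizontal q.1⁆ ∈ S.V 2 := by
    simp only [horizontal, Fintype.linearCombination_apply, sum_lie,
      lie_sum, smul_lie, lie_smul]
    exact Submodule.sum_mem _ fun i _ => Submodule.smul_mem _ _
      (Submodule.sum_mem _ fun j _ => Submodule.smul_mem _ _ (c.lie_basis_mem hV _ _))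
  obtain ⟨k, hk⟩ := c.exists_smul_eq hV h2
  have h3 : c.form p.1 q.1 = k := by
    simp only [form, LinearMap.mk₂_apply]
    rw [← hk]
    simp
  rw [toLie_snocPoint, toLie_snocPoint, h3, hk]
  simp only [lie_add, add_lie, lie_smul, smul_lie, h1, c.lie_last hV, smul_zero, add_zero]

theorem mul_snocPoint (hV : Module.finrank ℝ (S.V 2) = 1) (c : ExpCoords S (m + 1))
    (p q : (Fin m → ℝ) × ℝ) :
    c.mul (snocPoint p) (snocPoint q) = snocPoint (stepTwoMul c.form p q) := by
  have h1 : ∀ p : EuclideanSpace ℝ (Fin (m + 1)), ∀ i, c.basis.repr (c.toLie p) i = p i := by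
    intro p i
    rw [toLie, c.basis.repr_sum_self]
  ext i
  simp only [mul, ofLie, c.lie_toLie hV, map_add, Finsupp.add_apply, h1, map_smul,
    Finsupp.smul_apply, Module.Basis.repr_self]
  induction i using Fin.lastCases with
  | last => simp [stepTwoMul]
  | cast i => simp [stepTwoMul]

theorem dil_snocPoint (hV : Module.finrank ℝ (S.V 2) = 1) (c : ExpCoords S (m + 1)) (t : ℝ)
    (p : (Fin m → ℝ) × ℝ) : c.dil t (snocPoint p) = snocPoint (t • p.1, t ^ 2 * p.2) := by
  ext i
  simp only [dil]
  induction i using Fin.lastCases with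
  | last => simp [c.deg_last]
  | cast i => simp [c.deg_castSucc hV]

/-- For `m = 0` the algebra is spanned by one central vector, so all brackets vanish and with them
`V 2`. -/
theorem pos_of_finrank (hV : Module.finrank ℝ (S.V 2) = 1) (c : ExpCoords S (m + 1)) :
    0 < m := by
  rcases Nat.eq_zero_or_pos m with rfl | h
  swap
  · exact h
  exfalso
  apply S.V_ne_bot
  rw [← S.bracket_V 1 le_rfl, Submodule.span_eq_bot]
  rintro Z ⟨X, -, Y, -, rfl⟩
  rw [← c.basis.sum_repr Y]
  simp only [Fin.sum_univ_succ, lie_add, lie_smul]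
  have h0 : ⁅X, c.basis 0⁆ = 0 := c.lie_last hV X
  simp [h0]

theorem homogeneousDist (hV : Module.finrank ℝ (S.V 2) = 1) (c : ExpCoords S (m + 1))
    (D : MetricSpace (EuclideanSpace ℝ (Fin (m + 1)))) (hD : c.IsHomogeneousMetric D) :
    HomogeneousDist c.form fun p q => D.dist (snocPoint p) (snocPoint q) where
  alt := c.form_self
  self p := D.dist_self _
  eq_of_zero p q h := by
    have := D.eq_of_dist_eq_zero h
    rw [← splitPoint_snocPoint p, this, splitPoint_snocPoint]
  comm p q := D.dist_comm _ _
  triangle p q r := D.dist_triangle _ _ _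
  left p q r := by
    rw [← c.mul_snocPoint hV, ← c.mul_snocPoint hV]
    exact hD.1 _ _ _
  dil t ht p q := by
    rw [← c.dil_snocPoint hV, ← c.dil_snocPoint hV]
    exact hD.2 t ht _ _

end Carnot.ExpCoords

/-! ### Covers, transversality and discretization at one scale. -/

/-- Covers by small balls of a set of small Hausdorff dimension. -/
theorem exists_cover_of_dimH_lt {X : Type*} [MetricSpace X] [Nonempty X] {K : Set X} {α : NNReal}
    (hα : dimH K < α) {ε : ℝ} (hε : 0 < ε) :
    ∃ (p : ℕ → X) (r : ℕ → ℝ), (∀ j, 0 < r j ∧ r j ≤ ε) ∧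
      (∀ s : Finset ℕ, ∑ j ∈ s, r j ^ (α : ℝ) ≤ 1) ∧ ∀ z ∈ K, ∃ j, dist (p j) z ≤ r j := by
  classical
  borelize X
  have hα0 : 0 < (α : ℝ) := by
    have : (0 : ℝ≥0∞) < α := bot_le.trans_lt hα
    exact_mod_cast this
  have h0 : MeasureTheory.Measure.hausdorffMeasure (α : ℝ) K = 0 := hausdorffMeasure_of_dimH_lt hα
  rw [MeasureTheory.Measure.hausdorffMeasure_apply] at h0
  simp only [ENNReal.iSup_eq_zero] at h0
  have h1 := h0 (ENNReal.ofReal ε) (ENNReal.ofReal_pos.2 hε)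
  have h2 : (0 : ℝ≥0∞) < ENNReal.ofReal (1 / 2) := by simp
  rw [← h1] at h2
  simp only [iInf_lt_iff] at h2
  obtain ⟨t, htK, htd, hts⟩ := h2
  have hfin : ∀ n, Metric.ediam (t n) ≠ ⊤ := fun n => ((htd n).trans_lt ENNReal.ofReal_lt_top).ne
  have hsum : ∀ s : Finset ℕ, ∑ j ∈ s, (Metric.ediam (t j)).toReal ^ (α : ℝ) ≤ 1 / 2 := by
    intro s
    rw [← ENNReal.ofReal_le_ofReal_iff (by norm_num)]
    refine le_trans ?_ hts.le
    rw [ENNReal.ofReal_sum_of_nonneg fun _ _ => by positivity]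
    refine le_trans (Finset.sum_le_sum fun j _ => ?_) (ENNReal.sum_le_tsum s)
    rw [← ENNReal.ofReal_rpow_of_nonneg ENNReal.toReal_nonneg hα0.le,
      ENNReal.ofReal_toReal (hfin j)]
    rcases (t j).eq_empty_or_nonempty with he | hne
    · simp [he, hα0]
    · simp [hne]
  -- Covering sets may have diameter zero, while radii must be positive for a dyadic scale to exist.
  -- The floors `e n` add at most `1/2` to the sum, the diameters the other `1/2`.
  set e : ℕ → ℝ := fun n => min ε (((1 / 2 : ℝ) ^ (n + 2)) ^ ((α : ℝ)⁻¹)) with he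
  have he0 : ∀ n, 0 < e n := fun n => lt_min hε (by positivity)
  have hea : ∀ n, e n ^ (α : ℝ) ≤ (1 / 2 : ℝ) ^ (n + 2) := by
    intro n
    calc e n ^ (α : ℝ) ≤ (((1 / 2 : ℝ) ^ (n + 2)) ^ ((α : ℝ)⁻¹)) ^ (α : ℝ) := by
          refine Real.rpow_le_rpow (he0 n).le (min_le_right _ _) hα0.le
      _ = _ := by rw [← Real.rpow_mul (by positivity), inv_mul_cancel₀ hα0.ne', Real.rpow_one]
  refine ⟨fun n => if h : (t n).Nonempty then h.some else Classical.arbitrary X,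
    fun n => max (Metric.ediam (t n)).toReal (e n), fun j => ⟨(he0 j).trans_le (le_max_right _ _),
      max_le (ENNReal.toReal_le_of_le_ofReal hε.le (htd j)) (min_le_left _ _)⟩, ?_, ?_⟩
  · intro s
    have h3 : ∀ j, max (Metric.ediam (t j)).toReal (e j) ^ (α : ℝ) ≤
        (Metric.ediam (t j)).toReal ^ (α : ℝ) + (1 / 2 : ℝ) ^ (j + 2) := by
      intro j
      have h5 : 0 ≤ (Metric.ediam (t j)).toReal ^ (α : ℝ) := by positivity
      have h6 : (0 : ℝ) ≤ (1 / 2 : ℝ) ^ (j + 2) := by positivity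
      rcases le_total (Metric.ediam (t j)).toReal (e j) with h4 | h4
      · rw [max_eq_right h4]; linarith [hea j]
      · rw [max_eq_left h4]; linarith
    have h4 : ∑ j ∈ s, (1 / 2 : ℝ) ^ (j + 2) ≤ 1 / 2 := by
      have h5 : Summable fun j : ℕ => (1 / 2 : ℝ) ^ j := summable_geometric_two
      calc ∑ j ∈ s, (1 / 2 : ℝ) ^ (j + 2) = (∑ j ∈ s, (1 / 2 : ℝ) ^ j) * (1 / 4) := by
            rw [Finset.sum_mul]
            exact Finset.sum_congr rfl fun j _ => by ring
        _ ≤ 2 * (1 / 4) := by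
            gcongr
            exact (h5.sum_le_tsum s fun _ _ => by positivity).trans_eq tsum_geometric_two
        _ = _ := by norm_num
    calc _ ≤ ∑ j ∈ s, ((Metric.ediam (t j)).toReal ^ (α : ℝ) + (1 / 2 : ℝ) ^ (j + 2)) :=
          Finset.sum_le_sum fun j _ => h3 j
      _ ≤ 1 := by rw [Finset.sum_add_distrib]; linarith [hsum s]
  · intro z hz
    obtain ⟨n, hn⟩ := Set.mem_iUnion.1 (htK hz)
    have hne : (t n).Nonempty := ⟨z, hn⟩
    refine ⟨n, ?_⟩
    simp only [hne, dif_pos]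
    refine le_trans ?_ (le_max_left _ _)
    rw [dist_edist]
    exact ENNReal.toReal_mono (hfin n) (Metric.edist_le_ediam_of_mem hne.some_mem hn)

/-- One of countably many pieces of a set has a definite, geometrically decaying, share of its
measure. -/
theorem exists_large_piece {Y : Type*} [MeasurableSpace Y] (μ : MeasureTheory.Measure Y)
    {A : Set Y} (G : ℕ → Set Y) (hA : A ⊆ ⋃ k, G k) {V x : ℝ} (hV : 0 < V)
    (hμ : ENNReal.ofReal V ≤ μ A) (hx0 : 0 < x) (hx1 : x < 1) :
    ∃ k, ENNReal.ofReal ((1 - x) / 2 * x ^ k * V) ≤ μ (G k) := by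
  by_contra hcon
  push Not at hcon
  have h1 : μ A ≤ ∑' k, ENNReal.ofReal ((1 - x) / 2 * x ^ k * V) :=
    (MeasureTheory.measure_mono hA).trans ((MeasureTheory.measure_iUnion_le G).trans
      (ENNReal.tsum_le_tsum fun k => (hcon k).le))
  -- The factor `(1 - x) / 2` makes the shares add up to `V / 2 < V`.
  have h2 : HasSum (fun k : ℕ => (1 - x) / 2 * x ^ k * V) (V / 2) := by
    have := ((hasSum_geometric_of_lt_one hx0.le hx1).mul_left ((1 - x) / 2)).mul_right V
    have hne : 1 - x ≠ 0 := by linarith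
    have e : (1 - x) / 2 * (1 - x)⁻¹ * V = V / 2 := by field_simp
    rwa [e] at this
  have h1x : 0 < 1 - x := by linarith
  rw [← ENNReal.ofReal_tsum_of_nonneg (fun k => by positivity) h2.summable, h2.tsum_eq] at h1
  have h3 := hμ.trans h1
  rw [ENNReal.ofReal_le_ofReal_iff (by positivity)] at h3
  linarith

/-- Separated points in a set of given measure. -/
theorem exists_separated_finset_of_measure {X : Type*} [PseudoMetricSpace X] [MeasurableSpace X]
    (μ : MeasureTheory.Measure X) {A : Set X} {η V w : ℝ} (hη : 0 ≤ η) (hw : 0 < w) (hV : 0 < V)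
    (hball : ∀ x, μ (Metric.closedBall x η) ≤ ENNReal.ofReal w) (hA : ENNReal.ofReal V ≤ μ A) :
    ∃ S : Finset X, V ≤ S.card * w ∧ (∀ x ∈ S, x ∈ A) ∧
      ∀ x ∈ S, ∀ y ∈ S, x ≠ y → η < dist x y := by
  have hVw : 0 < V / w := by positivity
  have hceil : 0 < ⌈V / w⌉₊ := Nat.ceil_pos.2 hVw
  obtain ⟨n, hn⟩ : ∃ n, ⌈V / w⌉₊ = n + 1 := ⟨⌈V / w⌉₊ - 1, by omega⟩
  have h1 : (n : ℝ) < V / w := by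
    rw [← Nat.lt_ceil]; omega
  obtain ⟨S, hS, hSA, hsep⟩ := exists_separated_finset μ A hη (ENNReal.ofReal w) hball n (by
    refine lt_of_lt_of_le ?_ hA
    rw [← ENNReal.ofReal_natCast, ← ENNReal.ofReal_mul (Nat.cast_nonneg _)]
    rw [ENNReal.ofReal_lt_ofReal_iff hV]
    rwa [← lt_div_iff₀ hw])
  refine ⟨S, ?_, hSA, hsep⟩
  rw [hS, ← hn, ← div_le_iff₀ hw]
  exact Nat.le_ceil _

/-- A family of segments in `K`, one for each small horizontal vector `u`, which are uniformly
transversal to the horizontal distribution. -/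
structure SegmentFamily {m : ℕ} (ω : (Fin m → ℝ) →ₗ[ℝ] (Fin m → ℝ) →ₗ[ℝ] ℝ)
    (K : Set ((Fin m → ℝ) × ℝ)) (r₀ ℓ R : ℝ) (A : (Fin m → ℝ) → Fin m → ℝ)
    (b c : (Fin m → ℝ) → ℝ) : Prop where
  r₀_pos : 0 < r₀
  r₀_le : r₀ ≤ 1
  ℓ_pos : 0 < ℓ
  ℓ_le : ℓ ≤ 1
  mem : ∀ u, ‖u‖ ≤ r₀ → ∀ t, 0 ≤ t → t ≤ ℓ → (A u + t • u, b u + t * c u) ∈ K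
  norm_A : ∀ u, ‖u‖ ≤ r₀ → ‖A u‖ ≤ R
  abs_b : ∀ u, ‖u‖ ≤ r₀ → |b u| ≤ R
  le_c : ∀ u, ‖u‖ ≤ r₀ → 1 / 2 ≤ c u
  c_le : ∀ u, ‖u‖ ≤ r₀ → c u ≤ 2
  -- At the point with time `t` the direction `(u, c u)` is horizontal exactly when `c u = ½ω(A u +
  -- t u, u)`. This is independent of `t` because `ω u u = 0`.
  transversal : ∀ u, ‖u‖ ≤ r₀ → 1 / 2 ≤ |c u - 1 / 2 * ω (A u) u|

/-- The box of radius `s` about `p` for the model gauge. -/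
def InBox {m : ℕ} (ω : (Fin m → ℝ) →ₗ[ℝ] (Fin m → ℝ) →ₗ[ℝ] ℝ) (C s : ℝ)
    (p z : (Fin m → ℝ) × ℝ) : Prop :=
  ‖z.1 - p.1‖ ≤ C * s ∧ |z.2 - p.2 - 1 / 2 * ω p.1 z.1| ≤ C * s ^ 2

/-- A segment transversal to the horizontal distribution meets a box of radius `s` in a set of
diameter `O(s²)`. -/
theorem abs_sub_le_of_inBox {m : ℕ} {ω : (Fin m → ℝ) →ₗ[ℝ] (Fin m → ℝ) →ₗ[ℝ] ℝ}
    (halt : ∀ x, ω x x = 0) {Cω C s : ℝ} (hω : ∀ x y, |ω x y| ≤ Cω * ‖x‖ * ‖y‖) (hCω : 0 ≤ Cω)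
    (hs : Cω * C * s ≤ 1 / 2) {p : (Fin m → ℝ) × ℝ} {a u : Fin m → ℝ} {b c t t' : ℝ}
    (hu : ‖u‖ ≤ 1) (htr : 1 / 2 ≤ |c - 1 / 2 * ω a u|)
    (ht : InBox ω C s p (a + t • u, b + t * c)) (ht' : InBox ω C s p (a + t' • u, b + t' * c)) :
    |t - t'| ≤ 8 * C * s ^ 2 := by
  obtain ⟨h1, h2⟩ := ht
  obtain ⟨-, h3⟩ := ht'
  simp only at h1 h2 h3
  -- Subtracting the two vertical conditions leaves the time difference multiplied by the vertical
  -- speed seen from the centre `p`. That speed is at least `1/4`, since `ω p.1 u` is close to `ω a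
  -- u`.
  have h4 : |(t - t') * (c - 1 / 2 * ω p.1 u)| ≤ 2 * (C * s ^ 2) := by
    have e : (t - t') * (c - 1 / 2 * ω p.1 u) =
        (b + t * c - p.2 - 1 / 2 * ω p.1 (a + t • u)) -
        (b + t' * c - p.2 - 1 / 2 * ω p.1 (a + t' • u)) := by
      simp only [map_add, map_smul, smul_eq_mul]; ring
    rw [e]
    refine (abs_sub _ _).trans ?_
    linarith
  have h5 : ω p.1 u = ω a u - ω (a + t • u - p.1) u := by
    simp only [map_sub, map_add, map_smul, LinearMap.sub_apply, LinearMap.add_apply,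
      LinearMap.smul_apply, halt, smul_zero]
    ring
  have h6 : |ω (a + t • u - p.1) u| ≤ 1 / 2 := by
    refine (hω _ _).trans ?_
    calc Cω * ‖a + t • u - p.1‖ * ‖u‖ ≤ Cω * (C * s) * 1 := by
          have : 0 ≤ C * s := (norm_nonneg _).trans h1
          gcongr
      _ ≤ 1 / 2 := by linarith
  have h7 : 1 / 4 ≤ |c - 1 / 2 * ω p.1 u| := by
    have e : c - 1 / 2 * ω a u = (c - 1 / 2 * ω p.1 u) + -(1 / 2 * ω (a + t • u - p.1) u) := by
      rw [h5]; ring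
    have h8 := abs_add_le (c - 1 / 2 * ω p.1 u) (-(1 / 2 * ω (a + t • u - p.1) u))
    rw [← e, abs_neg, abs_mul, abs_of_pos (by norm_num : (0 : ℝ) < 1 / 2)] at h8
    linarith
  rw [abs_mul] at h4
  nlinarith [abs_nonneg (t - t')]

/-- The box met by a segment is, up to `O(s)`, centred on it. -/
theorem abs_height_sub_le_of_inBox {m : ℕ} {ω : (Fin m → ℝ) →ₗ[ℝ] (Fin m → ℝ) →ₗ[ℝ] ℝ}
    (halt : ∀ x, ω x x = 0) {Cω C s R : ℝ} (hω : ∀ x y, |ω x y| ≤ Cω * ‖x‖ * ‖y‖) (hCω : 0 ≤ Cω)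
    (hC : 0 ≤ C) (hs : 0 ≤ s) (hs1 : s ≤ 1) {p z : (Fin m → ℝ) × ℝ} (hz : ‖z.1‖ ≤ R)
    (h : InBox ω C s p z) : |p.2 - z.2| ≤ (C + Cω * C * R) * s := by
  obtain ⟨h1, h2⟩ := h
  have h3 : ω p.1 z.1 = - ω (z.1 - p.1) z.1 := by simp [halt]
  have h4 : |ω (z.1 - p.1) z.1| ≤ Cω * (C * s) * R := (hω _ _).trans (by gcongr)
  have h5 : C * s ^ 2 ≤ C * s := by gcongr; nlinarith
  rw [h3] at h2
  rw [abs_le] at h2 h4 ⊢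
  have h6 : 0 ≤ Cω * (C * s) * R := by
    have := (norm_nonneg _).trans hz
    positivity
  have e : (C + Cω * C * R) * s = C * s + Cω * (C * s) * R := by ring
  rw [e]
  constructor <;> linarith

theorem InBox.mono {m : ℕ} {ω : (Fin m → ℝ) →ₗ[ℝ] (Fin m → ℝ) →ₗ[ℝ] ℝ} {C s s' : ℝ}
    {p z : (Fin m → ℝ) × ℝ} (h : InBox ω C s p z) (hC : 0 ≤ C) (hs : 0 ≤ s) (hss : s ≤ s') :
    InBox ω C s' p z :=
  ⟨h.1.trans (by gcongr), h.2.trans (by gcongr)⟩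

/-- Choice of boxes met by a segment at separated heights. -/
theorem exists_boxes_of_segment {m : ℕ} {ω : (Fin m → ℝ) →ₗ[ℝ] (Fin m → ℝ) →ₗ[ℝ] ℝ}
    (halt : ∀ x, ω x x = 0) {Cω C δ R : ℝ} (hω : ∀ x y, |ω x y| ≤ Cω * ‖x‖ * ‖y‖) (hCω : 0 ≤ Cω)
    (hC : 1 ≤ C) (hδ : 0 < δ) (hδ1 : δ ≤ 1) (hs : Cω * C * δ ≤ 1 / 2)
    (p : ℕ → (Fin m → ℝ) × ℝ) (Q : Finset ℕ) {a u : Fin m → ℝ} {b c ℓ V : ℝ} (hℓ : ℓ ≤ 1)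
    (hu : ‖u‖ ≤ 1) (ha : ‖a‖ ≤ R) (hc : 1 / 2 ≤ c) (htr : 1 / 2 ≤ |c - 1 / 2 * ω a u|) (hV : 0 < V)
    (hvol : ENNReal.ofReal V ≤ MeasureTheory.volume
      {t : ℝ | (0 ≤ t ∧ t ≤ ℓ) ∧ ∃ j ∈ Q, InBox ω C δ (p j) (a + t • u, b + t * c)}) :
    ∃ J : Finset ℕ, J ⊆ Q ∧ V ≤ J.card * (16 * C * δ ^ 2) ∧
      (∀ q ∈ J, ∃ t, (0 ≤ t ∧ t ≤ ℓ) ∧ ‖(p q).1 - (a + t • u)‖ ≤ C * δ ∧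
        |(p q).2 - (b + t * c)| ≤ (C + Cω * C * (R + 1)) * δ) ∧
      ∀ s ρ : ℝ, δ ≤ ρ → (((J).filter fun q => |(p q).2 - s| ≤ ρ).card : ℝ) * δ ^ 2 ≤
        (10 + 8 * (C + Cω * C * (R + 1))) * ρ := by
  classical
  have hC0 : 0 < C := by linarith
  set C₂ := C + Cω * C * (R + 1) with hC₂
  have hR : 0 ≤ R := (norm_nonneg _).trans ha
  have hC₂0 : 0 ≤ C₂ := by positivity
  -- Times more than `8Cδ²` apart lie in different boxes by `abs_sub_le_of_inBox`. An interval of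
  -- that radius has length `16Cδ²`, so measure `V` yields at least `V/(16Cδ²)` distinct boxes.
  obtain ⟨S, hS, hSA, hsep⟩ := exists_separated_finset_of_measure MeasureTheory.volume
    (η := 8 * C * δ ^ 2) (w := 16 * C * δ ^ 2) (by positivity) (by positivity) hV
    (fun x => by rw [Real.volume_closedBall]; apply ENNReal.ofReal_le_ofReal; linarith) hvol
  simp only [Set.mem_ofPred_eq] at hSA
  choose! hSt j hj using hSA
  have hinj : Set.InjOn j S := by
    intro t ht t' ht' htt
    by_contra hne
    have h1 := hsep t ht t' ht' hne
    have h2 := (hj t' ht').2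
    rw [← htt] at h2
    have h3 := abs_sub_le_of_inBox halt hω hCω hs hu htr (hj t ht).2 h2
    rw [Real.dist_eq] at h1
    linarith
  have hnear : ∀ t ∈ S, |(p (j t)).2 - (b + t * c)| ≤ C₂ * δ := by
    intro t ht
    refine abs_height_sub_le_of_inBox halt hω hCω hC0.le hδ.le hδ1 ?_ (hj t ht).2
    refine (norm_add_le _ _).trans (add_le_add ha ?_)
    rw [norm_smul, Real.norm_eq_abs, abs_of_nonneg (hSt t ht).1]
    have := (hSt t ht).2
    have := (hSt t ht).1
    nlinarith [norm_nonneg u]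
  refine ⟨S.image j, ?_, ?_, ?_, ?_⟩
  · intro q hq
    obtain ⟨t, ht, rfl⟩ := Finset.mem_image.1 hq
    exact (hj t ht).1
  · rwa [Finset.card_image_of_injOn hinj]
  · intro q hq
    obtain ⟨t, ht, rfl⟩ := Finset.mem_image.1 hq
    refine ⟨t, hSt t ht, ?_, hnear t ht⟩
    rw [norm_sub_rev]
    exact (hj t ht).2.1
  · intro s ρ hρ
    rw [Finset.filter_image]
    set S' := S.filter fun t => |(p (j t)).2 - s| ≤ ρ with hS'
    have hρ0 : 0 < ρ := hδ.trans_le hρ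
    have hle : ((S'.image j).card : ℝ) ≤ S'.card := Nat.cast_le.2 Finset.card_image_le
    have hcount : (S'.card : ℝ) ≤ 2 * ((4 + 4 * C₂) * ρ) / (8 * C * δ ^ 2) + 2 := by
      rcases S'.eq_empty_or_nonempty with h0 | ⟨o, ho⟩
      · rw [h0]; simp only [Finset.card_empty, Nat.cast_zero]; positivity
      have h1 := card_le_of_separated (m := 1) S' (fun t _ => t)
        (by positivity : 0 < 8 * C * δ ^ 2) (by positivity : 0 ≤ (4 + 4 * C₂) * ρ) (fun _ => o)
        ?_ ?_
      · rwa [pow_one] at h1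
      · intro t ht t' ht' hne
        have h2 := hsep t (Finset.mem_filter.1 ht).1 t' (Finset.mem_filter.1 ht').1 hne
        rw [Real.dist_eq] at h2
        exact h2.le.trans (norm_le_pi_norm ((fun _ => t : Fin 1 → ℝ) - fun _ => t') 0)
      · intro t ht
        rw [pi_norm_le_iff_of_nonneg (by positivity)]
        intro _
        simp only [Pi.sub_apply, Real.norm_eq_abs]
        have h3 := (Finset.mem_filter.1 ht).2
        have h4 := (Finset.mem_filter.1 ho).2
        have h5 := hnear t (Finset.mem_filter.1 ht).1
        have h6 := hnear o (Finset.mem_filter.1 ho).1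
        have h7 : C₂ * δ ≤ C₂ * ρ := by gcongr
        have h8 : |(t - o) * c| ≤ 2 * ρ + 2 * (C₂ * ρ) := by
          rw [abs_le] at h3 h4 h5 h6 ⊢
          constructor <;> linarith
        rw [abs_mul, abs_of_pos (by linarith : 0 < c)] at h8
        nlinarith [abs_nonneg (t - o)]
    calc ((S'.image j).card : ℝ) * δ ^ 2
        ≤ (2 * ((4 + 4 * C₂) * ρ) / (8 * C * δ ^ 2) + 2) * δ ^ 2 := by
          gcongr
          exact hle.trans hcount
      _ = (1 + C₂) * ρ * C⁻¹ + 2 * δ ^ 2 := by field_simp; ring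
      _ ≤ (1 + C₂) * ρ * 1 + 2 * ρ := by
          gcongr
          · exact inv_le_one_of_one_le₀ hC
          · nlinarith
      _ ≤ _ := by nlinarith

/-- Discretization at a single scale of a set of small dimension which contains a transversal
family of segments. -/
theorem exists_discretization {m : ℕ} {ω : (Fin m → ℝ) →ₗ[ℝ] (Fin m → ℝ) →ₗ[ℝ] ℝ}
    (halt : ∀ x, ω x x = 0) {K : Set ((Fin m → ℝ) × ℝ)} {r₀ ℓ R : ℝ}
    {A : (Fin m → ℝ) → Fin m → ℝ} {b c : (Fin m → ℝ) → ℝ} (F : SegmentFamily ω K r₀ ℓ R A b c)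
    {α C : ℝ} (hα : 0 ≤ α) (hC : 1 ≤ C)
    (hcover : ∀ ε : ℝ, 0 < ε → ∃ (p : ℕ → (Fin m → ℝ) × ℝ) (r : ℕ → ℝ),
      (∀ j, 0 < r j ∧ r j ≤ ε) ∧ (∀ s : Finset ℕ, ∑ j ∈ s, r j ^ α ≤ 1) ∧
      ∀ z ∈ K, ∃ j, InBox ω C (r j) (p j) z)
    {x : ℝ} (hx0 : 0 < x) (hx1 : x < 1) :
    ∃ C₁ : ℝ, 1 ≤ C₁ ∧ ∀ k₀ : ℕ, ∃ k ≥ k₀, ∃ δ : ℝ, δ = (1 / 2) ^ k ∧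
      ∃ (T : Finset (Fin m → ℝ)) (Q : Finset ℕ) (p : ℕ → (Fin m → ℝ) × ℝ)
        (J : (Fin m → ℝ) → Finset ℕ),
        (Q.card : ℝ) * δ ^ α ≤ C₁ ∧ x ^ k ≤ C₁ * (T.card * δ ^ m) ∧
        (∀ u ∈ T, ‖u‖ ≤ r₀) ∧ (∀ u ∈ T, ∀ v ∈ T, u ≠ v → δ ≤ ‖u - v‖) ∧
        ∀ u ∈ T, J u ⊆ Q ∧ x ^ k ≤ C₁ * ((J u).card * δ ^ 2) ∧
          (∀ q ∈ J u, ∃ t, (0 ≤ t ∧ t ≤ ℓ) ∧ ‖(p q).1 - (A u + t • u)‖ ≤ C₁ * δ ∧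
            |(p q).2 - (b u + t * c u)| ≤ C₁ * δ) ∧
          ∀ s ρ : ℝ, δ ≤ ρ →
            (((J u).filter fun q => |(p q).2 - s| ≤ ρ).card : ℝ) * δ ^ 2 ≤ C₁ * ρ := by
  classical
  obtain ⟨Cω, hCω, hω⟩ := exists_bilin_bound ω
  have hr₀ := F.r₀_pos
  have hℓ := F.ℓ_pos
  have hC0 : 0 < C := by linarith
  have h1x : 0 < 1 - x := by linarith
  have hR : 0 ≤ R := (norm_nonneg _).trans (F.norm_A 0 (by simpa using hr₀.le))
  set C₂ := C + Cω * C * (R + 1) with hC₂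
  have hC₂0 : 0 ≤ C₂ := by positivity
  have hCC₂ : C ≤ C₂ := by
    have : 0 ≤ Cω * C * (R + 1) := by positivity
    linarith
  set D₁ : ℝ := 2 ^ α with hD₁
  set D₂ : ℝ := 2 / ((1 - x) * r₀ ^ m) with hD₂
  set D₃ : ℝ := 32 * C / ((1 - x) * ℓ) with hD₃
  have hD₁0 : 0 ≤ D₁ := by positivity
  have hD₂0 : 0 ≤ D₂ := by positivity
  have hD₃0 : 0 ≤ D₃ := by positivity
  refine ⟨D₁ + D₂ + D₃ + (10 + 8 * C₂), by linarith, fun k₀ => ?_⟩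
  -- Below this scale the smallness condition of `abs_sub_le_of_inBox` holds.
  obtain ⟨k₁, hk₁⟩ : ∃ k₁ : ℕ, (1 / 2 : ℝ) ^ k₁ < 1 / (2 * (Cω * C)) :=
    exists_pow_lt_of_lt_one (by positivity) (by norm_num)
  obtain ⟨p, r, hr, hsum, hcov⟩ := hcover ((1 / 2) ^ (max k₀ k₁)) (by positivity)
  have hscale : ∀ j, ∃ k : ℕ, (1 / 2 : ℝ) ^ (k + 1) < r j ∧ r j ≤ (1 / 2) ^ k := fun j =>
    exists_nat_pow_near_of_lt_one (hr j).1
      ((hr j).2.trans (pow_le_one₀ (by norm_num) (by norm_num))) (by norm_num) (by norm_num)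
  choose κ hκ1 hκ2 using hscale
  have hκ : ∀ j, max k₀ k₁ ≤ κ j := by
    intro j
    have h1 := (hκ1 j).trans_le (hr j).2
    rw [pow_lt_pow_iff_right_of_lt_one₀ (by norm_num) (by norm_num)] at h1
    omega
  have hQcard : ∀ k (s : Finset ℕ), (∀ j ∈ s, κ j = k) →
      (s.card : ℝ) * ((1 / 2 : ℝ) ^ k) ^ α ≤ D₁ := by
    intro k s hs
    have h1 : (s.card : ℝ) * ((1 / 2 : ℝ) ^ (k + 1)) ^ α ≤ 1 := by
      refine le_trans ?_ (hsum s)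
      rw [← nsmul_eq_mul]
      apply Finset.card_nsmul_le_sum
      intro j hj
      have := (hκ1 j).le
      rw [hs j hj] at this
      exact Real.rpow_le_rpow (by positivity) this hα
    have h2 : ((1 / 2 : ℝ) ^ k) ^ α = 2 ^ α * ((1 / 2 : ℝ) ^ (k + 1)) ^ α := by
      rw [← Real.mul_rpow (by norm_num) (by positivity)]
      congr 1
      rw [pow_succ]; ring
    rw [h2]
    calc (s.card : ℝ) * (2 ^ α * ((1 / 2 : ℝ) ^ (k + 1)) ^ α)
        = D₁ * (s.card * ((1 / 2 : ℝ) ^ (k + 1)) ^ α) := by ring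
      _ ≤ D₁ * 1 := by gcongr
      _ = _ := mul_one _
  have hQfin : ∀ k, {j | κ j = k}.Finite := by
    intro k
    by_contra hinf
    obtain ⟨n, hn⟩ := exists_nat_gt (D₁ / ((1 / 2 : ℝ) ^ k) ^ α)
    obtain ⟨s, hs, hsn⟩ := Set.Infinite.exists_subset_card_eq hinf n
    have h1 := hQcard k s fun j hj => hs hj
    rw [hsn, ← le_div_iff₀ (by positivity)] at h1
    linarith
  let Q : ℕ → Finset ℕ := fun k => (hQfin k).toFinset
  have hQ : ∀ k j, j ∈ Q k ↔ κ j = k := fun k j => by simp [Q]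
  -- Two pigeonholes: each `u` has a scale whose boxes cover a share `x ^ k` of its segment, and
  -- then one scale serves a share `x ^ k` of the ball of directions.
  let G : (Fin m → ℝ) → ℕ → Set ℝ := fun u k => {t : ℝ | (0 ≤ t ∧ t ≤ ℓ) ∧
    ∃ j ∈ Q k, InBox ω C ((1 / 2) ^ k) (p j) (A u + t • u, b u + t * c u)}
  have hG : ∀ u, ‖u‖ ≤ r₀ → ∃ k, ENNReal.ofReal ((1 - x) / 2 * x ^ k * ℓ) ≤
      MeasureTheory.volume (G u k) := by
    intro u hu
    refine exists_large_piece MeasureTheory.volume (A := Set.Icc 0 ℓ) (G u) ?_ hℓ ?_ hx0 hx1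
    · intro t ht
      obtain ⟨j, hj⟩ := hcov _ (F.mem u hu t ht.1 ht.2)
      exact Set.mem_iUnion.2 ⟨κ j, ⟨ht.1, ht.2⟩, j, (hQ _ _).2 rfl,
        hj.mono hC0.le (hr j).1.le (hκ2 j)⟩
    · rw [Real.volume_Icc, sub_zero]
  let U : ℕ → Set (Fin m → ℝ) := fun k => {u | ‖u‖ ≤ r₀ ∧
    ENNReal.ofReal ((1 - x) / 2 * x ^ k * ℓ) ≤ MeasureTheory.volume (G u k)}
  obtain ⟨k, hk⟩ := exists_large_piece MeasureTheory.volume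
    (A := Metric.closedBall (0 : Fin m → ℝ) r₀) (V := (2 * r₀) ^ m) U (by
      intro u hu
      rw [mem_closedBall_zero_iff] at hu
      obtain ⟨k, hk⟩ := hG u hu
      exact Set.mem_iUnion.2 ⟨k, hu, hk⟩) (by positivity)
      (by rw [Real.volume_pi_closedBall _ hr₀.le, Fintype.card_fin]) hx0 hx1
  set δ : ℝ := (1 / 2) ^ k with hδ
  have hδ0 : 0 < δ := by positivity
  have hδ1 : δ ≤ 1 := pow_le_one₀ (by norm_num) (by norm_num)
  have hxk : 0 < x ^ k := by positivity
  obtain ⟨T, hTV, hTU, hTsep⟩ := exists_separated_finset_of_measure MeasureTheory.volume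
    (η := δ) (w := (2 * δ) ^ m) hδ0.le (by positivity) (by positivity)
    (fun y => by rw [Real.volume_pi_closedBall _ hδ0.le, Fintype.card_fin]) hk
  have hTne : T.Nonempty := by
    by_contra h0
    rw [Finset.not_nonempty_iff_eq_empty.1 h0, Finset.card_empty, Nat.cast_zero, zero_mul] at hTV
    have : 0 < (1 - x) / 2 * x ^ k * (2 * r₀) ^ m := by positivity
    linarith
  -- The selected scale cannot be coarse: the cover contains no large boxes, yet `G u k` is
  -- nonempty.
  have hkk : max k₀ k₁ ≤ k := by
    obtain ⟨u, hu⟩ := hTne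
    have h1 := (hTU u hu).2
    have h2 : 0 < MeasureTheory.volume (G u k) :=
      (ENNReal.ofReal_pos.2 (by positivity)).trans_le h1
    obtain ⟨t, -, j, hj, -⟩ := MeasureTheory.nonempty_of_measure_ne_zero h2.ne'
    rw [← (hQ k j).1 hj]
    exact hκ j
  have hs : Cω * C * δ ≤ 1 / 2 := by
    have h1 : δ ≤ (1 / 2 : ℝ) ^ k₁ :=
      pow_le_pow_of_le_one (by norm_num) (by norm_num) ((le_max_right _ _).trans hkk)
    have h2 := h1.trans hk₁.le
    rw [le_div_iff₀ (by positivity)] at h2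
    linarith
  have hJ : ∀ u ∈ T, ∃ J : Finset ℕ, J ⊆ Q k ∧
      (1 - x) / 2 * x ^ k * ℓ ≤ J.card * (16 * C * δ ^ 2) ∧
      (∀ q ∈ J, ∃ t, (0 ≤ t ∧ t ≤ ℓ) ∧ ‖(p q).1 - (A u + t • u)‖ ≤ C * δ ∧
        |(p q).2 - (b u + t * c u)| ≤ C₂ * δ) ∧
      ∀ s ρ : ℝ, δ ≤ ρ → (((J).filter fun q => |(p q).2 - s| ≤ ρ).card : ℝ) * δ ^ 2 ≤
        (10 + 8 * C₂) * ρ := by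
    intro u hu
    have hur := (hTU u hu).1
    exact exists_boxes_of_segment halt hω hCω.le hC hδ0 hδ1 hs p (Q k) F.ℓ_le
      (hur.trans F.r₀_le) (F.norm_A u hur) (F.le_c u hur) (F.transversal u hur) (by positivity)
      (hTU u hu).2
  choose! J hJQ hJV hJn hJc using hJ
  refine ⟨k, (le_max_left _ _).trans hkk, δ, rfl, T, Q k, p, J, ?_, ?_, fun u hu => (hTU u hu).1,
    fun u hu v hv huv => ?_, fun u hu => ⟨hJQ u hu, ?_, ?_, ?_⟩⟩
  · refine (hQcard k (Q k) fun j hj => (hQ k j).1 hj).trans ?_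
    linarith
  · have h1 : x ^ k ≤ D₂ * (T.card * δ ^ m) := by
      rw [hD₂, div_mul_eq_mul_div, le_div_iff₀ (by positivity)]
      rw [mul_pow, mul_pow] at hTV
      have h2 : (0 : ℝ) < 2 ^ m := by positivity
      refine le_of_mul_le_mul_right ?_ h2
      calc x ^ k * ((1 - x) * r₀ ^ m) * 2 ^ m
          = 2 * ((1 - x) / 2 * x ^ k * (2 ^ m * r₀ ^ m)) := by ring
        _ ≤ 2 * (T.card * (2 ^ m * δ ^ m)) := by gcongr
        _ = _ := by ring
    refine h1.trans ?_
    gcongr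
    linarith
  · rw [← dist_eq_norm]
    exact (hTsep u hu v hv huv).le
  · have h1 : x ^ k ≤ D₃ * ((J u).card * δ ^ 2) := by
      rw [hD₃, div_mul_eq_mul_div, le_div_iff₀ (by positivity)]
      have := hJV u hu
      linarith
    refine h1.trans ?_
    gcongr
    linarith
  · intro q hq
    obtain ⟨t, ht, h1, h2⟩ := hJn u hu q hq
    refine ⟨t, ht, h1.trans ?_, h2.trans ?_⟩ <;> gcongr <;> linarith
  · intro s ρ hρ
    refine (hJc u hu s ρ hρ).trans ?_
    exact mul_le_mul_of_nonneg_right (by linarith) (hδ0.le.trans hρ)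

/-! ### Choice of parameters and the two contradictions. -/

theorem exists_one_lt_pow_lt {s : ℝ} (hs : 1 < s) (n : ℕ) : ∃ z : ℝ, 1 < z ∧ z ^ n < s := by
  have h1 : Filter.Tendsto (fun z : ℝ => z ^ n) (nhdsWithin 1 (Set.Ioi 1)) (nhds 1) := by
    have : ContinuousAt (fun z : ℝ => z ^ n) 1 := by fun_prop
    have := this.tendsto
    rw [one_pow] at this
    exact this.mono_left nhdsWithin_le_nhds
  obtain ⟨z, hz1, hz2⟩ := ((h1.eventually_lt_const hs).and self_mem_nhdsWithin).exists
  exact ⟨z, hz2, hz1⟩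

/-- Choice of the parameters: losses that are powers of `z ^ k` are harmless at scale `2 ^ (-k)`. -/
theorem exists_loss_parameter {α : ℝ} {M K : ℕ} (hα : 2 * α < M) (W : ℝ) :
    ∃ (z : ℝ) (g : ℕ), 1 < z ∧ 1 ≤ g ∧ W ≤ z ^ (2 * g) ∧ ∀ C₁ : ℝ, ∃ k₀ : ℕ, ∀ k ≥ k₀,
      C₁ ≤ z ^ k ∧ 2 * (k : ℝ) + 6 ≤ z ^ (2 * k) ∧ 2 * (z ^ (2 * k)) ^ 7 * (1 / 2) ^ k ≤ 1 ∧
      ∀ q : ℝ, 0 ≤ q → q * ((1 / 2 : ℝ) ^ k) ^ α ≤ C₁ →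
        q ^ 2 * ((1 / 2 : ℝ) ^ k) ^ M * (z ^ (2 * k)) ^ K < 1 := by
  have hs : (1 : ℝ) < min 2 ((2 : ℝ) ^ ((M : ℝ) - 2 * α)) :=
    lt_min (by norm_num) (Real.one_lt_rpow (by norm_num) (by linarith))
  -- With `B = z ^ (2 * k)` and `δ = 2 ^ (-k)`, the bound `z ^ 14 < 2` makes `B ^ 7 * δ` tend to
  -- `0`, and `z ^ (2 * K) < 2 ^ (M - 2α)` lets the gain `δ ^ (M - 2α)` beat the loss `B ^ K`.
  obtain ⟨z, hz, hzs⟩ := exists_one_lt_pow_lt hs (14 + 2 * K)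
  have hz0 : 0 < z := by linarith
  have hz14 : z ^ 14 < 2 :=
    ((pow_le_pow_right₀ hz.le (by omega)).trans_lt hzs).trans_le (min_le_left _ _)
  have hzK : z ^ (2 * K) < (2 : ℝ) ^ ((M : ℝ) - 2 * α) :=
    ((pow_le_pow_right₀ hz.le (by omega)).trans_lt hzs).trans_le (min_le_right _ _)
  obtain ⟨g, hg⟩ := pow_unbounded_of_one_lt W hz
  refine ⟨z, g + 1, hz, by omega, hg.le.trans (pow_le_pow_right₀ hz.le (by omega)), fun C₁ => ?_⟩
  set θ : ℝ := z ^ (2 * K) * (1 / 2 : ℝ) ^ ((M : ℝ) - 2 * α) with hθ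
  have hθ0 : 0 ≤ θ := by positivity
  have hθ1 : θ < 1 := by
    rw [hθ, Real.div_rpow (by norm_num) (by norm_num), Real.one_rpow, mul_one_div,
      div_lt_one (by positivity)]
    exact hzK
  have e1 : ∀ᶠ k : ℕ in Filter.atTop, C₁ ≤ z ^ k :=
    (tendsto_pow_atTop_atTop_of_one_lt hz).eventually_ge_atTop C₁
  have e2 : ∀ᶠ k : ℕ in Filter.atTop, 2 * (k : ℝ) + 6 ≤ z ^ (2 * k) := by
    have h1 := tendsto_pow_const_div_const_pow_of_one_lt 1 hz
    have h2 := h1.eventually_lt_const (by norm_num : (0 : ℝ) < 1 / 8)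
    filter_upwards [h2, Filter.eventually_ge_atTop 1] with k hk hk1
    have hk1' : (1 : ℝ) ≤ k := by exact_mod_cast hk1
    rw [pow_one, div_lt_iff₀ (by positivity)] at hk
    have h3 : z ^ k ≤ z ^ (2 * k) := pow_le_pow_right₀ hz.le (by omega)
    linarith
  have e3 : ∀ᶠ k : ℕ in Filter.atTop, 2 * (z ^ (2 * k)) ^ 7 * (1 / 2) ^ k ≤ 1 := by
    have h1 := tendsto_pow_atTop_nhds_zero_of_lt_one (by positivity : 0 ≤ z ^ 14 / 2)
      (by linarith)
    filter_upwards [h1.eventually_lt_const (by norm_num : (0 : ℝ) < 1 / 2)] with k hk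
    have e : (z ^ (2 * k)) ^ 7 * (1 / 2) ^ k = (z ^ 14 / 2) ^ k := by
      rw [div_eq_mul_one_div (z ^ 14), mul_pow, ← pow_mul, ← pow_mul]
      congr 2
      ring
    rw [mul_assoc, e]
    linarith
  have e4 : ∀ᶠ k : ℕ in Filter.atTop, C₁ ^ 2 * θ ^ k < 1 := by
    have h1 := (tendsto_pow_atTop_nhds_zero_of_lt_one hθ0 hθ1).const_mul (C₁ ^ 2)
    rw [mul_zero] at h1
    exact h1.eventually_lt_const one_pos
  obtain ⟨k₀, hk₀⟩ := Filter.eventually_atTop.1 (e1.and (e2.and (e3.and e4)))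
  refine ⟨k₀, fun k hk => ?_⟩
  obtain ⟨h1, h2, h3, h4⟩ := hk₀ k hk
  refine ⟨h1, h2, h3, fun q hq hqC => lt_of_le_of_lt ?_ h4⟩
  set δ : ℝ := (1 / 2) ^ k with hδ
  have hδ0 : 0 < δ := by positivity
  have e5 : δ ^ M = (δ ^ α) ^ 2 * δ ^ ((M : ℝ) - 2 * α) := by
    rw [← Real.rpow_natCast (δ ^ α), ← Real.rpow_mul hδ0.le, ← Real.rpow_add hδ0,
      ← Real.rpow_natCast]
    congr 1
    push_cast
    ring
  have e6 : δ ^ ((M : ℝ) - 2 * α) = ((1 / 2 : ℝ) ^ ((M : ℝ) - 2 * α)) ^ k := by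
    rw [hδ, ← Real.rpow_natCast, ← Real.rpow_natCast, ← Real.rpow_mul (by norm_num),
      ← Real.rpow_mul (by norm_num), mul_comm]
  have e7 : (z ^ (2 * k)) ^ K = (z ^ (2 * K)) ^ k := by
    rw [← pow_mul, ← pow_mul]; congr 1; ring
  calc q ^ 2 * δ ^ M * (z ^ (2 * k)) ^ K
      = (q * δ ^ α) ^ 2 * ((z ^ (2 * K)) ^ k * ((1 / 2 : ℝ) ^ ((M : ℝ) - 2 * α)) ^ k) := by
        rw [e5, e6, e7]; ring
    _ = (q * δ ^ α) ^ 2 * θ ^ k := by rw [hθ, mul_pow (z ^ (2 * K))]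
    _ ≤ C₁ ^ 2 * θ ^ k := by gcongr

/-- The harmonic sum of the hairbrush argument. -/
theorem sum_inv_one_add_abs_le (k : ℕ) :
    ∑ n ∈ Finset.Icc (-((2 ^ (k + 1) + 1 : ℕ) : ℤ)) ((2 ^ (k + 1) + 1 : ℕ) : ℤ),
      (1 + |(n : ℝ)|)⁻¹ ≤ 2 * (k : ℝ) + 6 := by
  set N := 2 ^ (k + 1) + 1 with hN
  have h1 : ∑ i ∈ Finset.range (N + 1), ((1 : ℝ) + i)⁻¹ ≤ k + 3 := by
    have h2 := harmonic_le_one_add_log (N + 1)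
    have h3 : ((harmonic (N + 1) : ℚ) : ℝ) = ∑ i ∈ Finset.range (N + 1), ((1 : ℝ) + i)⁻¹ := by
      rw [harmonic]
      push_cast
      exact Finset.sum_congr rfl fun i _ => by rw [add_comm]
    rw [← h3]
    refine h2.trans ?_
    have h4 : ((N + 1 : ℕ) : ℝ) ≤ 2 ^ (k + 2) := by
      have : N + 1 ≤ 2 ^ (k + 2) := by
        have : 1 ≤ 2 ^ k := Nat.one_le_two_pow
        rw [hN, pow_succ, pow_succ, pow_succ]; omega
      exact_mod_cast this
    have h5 : Real.log ((N + 1 : ℕ) : ℝ) ≤ k + 2 := by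
      calc Real.log ((N + 1 : ℕ) : ℝ) ≤ Real.log (2 ^ (k + 2)) :=
            Real.log_le_log (by positivity) h4
        _ = (k + 2) * Real.log 2 := by rw [Real.log_pow]; push_cast; ring
        _ ≤ (k + 2) * 1 := by
            gcongr
            have := Real.log_two_lt_d9
            linarith
        _ = _ := mul_one _
    linarith
  have h2 : ∑ n ∈ Finset.Icc (-(N : ℤ)) N, (1 + |(n : ℝ)|)⁻¹ ≤
      2 * ∑ i ∈ Finset.range (N + 1), ((1 : ℝ) + i)⁻¹ := by
    have hmaps : ∀ n ∈ Finset.Icc (-(N : ℤ)) N, n.natAbs ∈ Finset.range (N + 1) := by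
      intro n hn
      rw [Finset.mem_Icc] at hn
      rw [Finset.mem_range]; omega
    rw [← Finset.sum_fiberwise_of_maps_to hmaps, Finset.mul_sum]
    apply Finset.sum_le_sum
    intro i _
    have hcard : ((Finset.Icc (-(N : ℤ)) N).filter fun n => n.natAbs = i).card ≤ 2 := by
      refine (Finset.card_le_card (t := {(i : ℤ), -(i : ℤ)}) ?_).trans Finset.card_le_two
      intro n hn
      have := (Finset.mem_filter.1 hn).2
      simp only [Finset.mem_insert, Finset.mem_singleton]
      omega
    calc ∑ n ∈ Finset.Icc (-(N : ℤ)) N with n.natAbs = i, (1 + |(n : ℝ)|)⁻¹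
        = ∑ n ∈ Finset.Icc (-(N : ℤ)) N with n.natAbs = i, ((1 : ℝ) + i)⁻¹ := by
          apply Finset.sum_congr rfl
          intro n hn
          have h3 := (Finset.mem_filter.1 hn).2
          rw [← h3, Nat.cast_natAbs, Int.cast_abs]
      _ = (((Finset.Icc (-(N : ℤ)) N).filter fun n => n.natAbs = i).card : ℝ) *
            ((1 : ℝ) + i)⁻¹ := by rw [Finset.sum_const, nsmul_eq_mul]
      _ ≤ 2 * ((1 : ℝ) + i)⁻¹ := by
          gcongr
          exact_mod_cast hcard
  linarith

/-- The discretized segments form a family of tubes. -/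
theorem tubeFamily_of_discretization {m : ℕ} {ω : (Fin m → ℝ) →ₗ[ℝ] (Fin m → ℝ) →ₗ[ℝ] ℝ}
    {K : Set ((Fin m → ℝ) × ℝ)} {r₀ ℓ R : ℝ}
    {A : (Fin m → ℝ) → Fin m → ℝ} {b c : (Fin m → ℝ) → ℝ} (F : SegmentFamily ω K r₀ ℓ R A b c)
    (hr : r₀ ≤ 1 / 2) {C₁ B δ : ℝ} (hC₁ : 1 ≤ C₁) (hδ : 0 < δ) (hδ1 : δ ≤ 1)
    (hB : 3 * C₁ + R + 2 ≤ B) {T : Finset (Fin m → ℝ)} {p : ℕ → (Fin m → ℝ) × ℝ}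
    {J : (Fin m → ℝ) → Finset ℕ} (hT : ∀ u ∈ T, ‖u‖ ≤ r₀)
    (hJ : ∀ u ∈ T, ∀ q ∈ J u, ∃ t, (0 ≤ t ∧ t ≤ ℓ) ∧ ‖(p q).1 - (A u + t • u)‖ ≤ C₁ * δ ∧
      |(p q).2 - (b u + t * c u)| ≤ C₁ * δ)
    (hcount : ∀ u ∈ T, ∀ s ρ : ℝ, δ ≤ ρ →
      (((J u).filter fun q => |(p q).2 - s| ≤ ρ).card : ℝ) * δ ^ 2 ≤ C₁ * ρ) :
    TubeFamily T (fun u => (c u)⁻¹ • u) (fun u => A u - (b u / c u) • u) (fun q => (p q).1)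
      (fun q => (p q).2) J δ B := by
  have hR : 0 ≤ R := (norm_nonneg _).trans (F.norm_A 0 (by simpa using F.r₀_pos.le))
  refine ⟨hδ, hδ1, by linarith, ?_, ?_, ?_, ?_⟩
  · intro u hu q hq
    have hur := hT u hu
    have hc := F.le_c u hur
    have hc0 : 0 < c u := by linarith
    obtain ⟨t, ht, h1, h2⟩ := hJ u hu q hq
    -- The segment is reparametrised by height, with slope `u / c u`. Replacing the height on the
    -- segment by that of the box centre produces the second term.
    have e : (p q).1 - (A u - (b u / c u) • u + (p q).2 • (c u)⁻¹ • u) =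
        ((p q).1 - (A u + t • u)) - ((c u)⁻¹ * ((p q).2 - (b u + t * c u))) • u := by
      have : t = (c u)⁻¹ * (t * c u) := by field_simp
      have h3 : (c u)⁻¹ * ((p q).2 - (b u + t * c u)) = (c u)⁻¹ * (p q).2 - b u / c u - t := by
        field_simp; ring
      rw [h3]
      module
    rw [e]
    refine (norm_sub_le _ _).trans ?_
    rw [norm_smul, Real.norm_eq_abs, abs_mul, abs_inv, abs_of_pos hc0]
    have h4 : (c u)⁻¹ ≤ 2 := by rw [inv_le_comm₀ hc0 (by norm_num)]; linarith
    have h5 : (c u)⁻¹ * |(p q).2 - (b u + t * c u)| * ‖u‖ ≤ 2 * (C₁ * δ) * 1 := by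
      gcongr
      linarith
    nlinarith
  · intro u hu s ρ hρ
    refine (hcount u hu s ρ hρ).trans ?_
    exact mul_le_mul_of_nonneg_right (by linarith) (hδ.le.trans hρ)
  · intro u hu q hq
    have hur := hT u hu
    obtain ⟨t, ht, -, h2⟩ := hJ u hu q hq
    have hb := F.abs_b u hur
    have hc := F.le_c u hur
    have hc2 := F.c_le u hur
    have hℓ := F.ℓ_le
    have h3 : C₁ * δ ≤ C₁ := by nlinarith
    have h4 : t * c u ≤ 1 * 2 := by
      gcongr
      linarith
    have h5 : 0 ≤ t * c u := by
      have := ht.1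
      positivity
    rw [abs_le] at h2 hb ⊢
    constructor <;> linarith
  · intro u hu
    have hur := hT u hu
    have hc := F.le_c u hur
    have hc0 : 0 < c u := by linarith
    rw [norm_smul, norm_inv, Real.norm_eq_abs, abs_of_pos hc0, inv_mul_le_iff₀ hc0]
    linarith

/-- A set containing a transversal family of segments with the directions `(u, 1)` has no efficient
covers. -/
theorem false_of_hairbrush {m : ℕ} (hm : 0 < m)
    {ω : (Fin m → ℝ) →ₗ[ℝ] (Fin m → ℝ) →ₗ[ℝ] ℝ}
    (halt : ∀ x, ω x x = 0) {K : Set ((Fin m → ℝ) × ℝ)} {r₀ ℓ R : ℝ}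
    {A : (Fin m → ℝ) → Fin m → ℝ} {b : (Fin m → ℝ) → ℝ}
    (F : SegmentFamily ω K r₀ ℓ R A b fun _ => 1) (hr : r₀ ≤ 1 / 2)
    {α C : ℝ} (hα0 : 0 ≤ α) (hα : 2 * α < m + 5) (hC : 1 ≤ C)
    (hcover : ∀ ε : ℝ, 0 < ε → ∃ (p : ℕ → (Fin m → ℝ) × ℝ) (r : ℕ → ℝ),
      (∀ j, 0 < r j ∧ r j ≤ ε) ∧ (∀ s : Finset ℕ, ∑ j ∈ s, r j ^ α ≤ 1) ∧
      ∀ z ∈ K, ∃ j, InBox ω C (r j) (p j) z) : False := by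
  classical
  obtain ⟨z, g, hz, hg, hW, hk⟩ := exists_loss_parameter (α := α) (M := m + 5) (K := 42 + 15 * m)
    (by push_cast; exact hα) (4 * 3 ^ m)
  have hz0 : 0 < z := by linarith
  obtain ⟨C₁, hC₁, hdisc⟩ := exists_discretization halt F hα0 hC hcover (x := z⁻¹) (by positivity)
    (inv_lt_one_of_one_lt₀ hz)
  have hR : 0 ≤ R := (norm_nonneg _).trans (F.norm_A 0 (by simpa using F.r₀_pos.le))
  obtain ⟨k₀, hk₀⟩ := hk (3 * C₁ + R + 2 + 8 * 16 ^ m + 2 ^ g)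
  obtain ⟨k, hkk, δ, hδ, T, Q, p, J, hQ, hTc, hTr, hsep, hJ⟩ := hdisc k₀
  obtain ⟨h1, h2, h3, h4⟩ := hk₀ k hkk
  rw [← hδ] at h3 h4
  set B := z ^ (2 * k) with hB
  have h16 : (0 : ℝ) < 16 ^ m := by positivity
  have h2g : (0 : ℝ) < 2 ^ g := by positivity
  have hzk1 : 1 ≤ z ^ k := one_le_pow₀ hz.le
  have hzkB : z ^ k ≤ B := pow_le_pow_right₀ hz.le (by omega)
  have hδ0 : 0 < δ := by rw [hδ]; positivity
  have hδ1 : δ ≤ 1 := by rw [hδ]; exact pow_le_one₀ (by norm_num) (by norm_num)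
  -- `B` is the square of `z ^ k`: one factor pays for the share `x ^ k`, the other for `C₁ ≤ z ^
  -- k`.
  have hloss : ∀ X : ℝ, 0 ≤ X → z⁻¹ ^ k ≤ C₁ * X → 1 ≤ X * B := by
    intro X hX h
    rw [inv_pow, inv_le_iff_one_le_mul₀ (by positivity)] at h
    calc 1 ≤ C₁ * X * z ^ k := h
      _ ≤ z ^ k * X * z ^ k := by gcongr; linarith
      _ = X * B := by rw [hB, mul_comm 2 k, pow_mul]; ring
  have hfam := tubeFamily_of_discretization F hr hC₁ hδ0 hδ1 (B := B) (by linarith) hTr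
    (fun u hu => (hJ u hu).2.2.1) (fun u hu => (hJ u hu).2.2.2)
  simp only [inv_one, one_smul] at hfam
  have h2k : (2 : ℝ) ^ k * δ = 1 := by rw [hδ, ← mul_pow]; norm_num
  -- A coarse base `b = 2 ^ g` gives only `k / g` levels. Each costs `4 * 3 ^ m ≤ z ^ (2 * g)`, so
  -- together they cost at most `z ^ (2 * k) = B`.
  have hfinal := hfam.one_le_of_hairbrush hm hsep Q (fun u hu => (hJ u hu).1)
    (fun u hu => hloss _ (by positivity) (hJ u hu).2.1)
    (hloss _ (by positivity) hTc) (b := 2 ^ g) (L := k / g) Nat.one_le_two_pow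
    (by push_cast; linarith) ?_ ?_ ?_ ?_ (by linarith) h3 (2 ^ (k + 1) + 1) ?_
    ((sum_inv_one_add_abs_le k).trans h2)
  · exact absurd (h4 Q.card (Nat.cast_nonneg _) (hQ.trans (by linarith))) (not_lt.2 hfinal)
  · rw [← h2k]
    push_cast
    rw [← pow_mul]
    gcongr
    · norm_num
    · exact Nat.mul_div_le k g
  · rw [← h2k]
    push_cast
    rw [← pow_mul]
    gcongr
    · norm_num
    · exact Nat.lt_mul_div_succ k (by omega)
  · calc ((4 : ℝ) * 3 ^ m) ^ (k / g) ≤ (z ^ (2 * g)) ^ (k / g) := by gcongr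
      _ = z ^ (2 * (g * (k / g))) := by rw [← pow_mul, mul_assoc]
      _ ≤ B := pow_le_pow_right₀ hz.le (by have := Nat.mul_div_le k g; omega)
  · have h5 : ((k / g : ℕ) : ℝ) ≤ k := by exact_mod_cast Nat.div_le_self k g
    have h6 : (0 : ℝ) ≤ k := Nat.cast_nonneg k
    linarith
  · have e : 2 / δ = 2 ^ (k + 1) := by
      rw [div_eq_iff hδ0.ne', pow_succ]
      linarith
    rw [e]
    push_cast
    rfl

/-- Left translated segments through a common point have separated directions. -/
theorem norm_sub_le_of_common_point {m : ℕ} {ω : (Fin m → ℝ) →ₗ[ℝ] (Fin m → ℝ) →ₗ[ℝ] ℝ}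
    (halt : ∀ x, ω x x = 0) {Cω R r₀ η : ℝ} (hω : ∀ x y, |ω x y| ≤ Cω * ‖x‖ * ‖y‖) (hCω : 0 ≤ Cω)
    (hr : r₀ ≤ 1 / 2) (hη : 0 ≤ η) (hη1 : η ≤ 1) (hsmall : Cω * (R + 2) * r₀ ≤ 1 / 2)
    {w a a' u u' : Fin m → ℝ} {t t' c c' : ℝ} (hu : ‖u‖ ≤ r₀) (hu' : ‖u'‖ ≤ r₀) (ha : ‖a‖ ≤ R)
    (ht0 : 0 ≤ t) (ht1 : t ≤ 1)
    (hw : ‖w - (a + t • u)‖ ≤ η) (hw' : ‖w - (a' + t' • u')‖ ≤ η) (hc : 1 / 2 ≤ c) (hc2 : c ≤ 2)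
    (hc' : 1 / 2 ≤ c') (hcu : c = 1 + 1 / 2 * ω a u) (hcu' : c' = 1 + 1 / 2 * ω a' u') :
    ‖u - u'‖ ≤ (4 + 2 * Cω) * (‖c⁻¹ • u - c'⁻¹ • u'‖ + η) := by
  have hc0 : 0 < c := by linarith
  have hc0' : 0 < c' := by linarith
  set v := c⁻¹ • u with hv
  set v' := c'⁻¹ • u' with hv'
  have huv : u = c • v := by rw [hv, smul_smul, mul_inv_cancel₀ hc0.ne', one_smul]
  have huv' : u' = c' • v' := by rw [hv', smul_smul, mul_inv_cancel₀ hc0'.ne', one_smul]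
  have hvn : ‖v'‖ ≤ 2 * r₀ := by
    have h1 := congrArg norm huv'
    rw [norm_smul, Real.norm_eq_abs, abs_of_pos hc0'] at h1
    nlinarith [norm_nonneg v']
  -- Since `ω u u = 0`, the value `ω a u` is unchanged along the segment, so `a` may be replaced by
  -- `w`. Both slopes are then nearly values of the one map `u ↦ u / (1 + ½ω(w,u))`.
  have hdiff : ∀ {a u : Fin m → ℝ} {t : ℝ}, ‖u‖ ≤ r₀ → ‖w - (a + t • u)‖ ≤ η →
      |ω w u - ω a u| ≤ Cω * η * (1 / 2) := by
    intro a u t hu hw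
    have e : ω w u - ω a u = ω (w - (a + t • u)) u := by simp [halt]
    rw [e]
    refine (hω _ _).trans ?_
    gcongr
    linarith
  have h1 := hdiff hu hw
  have h1' := hdiff hu' hw'
  have hwn : ‖w‖ ≤ R + 2 := by
    have e : w = (w - (a + t • u)) + (a + t • u) := by abel
    have h2 := norm_add_le (w - (a + t • u)) (a + t • u)
    rw [← e] at h2
    have h3 := norm_add_le a (t • u)
    rw [norm_smul, Real.norm_eq_abs, abs_of_nonneg ht0] at h3
    have h4 : t * ‖u‖ ≤ 1 * 1 := by
      gcongr
      linarith
    linarith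
  -- The middle term is linear in `u - u'` with norm at most `½‖u - u'‖`, thanks to `hsmall`, and is
  -- absorbed on the left; the last term is the `O(η)` error.
  have hkey : u - u' = c • (v - v') + ((1 / 2 * ω w (u - u')) • v' +
      (1 / 2 * ((ω w u' - ω a' u') - (ω w u - ω a u))) • v') := by
    have h2 : u - u' = c • (v - v') + (c - c') • v' := by
      rw [smul_sub, sub_smul, ← huv', ← huv]; abel
    have h3 : c - c' = 1 / 2 * ω w (u - u') +
        1 / 2 * ((ω w u' - ω a' u') - (ω w u - ω a u)) := by
      rw [hcu, hcu', map_sub]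
      ring
    rw [← add_smul, ← h3]
    exact h2
  have h5 : ‖(1 / 2 * ω w (u - u')) • v'‖ ≤ 1 / 2 * ‖u - u'‖ := by
    rw [norm_smul, Real.norm_eq_abs, abs_mul, abs_of_pos (by norm_num : (0 : ℝ) < 1 / 2)]
    have h6 : |ω w (u - u')| ≤ Cω * (R + 2) * ‖u - u'‖ := (hω _ _).trans (by gcongr)
    calc 1 / 2 * |ω w (u - u')| * ‖v'‖ ≤ 1 / 2 * (Cω * (R + 2) * ‖u - u'‖) * (2 * r₀) :=
          mul_le_mul (by linarith) hvn (norm_nonneg _)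
            (mul_nonneg (by norm_num) ((abs_nonneg _).trans h6))
      _ = (Cω * (R + 2) * r₀) * ‖u - u'‖ := by ring
      _ ≤ _ := by gcongr
  have h6 : ‖(1 / 2 * ((ω w u' - ω a' u') - (ω w u - ω a u))) • v'‖ ≤ Cω * η := by
    rw [norm_smul, Real.norm_eq_abs, abs_mul, abs_of_pos (by norm_num : (0 : ℝ) < 1 / 2)]
    have h7 := abs_sub (ω w u' - ω a' u') (ω w u - ω a u)
    have h8 : |(ω w u' - ω a' u') - (ω w u - ω a u)| ≤ Cω * η := by linarith
    have h9 : ‖v'‖ ≤ 1 := by linarith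
    have h10 : 0 ≤ Cω * η := by positivity
    nlinarith [norm_nonneg v', abs_nonneg ((ω w u' - ω a' u') - (ω w u - ω a u))]
  have h7 : ‖c • (v - v')‖ ≤ 2 * ‖v - v'‖ := by
    rw [norm_smul, Real.norm_eq_abs, abs_of_pos hc0]
    gcongr
  have h8 : ‖u - u'‖ ≤ 2 * ‖v - v'‖ + (1 / 2 * ‖u - u'‖ + Cω * η) := by
    calc ‖u - u'‖ = ‖_‖ := congrArg norm hkey
      _ ≤ ‖c • (v - v')‖ + (‖(1 / 2 * ω w (u - u')) • v'‖ +
          ‖(1 / 2 * ((ω w u' - ω a' u') - (ω w u - ω a u))) • v'‖) :=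
          (norm_add_le _ _).trans (add_le_add le_rfl (norm_add_le _ _))
      _ ≤ _ := by linarith
  have h9 : 0 ≤ Cω * ‖v - v'‖ := by positivity
  nlinarith

/-- A set containing left translates of the segments `I_u` has no efficient covers. -/
theorem false_of_bush {m : ℕ} {ω : (Fin m → ℝ) →ₗ[ℝ] (Fin m → ℝ) →ₗ[ℝ] ℝ}
    (halt : ∀ x, ω x x = 0) {K : Set ((Fin m → ℝ) × ℝ)} {r₀ ℓ R : ℝ}
    {A : (Fin m → ℝ) → Fin m → ℝ} {b : (Fin m → ℝ) → ℝ}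
    (F : SegmentFamily ω K r₀ ℓ R A b fun u => 1 + 1 / 2 * ω (A u) u) (hr : r₀ ≤ 1 / 2)
    {Cω : ℝ} (hω : ∀ x y, |ω x y| ≤ Cω * ‖x‖ * ‖y‖) (hCω : 0 ≤ Cω)
    (hsmall : Cω * (R + 2) * r₀ ≤ 1 / 2)
    {α C : ℝ} (hα0 : 0 ≤ α) (hα : 2 * α < m + 4) (hC : 1 ≤ C)
    (hcover : ∀ ε : ℝ, 0 < ε → ∃ (p : ℕ → (Fin m → ℝ) × ℝ) (r : ℕ → ℝ),
      (∀ j, 0 < r j ∧ r j ≤ ε) ∧ (∀ s : Finset ℕ, ∑ j ∈ s, r j ^ α ≤ 1) ∧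
      ∀ z ∈ K, ∃ j, InBox ω C (r j) (p j) z) : False := by
  classical
  obtain ⟨z, g, hz, -, -, hk⟩ := exists_loss_parameter (α := α) (M := m + 4) (K := 4 + 5 * m)
    (by push_cast; exact hα) 1
  have hz0 : 0 < z := by linarith
  obtain ⟨C₁, hC₁, hdisc⟩ := exists_discretization halt F hα0 hC hcover (x := z⁻¹) (by positivity)
    (inv_lt_one_of_one_lt₀ hz)
  have hR : 0 ≤ R := (norm_nonneg _).trans (F.norm_A 0 (by simpa using F.r₀_pos.le))
  obtain ⟨k₀, hk₀⟩ := hk (3 * C₁ + R + 20 + (4 + 2 * Cω) * C₁)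
  obtain ⟨k, hkk, δ, hδ, T, Q, p, J, hQ, hTc, hTr, hsep, hJ⟩ := hdisc k₀
  obtain ⟨h1, h2, h3, h4⟩ := hk₀ k hkk
  rw [← hδ] at h3 h4
  set B := z ^ (2 * k) with hB
  have hzk1 : 1 ≤ z ^ k := one_le_pow₀ hz.le
  have hzkB : z ^ k ≤ B := pow_le_pow_right₀ hz.le (by omega)
  have hδ0 : 0 < δ := by rw [hδ]; positivity
  have hδ1 : δ ≤ 1 := by rw [hδ]; exact pow_le_one₀ (by norm_num) (by norm_num)
  have hCC : 0 ≤ (4 + 2 * Cω) * C₁ := by positivity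
  have hB20 : 20 ≤ B := by linarith
  have hB1 : 1 ≤ B := by linarith
  have hloss : ∀ X : ℝ, 0 ≤ X → z⁻¹ ^ k ≤ C₁ * X → 1 ≤ X * B := by
    intro X hX h
    rw [inv_pow, inv_le_iff_one_le_mul₀ (by positivity)] at h
    calc 1 ≤ C₁ * X * z ^ k := h
      _ ≤ z ^ k * X * z ^ k := by gcongr; linarith
      _ = X * B := by rw [hB, mul_comm 2 k, pow_mul]; ring
  have hfam := tubeFamily_of_discretization F hr hC₁ hδ0 hδ1 (B := B) (by linarith) hTr
    (fun u hu => (hJ u hu).2.2.1) (fun u hu => (hJ u hu).2.2.2)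
  have hBδ : 2 * B ^ 2 * δ ≤ 1 := by
    refine le_trans ?_ h3
    gcongr
    norm_num
  have hC₁δ : C₁ * δ ≤ 1 := by
    have h5 : C₁ ≤ B := by linarith
    have h6 : C₁ * δ ≤ B * δ := by gcongr
    have h7 : B * δ ≤ B ^ 2 * δ := by gcongr; exact le_self_pow₀ hB1 (by norm_num)
    have h8 : 0 ≤ B ^ 2 * δ := by positivity
    linarith
  have hbush := hfam.card_le_of_bush id hsep ?_ Q (fun u hu => (hJ u hu).1)
    (fun u hu => ?_) hBδ
  · have h5 : 1 ≤ (T.card : ℝ) * δ ^ m * B := hloss _ (by positivity) hTc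
    have h6 : 1 ≤ (Q.card : ℝ) ^ 2 * δ ^ (m + 4) * B ^ (4 + 5 * m) := by
      calc 1 ≤ (T.card : ℝ) * δ ^ m * B := h5
        _ ≤ ((Q.card : ℝ) ^ 2 * δ ^ 4 * (2 * B ^ 2 * (20 * B ^ 4) ^ m)) * δ ^ m * B := by gcongr
        _ ≤ ((Q.card : ℝ) ^ 2 * δ ^ 4 * (B * B ^ 2 * (B * B ^ 4) ^ m)) * δ ^ m * B := by
            gcongr
            linarith
        _ = _ := by rw [← pow_succ', ← pow_succ' B 4, ← pow_mul]; ring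
    exact absurd (h4 Q.card (Nat.cast_nonneg _) (hQ.trans (by linarith))) (not_lt.2 h6)
  · rintro u hu u' hu' ⟨q, hq⟩
    rw [Finset.mem_inter] at hq
    obtain ⟨t, ht, h5, -⟩ := (hJ u hu).2.2.1 q hq.1
    obtain ⟨t', -, h5', -⟩ := (hJ u' hu').2.2.1 q hq.2
    have hur := hTr u hu
    have hur' := hTr u' hu'
    have h6 := norm_sub_le_of_common_point halt hω hCω hr (by positivity) hC₁δ hsmall hur hur'
      (F.norm_A u hur) ht.1 (ht.2.trans F.ℓ_le) h5 h5' (F.le_c u hur) (F.c_le u hur)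
      (F.le_c u' hur') rfl rfl
    refine h6.trans ?_
    have h7 : 4 + 2 * Cω ≤ (4 + 2 * Cω) * C₁ := le_mul_of_one_le_right (by positivity) hC₁
    rw [mul_add, mul_add, ← mul_assoc]
    gcongr
    · linarith
    · linarith
  · exact hloss _ (by positivity) (hJ u hu).2.1

/-! ### The two kinds of Kakeya sets. -/

namespace Carnot

variable {𝔤 : Type*} [LieRing 𝔤] [LieAlgebra ℝ 𝔤] {S : Stratification 𝔤 2} {m : ℕ}

/-- Covers by gauge boxes of a set of small Hausdorff dimension for a homogeneous metric. -/
theorem exists_box_cover (hV : Module.finrank ℝ (S.V 2) = 1) (c : ExpCoords S (m + 1))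
    (D : MetricSpace (EuclideanSpace ℝ (Fin (m + 1)))) (hD : c.IsHomogeneousMetric D) :
    ∃ C : ℝ, 1 ≤ C ∧ ∀ (K : Set (EuclideanSpace ℝ (Fin (m + 1)))) (α : NNReal),
      dimWrt D K < α → ∀ ε : ℝ, 0 < ε → ∃ (p : ℕ → (Fin m → ℝ) × ℝ) (r : ℕ → ℝ),
      (∀ j, 0 < r j ∧ r j ≤ ε) ∧ (∀ s : Finset ℕ, ∑ j ∈ s, r j ^ (α : ℝ) ≤ 1) ∧
      ∀ z ∈ snocPoint ⁻¹' K, ∃ j, InBox c.form C (r j) (p j) z := by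
  have H := c.homogeneousDist hV D hD
  obtain ⟨C, hC, hgauge⟩ := H.gauge_le
  refine ⟨C, hC, fun K α hα ε hε => ?_⟩
  obtain ⟨p, r, hr, hsum, hcov⟩ := @exists_cover_of_dimH_lt _ D ⟨0⟩ K α hα ε hε
  refine ⟨fun j => splitPoint (p j), r, hr, hsum, fun z hz => ?_⟩
  obtain ⟨j, hj⟩ := hcov _ hz
  refine ⟨j, ?_⟩
  obtain ⟨h1, h2⟩ := hgauge (splitPoint (p j)) z
  have h0 := H.nonneg (splitPoint (p j)) z
  simp only [snocPoint_splitPoint] at h0 h1 h2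
  have hj' : D.dist (p j) (snocPoint z) ≤ r j := hj
  exact ⟨h1.trans (by gcongr), h2.trans (by gcongr)⟩

theorem norm_toLp_le {m : ℕ} (u : Fin m → ℝ) : ‖(WithLp.toLp 2 u : EuclideanSpace ℝ (Fin m))‖ ≤
    (m + 1) * ‖u‖ := by
  rw [EuclideanSpace.norm_eq]
  apply Real.sqrt_le_iff.2
  refine ⟨by positivity, ?_⟩
  calc ∑ i, ‖u i‖ ^ 2 ≤ ∑ _i : Fin m, ‖u‖ ^ 2 := by
        gcongr with i
        exact norm_le_pi_norm u i
    _ = m * ‖u‖ ^ 2 := by simp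
    _ ≤ (m + 1) ^ 2 * ‖u‖ ^ 2 := by
        gcongr
        have : (0 : ℝ) ≤ m := Nat.cast_nonneg m
        nlinarith
    _ = _ := by ring

theorem norm_splitPoint_fst_le {m : ℕ} (p : EuclideanSpace ℝ (Fin (m + 1))) :
    ‖(splitPoint p).1‖ ≤ ‖p‖ := by
  rw [pi_norm_le_iff_of_nonneg (norm_nonneg _)]
  exact fun i => PiLp.norm_apply_le p i.castSucc

theorem abs_splitPoint_snd_le {m : ℕ} (p : EuclideanSpace ℝ (Fin (m + 1))) :
    |(splitPoint p).2| ≤ ‖p‖ :=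
  PiLp.norm_apply_le p (Fin.last m)

theorem vec_toLp {m : ℕ} (u : Fin m → ℝ) (t : ℝ) :
    t • vec (WithLp.toLp 2 u) = snocPoint (t • u, t) := by
  ext i
  induction i using Fin.lastCases <;> simp [vec]

theorem norm_vec_sq {m : ℕ} (u : EuclideanSpace ℝ (Fin m)) : ‖vec u‖ ^ 2 = ‖u‖ ^ 2 + 1 := by
  rw [EuclideanSpace.norm_sq_eq, EuclideanSpace.norm_sq_eq, Fin.sum_univ_castSucc]
  simp [vec]

/-- The left translate of `t(u,1)` by `a` has vertical speed `1 + ½ω(a,u)`, so its transversality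
constant is exactly `1`. The slopes, however, now depend on `a`, which is why the bush argument is
used. -/
theorem le_dim_of_isBoundedLTKakeya (hV : Module.finrank ℝ (S.V 2) = 1) (c : ExpCoords S (m + 1))
    (D : MetricSpace (EuclideanSpace ℝ (Fin (m + 1)))) (hD : c.IsHomogeneousMetric D)
    (K : Set (EuclideanSpace ℝ (Fin (m + 1)))) (hK : IsBoundedLTKakeya c K) :
    (((m + 1 : ℕ) : ℝ≥0∞) + 3) / 2 ≤ dimWrt D K := by
  by_contra hlt
  obtain ⟨α, hα1, hα2⟩ := ENNReal.lt_iff_exists_nnreal_btwn.1 (not_le.1 hlt)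
  obtain ⟨C, hC, hcover⟩ := exists_box_cover hV c D hD
  obtain ⟨R, hR, r, hr, hsegs⟩ := hK
  obtain ⟨Cω, hCω, hω⟩ := exists_bilin_bound c.form
  have hα : 2 * (α : ℝ) < m + 4 := by
    rw [ENNReal.lt_div_iff_mul_lt (Or.inl (by norm_num)) (Or.inl (by norm_num))] at hα2
    have h1 : α * 2 < ((m + 1 : ℕ) : NNReal) + 3 := by exact_mod_cast hα2
    have h2 : (α : ℝ) * 2 < ((m + 1 : ℕ) : ℝ) + 3 := by exact_mod_cast h1
    push_cast at h2
    linarith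
  -- In order: `u` stays in the given Euclidean ball, the segment lasts at least up to `t = 1/2`,
  -- and the smallness condition of `false_of_bush` holds.
  set r₀ : ℝ := min (min (r / (m + 1)) (1 / (2 * (m + 1)))) (1 / (2 * (Cω * (R + 2)))) with hr₀
  have hr₀pos : 0 < r₀ := lt_min (lt_min (by positivity) (by positivity)) (by positivity)
  have hm1 : (0 : ℝ) < m + 1 := by positivity
  have hr1 : (m + 1) * r₀ ≤ r := by
    have h1 : r₀ ≤ r / (m + 1) := (min_le_left _ _).trans (min_le_left _ _)
    rw [le_div_iff₀ hm1] at h1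
    linarith
  have hr2 : (m + 1) * r₀ ≤ 1 / 2 := by
    have h1 : r₀ ≤ 1 / (2 * (m + 1)) := (min_le_left _ _).trans (min_le_right _ _)
    rw [le_div_iff₀ (by positivity)] at h1
    linarith
  have hr3 : Cω * (R + 2) * r₀ ≤ 1 / 2 := by
    have h1 : r₀ ≤ 1 / (2 * (Cω * (R + 2))) := min_le_right _ _
    rw [le_div_iff₀ (by positivity)] at h1
    linarith
  have hr4 : r₀ ≤ 1 / 2 := by
    have : (0 : ℝ) ≤ m := Nat.cast_nonneg m
    nlinarith
  have hexp : ∀ u : Fin m → ℝ, ∃ a : EuclideanSpace ℝ (Fin (m + 1)), ‖u‖ ≤ r₀ →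
      ‖a‖ ≤ R ∧ c.mul a '' seg (WithLp.toLp 2 u) ⊆ K := by
    intro u
    by_cases hu : ‖u‖ ≤ r₀
    · obtain ⟨a, ha⟩ := hsegs (WithLp.toLp 2 u) ((norm_toLp_le u).trans
        ((mul_le_mul_of_nonneg_left hu hm1.le).trans hr1))
      exact ⟨a, fun _ => ha⟩
    · exact ⟨0, fun h => absurd h hu⟩
  choose a ha using hexp
  have hform : ∀ u : Fin m → ℝ, ‖u‖ ≤ r₀ → |c.form (splitPoint (a u)).1 u| ≤ 1 / 2 := by
    intro u hu
    have h1 := (norm_splitPoint_fst_le (a u)).trans (ha u hu).1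
    refine (hω _ _).trans ?_
    calc Cω * ‖(splitPoint (a u)).1‖ * ‖u‖ ≤ Cω * R * r₀ := by gcongr
      _ ≤ Cω * (R + 2) * r₀ := by gcongr; linarith
      _ ≤ 1 / 2 := hr3
  have F : SegmentFamily c.form (snocPoint ⁻¹' K) r₀ (1 / 2) R (fun u => (splitPoint (a u)).1)
      (fun u => (splitPoint (a u)).2) fun u => 1 + 1 / 2 * c.form (splitPoint (a u)).1 u := by
    refine ⟨hr₀pos, by linarith, by norm_num, by norm_num, ?_,
      fun u hu => (norm_splitPoint_fst_le _).trans (ha u hu).1,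
      fun u hu => (abs_splitPoint_snd_le _).trans (ha u hu).1, ?_, ?_, ?_⟩
    · intro u hu t ht0 ht1
      apply (ha u hu).2
      refine ⟨t • vec (WithLp.toLp 2 u), ⟨t, ht0, ht1.trans ?_, rfl⟩, ?_⟩
      · have h1 : ‖(WithLp.toLp 2 u : EuclideanSpace ℝ (Fin m))‖ ≤ 1 / 2 :=
          (norm_toLp_le u).trans ((mul_le_mul_of_nonneg_left hu hm1.le).trans hr2)
        have h2 : Real.sqrt (‖(WithLp.toLp 2 u : EuclideanSpace ℝ (Fin m))‖ ^ 2 + 1) ≤ 2 := by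
          rw [Real.sqrt_le_left (by norm_num)]
          nlinarith [norm_nonneg (WithLp.toLp 2 u : EuclideanSpace ℝ (Fin m))]
        gcongr
      · rw [vec_toLp]
        conv_lhs => rw [← snocPoint_splitPoint (a u)]
        rw [c.mul_snocPoint hV]
        congr 1
        refine Prod.ext rfl ?_
        simp only [stepTwoMul, map_smul, smul_eq_mul]
        ring
    · intro u hu
      have := abs_le.1 (hform u hu)
      linarith
    · intro u hu
      have := abs_le.1 (hform u hu)
      linarith
    · intro u _
      rw [add_sub_cancel_right, abs_one]
      norm_num
  exact false_of_bush c.form_self F hr4 hω hCω.le hr3 α.coe_nonneg hα hC (hcover K α hα1)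

/-- The vertical speed is `1` and the slopes are the `u` themselves, hence globally separated, so
the hairbrush applies. Transversality now needs `|ω(a,u)| ≤ 1`, which boundedness of `K` provides
for small `u`. -/
theorem le_dim_of_isBoundedKakeya (hV : Module.finrank ℝ (S.V 2) = 1) (c : ExpCoords S (m + 1))
    (D : MetricSpace (EuclideanSpace ℝ (Fin (m + 1)))) (hD : c.IsHomogeneousMetric D)
    (K : Set (EuclideanSpace ℝ (Fin (m + 1)))) (hK : IsBoundedKakeya K) :
    (((m + 1 : ℕ) : ℝ≥0∞) + 4) / 2 ≤ dimWrt D K := by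
  by_contra hlt
  obtain ⟨α, hα1, hα2⟩ := ENNReal.lt_iff_exists_nnreal_btwn.1 (not_le.1 hlt)
  obtain ⟨C, hC, hcover⟩ := exists_box_cover hV c D hD
  obtain ⟨hbdd, hsegs⟩ := hK
  obtain ⟨R, hR, hRK⟩ := hbdd.exists_pos_norm_le
  obtain ⟨Cω, hCω, hω⟩ := exists_bilin_bound c.form
  have hα : 2 * (α : ℝ) < m + 5 := by
    rw [ENNReal.lt_div_iff_mul_lt (Or.inl (by norm_num)) (Or.inl (by norm_num))] at hα2
    have h1 : α * 2 < ((m + 1 : ℕ) : NNReal) + 4 := by exact_mod_cast hα2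
    have h2 : (α : ℝ) * 2 < ((m + 1 : ℕ) : ℝ) + 4 := by exact_mod_cast h1
    push_cast at h2
    linarith
  set r₀ : ℝ := min (1 / (2 * (m + 1))) (1 / (Cω * R)) with hr₀
  have hr₀pos : 0 < r₀ := lt_min (by positivity) (by positivity)
  have hm1 : (0 : ℝ) < m + 1 := by positivity
  have hr2 : (m + 1) * r₀ ≤ 1 / 2 := by
    have h1 : r₀ ≤ 1 / (2 * (m + 1)) := min_le_left _ _
    rw [le_div_iff₀ (by positivity)] at h1
    linarith
  have hr3 : Cω * R * r₀ ≤ 1 := by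
    have h1 : r₀ ≤ 1 / (Cω * R) := min_le_right _ _
    rw [le_div_iff₀ (by positivity)] at h1
    linarith
  have hr4 : r₀ ≤ 1 / 2 := by
    have : (0 : ℝ) ≤ m := Nat.cast_nonneg m
    nlinarith
  have hvec : ∀ u : Fin m → ℝ, 0 < ‖vec (WithLp.toLp 2 u)‖ := by
    intro u
    have h1 := norm_vec_sq (WithLp.toLp 2 u)
    have h2 : 0 < ‖vec (WithLp.toLp 2 u)‖ ^ 2 := by rw [h1]; positivity
    exact (norm_nonneg _).lt_of_ne fun h0 => by rw [← h0] at h2; norm_num at h2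
  have hexp : ∀ u : Fin m → ℝ, ∃ a : EuclideanSpace ℝ (Fin (m + 1)), ∀ t : ℝ, 0 ≤ t → t ≤ 1 →
      a + t • (‖vec (WithLp.toLp 2 u)‖⁻¹ • vec (WithLp.toLp 2 u)) ∈ K := by
    intro u
    apply hsegs
    rw [norm_smul, norm_inv, norm_norm, inv_mul_cancel₀ (hvec u).ne']
  choose a ha using hexp
  have haR : ∀ u, ‖a u‖ ≤ R := by
    intro u
    have := ha u 0 le_rfl zero_le_one
    rw [zero_smul, add_zero] at this
    exact hRK _ this
  have F : SegmentFamily c.form (snocPoint ⁻¹' K) r₀ (1 / 2) R (fun u => (splitPoint (a u)).1)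
      (fun u => (splitPoint (a u)).2) fun _ => 1 := by
    refine ⟨hr₀pos, by linarith, by norm_num, by norm_num, ?_,
      fun u hu => (norm_splitPoint_fst_le _).trans (haR u),
      fun u hu => (abs_splitPoint_snd_le _).trans (haR u), fun _ _ => by norm_num,
      fun _ _ => by norm_num, ?_⟩
    · intro u hu t ht0 ht1
      have h1 : ‖(WithLp.toLp 2 u : EuclideanSpace ℝ (Fin m))‖ ≤ 1 / 2 :=
        (norm_toLp_le u).trans ((mul_le_mul_of_nonneg_left hu hm1.le).trans hr2)
      have h2 : ‖vec (WithLp.toLp 2 u)‖ ≤ 2 := by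
        have h3 := norm_vec_sq (WithLp.toLp 2 u)
        nlinarith [norm_nonneg (WithLp.toLp 2 u : EuclideanSpace ℝ (Fin m)),
          norm_nonneg (vec (WithLp.toLp 2 u))]
      -- Time `t` along `(u, 1)` is arc length `t * ‖(u, 1)‖`, which is at most `1` for `t ≤ 1/2`.
      have h3 := ha u (t * ‖vec (WithLp.toLp 2 u)‖) (by positivity) (by nlinarith [hvec u])
      rw [smul_smul, mul_assoc, mul_inv_cancel₀ (hvec u).ne', mul_one, vec_toLp] at h3
      have e : snocPoint ((splitPoint (a u)).1 + t • u, (splitPoint (a u)).2 + t * 1) =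
          a u + snocPoint (t • u, t) := by
        ext i
        induction i using Fin.lastCases <;> simp [splitPoint]
      rw [Set.mem_preimage, e]
      exact h3
    · intro u hu
      have h1 : |c.form (splitPoint (a u)).1 u| ≤ 1 := by
        refine (hω _ _).trans ?_
        calc Cω * ‖(splitPoint (a u)).1‖ * ‖u‖ ≤ Cω * R * r₀ := by
              gcongr
              exact (norm_splitPoint_fst_le _).trans (haR u)
          _ ≤ 1 := hr3
      have h2 := abs_le.1 h1
      rw [abs_of_nonneg] <;> linarith
  exact false_of_hairbrush (c.pos_of_finrank hV) c.form_self F hr4 α.coe_nonneg hα hC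
    (hcover K α hα1)

end Carnot

theorem mainTheorem11 {𝔤 : Type*} [LieRing 𝔤] [LieAlgebra ℝ 𝔤]
    (S : Carnot.Stratification 𝔤 2) (hV : Module.finrank ℝ (S.V 2) = 1)
    (m : ℕ) (c : Carnot.ExpCoords S (m + 1))
    (D : MetricSpace (EuclideanSpace ℝ (Fin (m + 1)))) (hD : c.IsHomogeneousMetric D) :
    (∀ K : Set (EuclideanSpace ℝ (Fin (m + 1))), Carnot.IsBoundedLTKakeya c K →
      (((m + 1 : ℕ) : ℝ≥0∞) + 3) / 2 ≤ Carnot.dimWrt D K) ∧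
    (∀ K : Set (EuclideanSpace ℝ (Fin (m + 1))), Carnot.IsBoundedKakeya K →
      (((m + 1 : ℕ) : ℝ≥0∞) + 4) / 2 ≤ Carnot.dimWrt D K) :=
  ⟨Carnot.le_dim_of_isBoundedLTKakeya hV c D hD, Carnot.le_dim_of_isBoundedKakeya hV c D hD⟩
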